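/- Let $G$ be a primitive group of permutations of a finite set $\Omega$ of size $n$ that has more than one minimal normal subgroup (a primitive group of type B). Let $S=(x_1,x_2,x_3)$ be a triple of elements of $G$ with $x_1x_2x_3=1$ and $\langle x_1,x_2,x_3\rangle=G$. For $x\in G$ let $\mathrm{Orb}(x)$ be the number of orbits of $\langle x\rangle$ on $\Omega$, and let the genus of the system $(G,S,\Omega)$ be the integer $g\ge 0$ determined by the Riemann--Hurwitz formula $$\frac{\mathrm{Orb}(x_1)+\mathrm{Orb}(x_2)+\mathrm{Orb}(x_3)}{n}=1+\frac{2(1-g)}{n}.$$ If $g\le 1+\dfrac{n}{460}$, then $\mathrm{soc}(G)\cong L^2=L\times L$ for some finite nonabelian simple group $L$, where the socle $\mathrm{soc}(G)$ is the subgroup of $G$ generated by its minimal normal subgroups. -/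

import Mathlib

universe u v

namespace LowGenus

/-- `N` is a minimal normal subgroup of `G`: minimal among the nontrivial normal subgroups. -/
def IsMinimalNormal {G : Type*} [Group G] (N : Subgroup G) : Prop :=
  Minimal (fun M : Subgroup G => M.Normal ∧ M ≠ ⊥) N

/-- The socle of `G`: the subgroup generated by the minimal normal subgroups of `G`. -/
def socle (G : Type*) [Group G] : Subgroup G :=
  sSup {N : Subgroup G | IsMinimalNormal N}

/-- `G`, acting on `Ω`, is a primitive permutation group of type B: the action is faithful and
primitive, and `G` has more than one minimal normal subgroup. -/
structure IsTypeB (G Ω : Type*) [Group G] [MulAction G Ω] : Prop where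
  faithful : FaithfulSMul G Ω
  primitive : MulAction.IsPreprimitive G Ω
  exists_two_minimal_normal :
    ∃ M N : Subgroup G, IsMinimalNormal M ∧ IsMinimalNormal N ∧ M ≠ N

/-- The number `Orb(x)` of orbits of (the cyclic group generated by) `x` on `Ω`. -/
noncomputable def orbitCount {G : Type*} (Ω : Type*) [Group G] [MulAction G Ω] (x : G) : ℕ :=
  Nat.card (MulAction.orbitRel.Quotient (Subgroup.zpowers x) Ω)

/-- The orbit ratio `OR(x) = Orb(x) / n`, where `n = |Ω|`. -/
noncomputable def orbitRatio {G : Type*} (Ω : Type*) [Group G] [MulAction G Ω] (x : G) : ℚ :=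
  (orbitCount Ω x : ℚ) / (Nat.card Ω : ℚ)

/-- The tuple `S = (x₁, …, x_r)` is a product-`1` system for `G`:
`x₁ x₂ ⋯ x_r = 1` and `x₁, …, x_r` generate `G`. -/
structure IsProductOneSystem {G : Type*} [Group G] {r : ℕ} (S : Fin r → G) : Prop where
  prod_eq_one : (List.ofFn S).prod = 1
  generates : Subgroup.closure (Set.range S) = ⊤

/-- The product-`1` system `(G, S, Ω)` has genus `g`: the Riemann–Hurwitz formula
`OR(x₁) + ⋯ + OR(x_r) = r - 2 + 2 (1 - g) / n` holds, with `n = |Ω|`. -/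
structure IsGenusSystem {G : Type*} (Ω : Type*) [Group G] [MulAction G Ω] {r : ℕ}
    (S : Fin r → G) (g : ℕ) : Prop extends IsProductOneSystem S where
  riemann_hurwitz :
    ∑ i, orbitRatio Ω (S i) = (r : ℚ) - 2 + 2 * (1 - (g : ℚ)) / (Nat.card Ω : ℚ)

end LowGenus

/-!
Let `M ≠ N` be minimal normal subgroups of the primitive group `G`. They centralize each other, and
each of them is transitive; hence both are regular on `Ω`, the centralizer of `M` is `N`, and sending
`m` to the element of `N` which acts on a base point as `m⁻¹` does gives `M ≃* N`. So the socle is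
`M ⊔ N`, isomorphic to `M × M`, and `M` is not commutative. What has to be shown is that `M` is simple,
and for this it is enough that otherwise the orbit ratios `Orb(x) / n` of a generating triple have sum
less than `229 / 230` (`IsTypeB.sum_orbitRatio_lt`): by the Riemann-Hurwitz formula the hypothesis
`g ≤ 1 + n / 460` says that the sum is at least `1 - 1 / 230`.

Pass to `H = G ⧸ N` and the image `A` of `M`, a minimal normal subgroup of `H` with trivial centralizer.
Since `M` is regular, an element `x` has at most as many fixed points on `Ω` as there are elements of `A`
commuting with its image, so by Burnside's lemma its orbit ratio is at most the average `avgFix A x` of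
the ratios `fixRatio A (x ^ j)` (`IsTypeB.orbitRatio_le_avgFix`). If `A` is not simple, it is generated
by at least two commuting nonabelian simple subgroups `T i`, the factors, which `H` permutes transitively
(`exists_isFactorSystem`).

The fixed point ratios are bounded through the factors. A nontrivial automorphism of a finite nonabelian
simple group has fixed subgroup of index at least `8` (`eight_le_index_fixedSubgroup`): if the index
were at most `7`, the fixed subgroup would embed into the centralizer of a nontrivial permutation of
at most six points, which leaves a few orders to exclude. It follows that such a group has order at least `60`. So `y`
has fixed point ratio at most `1 / 8` if it induces a nontrivial automorphism of some `T i`, and at most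
`1 / 60` if it moves some `T i`; the bounds from two factors may be multiplied unless `y` interchanges
them (`IsFactorSystem.fixRatio_le_weight_mul`). On averaging over the powers of `x`, this bounds
`avgFix A x` in terms of the order of `x` (`IsFactorSystem.avgFix_le_of_moved`), if `x` moves some factor.

The group `H` has no nontrivial abelian normal subgroup and has more than `60` elements, so it is not a
quotient of a spherical or Euclidean triangle group, and the orders of a generating triple satisfy
`1 / a + 1 / b + 1 / c < 1` (`IsTriple.hyperbolic`). If each member of the triple moves a factor, the
bounds by order then give the result (`IsFactorSystem.sum_avgFix_lt_of_moved`). If one member fixes all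
factors, the other two permute them in a single cycle, so that they have their full order on each factor,
and the bound for the remaining member comes from its action on one factor or on two of them
(`IsFactorSystem.sum_avgFix_lt_of_fixes`). In a few cases of small order the estimates do not suffice;
in all but one of them some commuting elements generate a normal subgroup, which is impossible in `H`
unless they are trivial (`IsFactorSystem.false_of_two_three_eight`,
`IsFactorSystem.false_of_two_four_six`, `IsFactorSystem.eq_one_of_single`,
`IsFactorSystem.sq_eq_one_of_four_six_two`), and in the other one the permutations of the factors are
incompatible (`IsFactorSystem.smul_eq_of_involutions`).
-/

open scoped Nat

namespace LowGenus

/-! ### Indices and orders in finite nonabelian simple groups -/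

section SimpleOrder

variable {L : Type*} [Group L] [IsSimpleGroup L]

theorem not_isSolvable_of_simple (hL : ∃ a b : L, a * b ≠ b * a) : ¬ Group.IsSolvable L := by
  intro h
  obtain ⟨a, b, hab⟩ := hL
  exact hab (IsSimpleGroup.comm_iff_isSolvable.mpr h a b)

/-- A proper subgroup of a simple group has trivial core, so the group acts faithfully on its
cosets. -/
theorem toPermHom_quotient_injective {C : Subgroup L} (hC : C ≠ ⊤) :
    Function.Injective (MulAction.toPermHom L (L ⧸ C)) := by
  rw [← MonoidHom.ker_eq_bot_iff]
  rcases (inferInstance : (MulAction.toPermHom L (L ⧸ C)).ker.Normal).eq_bot_or_eq_top with h | h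
  · exact h
  · exfalso
    apply hC
    rw [eq_top_iff]
    intro x _
    have hx : x ∈ (MulAction.toPermHom L (L ⧸ C)).ker := by rw [h]; trivial
    rw [MonoidHom.mem_ker] at hx
    have := congrArg (fun e : Equiv.Perm (L ⧸ C) => e ((1 : L) : L ⧸ C)) hx
    simp only [MulAction.toPermHom_apply, MulAction.toPerm_apply, Equiv.Perm.coe_one, id_eq,
      MulAction.Quotient.smul_coe, smul_eq_mul, mul_one] at this
    rw [eq_comm, QuotientGroup.eq] at this
    simpa using this

variable [Finite L]

theorem card_ne_prime_pow (hL : ∃ a b : L, a * b ≠ b * a) (p : ℕ) [Fact p.Prime] (n : ℕ) :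
    Nat.card L ≠ p ^ n := by
  intro h
  have := (IsPGroup.of_card h).isNilpotent
  exact not_isSolvable_of_simple hL inferInstance

theorem not_squarefree_card (hL : ∃ a b : L, a * b ≠ b * a) : ¬ Squarefree (Nat.card L) := by
  intro h
  have := IsZGroup.of_squarefree h
  exact not_isSolvable_of_simple hL inferInstance

/-- The permutation action on the cosets of `C` embeds the group in a symmetric group. -/
theorem card_dvd_factorial_index {C : Subgroup L} (hC : C ≠ ⊤) :
    Nat.card L ∣ (C.index)! := by
  have := Subgroup.card_dvd_of_injective _ (toPermHom_quotient_injective hC)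
  rwa [Nat.card_perm] at this

/-- Sylow's third theorem, in the form used to exclude orders: the number of Sylow `p`-subgroups
of a nonabelian simple group is the index of a proper subgroup. -/
theorem exists_sylow_count (hL : ∃ a b : L, a * b ≠ b * a) (p : ℕ) [Fact p.Prime] {a m : ℕ}
    (hcard : Nat.card L = p ^ a * m) (ha : a ≠ 0) (hm : ¬ p ∣ m) :
    ∃ N : Subgroup L, N ≠ ⊤ ∧ N.index ∣ m ∧ N.index % p = 1 ∧
      ∃ P : Sylow p L, N = Subgroup.normalizer (P : Set L) ∧ Nat.card P = p ^ a := by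
  have hp : p.Prime := Fact.out
  obtain ⟨P⟩ : Nonempty (Sylow p L) := inferInstance
  have hP : Nat.card P = p ^ a := by
    rw [P.card_eq_multiplicity, hcard]
    have hm0 : m ≠ 0 := by rintro rfl; simp at hm
    rw [Nat.factorization_mul (pow_ne_zero _ hp.ne_zero) hm0]
    simp [hp.factorization_self, Nat.factorization_eq_zero_of_not_dvd hm]
  have hidx : (P : Subgroup L).index = m := by
    have := (P : Subgroup L).card_mul_index
    rw [hP, hcard] at this
    exact Nat.eq_of_mul_eq_mul_left (pow_pos hp.pos _) this
  refine ⟨_, ?_, ?_, ?_, P, rfl, hP⟩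
  · intro htop
    have hn : (P : Subgroup L).Normal := Subgroup.normalizer_eq_top_iff.mp htop
    rcases hn.eq_bot_or_eq_top with h | h
    · rw [h, Subgroup.card_bot] at hP
      exact absurd hP.symm (Nat.one_lt_pow ha hp.one_lt).ne'
    · have : Nat.card L = p ^ a := by rw [← hP, h]; exact Subgroup.card_top.symm
      exact card_ne_prime_pow hL p a this
  · rw [← P.card_eq_index_normalizer, ← hidx]
    exact P.card_dvd_index
  · rw [← P.card_eq_index_normalizer]
    have := card_sylow_modEq_one p L
    rw [Nat.ModEq, Nat.mod_eq_of_lt hp.one_lt] at this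
    exact this

theorem squarefree_of_dvd_six {f : ℕ} (hf : f ∣ 6) : Squarefree f :=
  Squarefree.squarefree_of_dvd hf <| by
    rw [show (6 : ℕ) = 2 * 3 by norm_num, Nat.squarefree_mul (by norm_num)]
    exact ⟨Nat.prime_two.prime.squarefree, Nat.prime_three.prime.squarefree⟩

/-- A subgroup of index at most `4` would force the order to divide `24`, which leaves prime powers,
divisors of `6`, and orders `2 ^ a * 3` with at most three Sylow `2`-subgroups. -/
theorem five_le_index (hL : ∃ a b : L, a * b ≠ b * a) {C : Subgroup L} (hC : C ≠ ⊤) :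
    5 ≤ C.index := by
  have h0 : C.index ≠ 0 := Subgroup.index_ne_zero_of_finite
  have h1 : C.index ≠ 1 := by rwa [Ne, Subgroup.index_eq_one]
  have key : ∀ f : ℕ, f ∣ 24 →
      f = 2 ^ 0 ∨ f = 2 ^ 1 ∨ f = 2 ^ 2 ∨ f = 2 ^ 3 ∨ f ∣ 6 ∨ ∃ a, a ≠ 0 ∧ f = 2 ^ a * 3 := by
    intro f hf
    have := Nat.le_of_dvd (by norm_num) hf
    by_cases h : f = 12 ∨ f = 24
    · rcases h with rfl | rfl
      · exact .inr (.inr (.inr (.inr (.inr ⟨2, by norm_num, by norm_num⟩))))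
      · exact .inr (.inr (.inr (.inr (.inr ⟨3, by norm_num, by norm_num⟩))))
    · interval_cases f <;> revert hf h <;> simp
  have h6 : ¬ Nat.card L ∣ 6 := fun h => not_squarefree_card hL (squarefree_of_dvd_six h)
  have hsmall : ∀ N : Subgroup L, N ≠ ⊤ → N.index ∣ 3 → False := by
    intro N hN h3
    have := (card_dvd_factorial_index hN).trans (Nat.factorial_dvd_factorial
      (Nat.le_of_dvd (by norm_num) h3))
    exact h6 this
  by_contra hlt
  have hd : Nat.card L ∣ 24 := (card_dvd_factorial_index hC).trans
    (Nat.factorial_dvd_factorial (show C.index ≤ 4 by omega))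
  have h2 : Fact (Nat.Prime 2) := ⟨Nat.prime_two⟩
  rcases key _ hd with h | h | h | h | h | ⟨a, ha, h⟩
  · exact card_ne_prime_pow hL 2 _ h
  · exact card_ne_prime_pow hL 2 _ h
  · exact card_ne_prime_pow hL 2 _ h
  · exact card_ne_prime_pow hL 2 _ h
  · exact h6 h
  · obtain ⟨N, hN, hN3, -⟩ := exists_sylow_count hL 2 h ha (by norm_num)
    exact hsmall N hN hN3

/-- If `|L| = p ^ a * m` with `a > 0` and `p ∤ m`, then `m` has a divisor `s ≥ 5` with
`s ≡ 1 (mod p)`. -/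
theorem exists_dvd_sylow (hL : ∃ a b : L, a * b ≠ b * a) (p : ℕ) [Fact p.Prime] {a m : ℕ}
    (hcard : Nat.card L = p ^ a * m) (ha : a ≠ 0) (hm : ¬ p ∣ m) :
    ∃ s, 5 ≤ s ∧ s ∣ m ∧ s % p = 1 := by
  obtain ⟨N, hN, h1, h2, -⟩ := exists_sylow_count hL p hcard ha hm
  exact ⟨N.index, five_le_index hL hN, h1, h2⟩

/-- Sylow's third theorem for an order of which only a multiple `p ^ b * n` is known: `n` has a divisor
`s ≥ 5` with `s ≡ 1 (mod p)`. Here `n` may itself be divisible by `p`. -/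
theorem not_dvd_of_sylow (hL : ∃ a b : L, a * b ≠ b * a) (p : ℕ) [hp : Fact p.Prime] {b n : ℕ}
    (hcard : Nat.card L ∣ p ^ b * n) (hpL : p ∣ Nat.card L)
    (hs : ∀ s, 5 ≤ s → s ∣ n → s % p ≠ 1) : False := by
  obtain ⟨a, m, hm, h⟩ := Nat.exists_eq_pow_mul_and_not_dvd (Nat.card_pos (α := L)).ne' p hp.out.ne_one
  have ha : a ≠ 0 := by
    rintro rfl
    rw [pow_zero, one_mul] at h
    exact hm (h ▸ hpL)
  obtain ⟨s, h5, hsm, hs1⟩ := exists_dvd_sylow hL p h ha hm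
  refine hs s h5 (hsm.trans ?_) hs1
  have : m ∣ p ^ b * n := (Dvd.intro_left _ h.symm).trans hcard
  exact (Nat.Coprime.pow_right b ((Nat.Prime.coprime_iff_not_dvd hp.out).mpr hm).symm).dvd_of_dvd_mul_left this

/-- There is no simple group of order `56`: a self-normalizing Sylow `7`-subgroup would have a
normal complement, by Burnside's transfer theorem. -/
theorem card_ne_fiftySix (hL : ∃ a b : L, a * b ≠ b * a) : Nat.card L ≠ 56 := by
  intro h
  have h7 : Fact (Nat.Prime 7) := ⟨by norm_num⟩
  obtain ⟨N, hN, h8, -, P, hNP, hP⟩ :=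
    exists_sylow_count hL 7 (a := 1) (m := 8) (by rw [h]; norm_num) one_ne_zero (by norm_num)
  have hi : N.index = 8 := by
    have := five_le_index hL hN
    have h8' := Nat.le_of_dvd (by norm_num) h8
    generalize N.index = s at *
    interval_cases s <;> revert h8 <;> decide
  have hNc : Nat.card N = 7 := by
    have := N.card_mul_index
    rw [hi, h] at this
    omega
  have hPN : (P : Subgroup L) = N := by
    apply Subgroup.eq_of_le_of_card_ge
    · rw [hNP]; exact Subgroup.le_normalizer
    · rw [hNc, hP]; norm_num
  have hcomm : Subgroup.normalizer (P : Set L) ≤ Subgroup.centralizer (P : Set L) := by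
    have hcyc : IsCyclic P := isCyclic_of_prime_card (p := 7) (by rw [hP]; norm_num)
    intro x hx
    rw [← hNP, ← hPN] at hx
    rw [Subgroup.mem_centralizer_iff]
    intro y hy
    have hc := hcyc.commGroup.mul_comm (⟨y, hy⟩ : P) ⟨x, hx⟩
    simpa [Subtype.ext_iff] using hc
  have hK := MonoidHom.ker_transferSylow_isComplement' P hcomm
  rcases (inferInstance : (MonoidHom.transferSylow P hcomm).ker.Normal).eq_bot_or_eq_top with hb | hb
  · rw [hb, Subgroup.isComplement'_bot_left] at hK
    exact hN (hPN ▸ hK)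
  · rw [hb, Subgroup.isComplement'_top_left] at hK
    rw [hK, Subgroup.card_bot] at hP
    norm_num at hP

end SimpleOrder

/-! ### Fixed points of automorphisms of a simple group -/

section FixedSubgroup
variable {L : Type*} [Group L]

/-- The subgroup of fixed points of an automorphism. -/
def fixedSubgroup (σ : MulAut L) : Subgroup L where
  carrier := {x | σ x = x}
  mul_mem' {a b} ha hb := by
    simp only [Set.mem_ofPred_eq] at *
    rw [map_mul, ha, hb]
  one_mem' := map_one σ
  inv_mem' {a} ha := by
    simp only [Set.mem_ofPred_eq] at *
    rw [map_inv, ha]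

theorem mem_fixedSubgroup {σ : MulAut L} {x : L} : x ∈ fixedSubgroup σ ↔ σ x = x := Iff.rfl

theorem fixedSubgroup_le_pow (σ : MulAut L) (n : ℕ) : fixedSubgroup σ ≤ fixedSubgroup (σ ^ n) := by
  intro x hx
  rw [mem_fixedSubgroup] at *
  induction n with
  | zero => simp
  | succ n ih => rw [pow_succ, MulAut.mul_apply, hx, ih]

theorem fixedSubgroup_ne_top {σ : MulAut L} (hσ : σ ≠ 1) : fixedSubgroup σ ≠ ⊤ := by
  intro h
  apply hσ
  ext x
  have : x ∈ fixedSubgroup σ := by rw [h]; trivial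
  exact this

/-- The permutation of the cosets of the fixed subgroup of `σ` induced by `σ`. -/
def cosetPerm (σ : MulAut L) : Equiv.Perm (L ⧸ fixedSubgroup σ) :=
  Quotient.congr σ.toEquiv (fun a b => by
    change QuotientGroup.leftRel _ a b ↔ QuotientGroup.leftRel _ (σ a) (σ b)
    rw [QuotientGroup.leftRel_apply, QuotientGroup.leftRel_apply, ← map_inv, ← map_mul,
      mem_fixedSubgroup, mem_fixedSubgroup, σ.injective.eq_iff])

theorem cosetPerm_mk (σ : MulAut L) (x : L) :
    cosetPerm σ (x : L ⧸ fixedSubgroup σ) = ((σ x : L) : L ⧸ fixedSubgroup σ) := rfl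

theorem cosetPerm_smul (σ : MulAut L) (x : L) (q : L ⧸ fixedSubgroup σ) :
    cosetPerm σ (x • q) = σ x • cosetPerm σ q := by
  induction q using QuotientGroup.induction_on with
  | H y =>
    rw [MulAction.Quotient.smul_coe, cosetPerm_mk, cosetPerm_mk, MulAction.Quotient.smul_coe]
    simp

theorem cosetPerm_one_coset (σ : MulAut L) :
    cosetPerm σ ((1 : L) : L ⧸ fixedSubgroup σ) = ((1 : L) : L ⧸ fixedSubgroup σ) := by
  rw [cosetPerm_mk, map_one]

theorem cosetPerm_pow_mk (σ : MulAut L) (n : ℕ) (x : L) :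
    (cosetPerm σ ^ n) (x : L ⧸ fixedSubgroup σ) = (((σ ^ n) x : L) : L ⧸ fixedSubgroup σ) := by
  induction n with
  | zero => simp
  | succ n ih => rw [pow_succ', Equiv.Perm.mul_apply, ih, cosetPerm_mk, pow_succ', MulAut.mul_apply]

theorem cosetPerm_ne_one [IsSimpleGroup L] {σ : MulAut L} (hσ : σ ≠ 1) : cosetPerm σ ≠ 1 := by
  intro h
  apply hσ
  ext x
  apply toPermHom_quotient_injective (fixedSubgroup_ne_top hσ)
  ext q
  have := cosetPerm_smul σ x q
  rw [h] at this
  simpa using this.symm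

/-- The cosets of the fixed subgroup other than the base coset. -/
abbrev OtherCoset (σ : MulAut L) := {q : L ⧸ fixedSubgroup σ // q ≠ ((1 : L) : L ⧸ fixedSubgroup σ)}

/-- The restriction of `cosetPerm` to the cosets other than the base coset. -/
def otherPerm (σ : MulAut L) : Equiv.Perm (OtherCoset σ) :=
  (cosetPerm σ).subtypePerm (fun q => by
    rw [not_iff_not, ← (cosetPerm σ).injective.eq_iff (a := q), cosetPerm_one_coset])

theorem smul_one_coset {σ : MulAut L} {c : L} (hc : c ∈ fixedSubgroup σ) :
    c • ((1 : L) : L ⧸ fixedSubgroup σ) = ((1 : L) : L ⧸ fixedSubgroup σ) := by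
  rw [MulAction.Quotient.smul_coe, eq_comm, QuotientGroup.eq]
  simpa using hc

/-- The fixed subgroup of `σ` acts on the cosets other than the base coset. -/
def otherHom (σ : MulAut L) : fixedSubgroup σ →* Equiv.Perm (OtherCoset σ) where
  toFun c := (MulAction.toPerm (c : L) : Equiv.Perm (L ⧸ fixedSubgroup σ)).subtypePerm (fun q => by
    rw [not_iff_not, MulAction.toPerm_apply]
    nth_rw 1 [← smul_one_coset c.2]
    exact smul_left_cancel_iff _)
  map_one' := by ext q; simp
  map_mul' a b := by ext q; simp only [Subgroup.coe_mul, Equiv.Perm.subtypePerm_apply,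
    MulAction.toPerm_apply, mul_smul, Equiv.Perm.mul_apply]

theorem otherHom_injective [IsSimpleGroup L] {σ : MulAut L} (hσ : σ ≠ 1) :
    Function.Injective (otherHom σ) := by
  intro a b hab
  apply Subtype.ext
  apply toPermHom_quotient_injective (fixedSubgroup_ne_top hσ)
  ext q
  by_cases hq : q = ((1 : L) : L ⧸ fixedSubgroup σ)
  · subst hq
    simp only [MulAction.toPermHom_apply, MulAction.toPerm_apply]
    rw [smul_one_coset a.2, smul_one_coset b.2]
  · have := congrArg (fun e : Equiv.Perm (OtherCoset σ) => ((e ⟨q, hq⟩ : OtherCoset σ) : L ⧸ fixedSubgroup σ)) hab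
    simpa [otherHom] using this

theorem otherHom_mem_centralizer (σ : MulAut L) (c : fixedSubgroup σ) :
    otherHom σ c ∈ Subgroup.centralizer {otherPerm σ} := by
  rw [Subgroup.mem_centralizer_singleton_iff]
  ext q
  simp only [otherHom, otherPerm, MonoidHom.coe_mk, OneHom.coe_mk, Equiv.Perm.coe_mul,
    Function.comp_apply, Equiv.Perm.subtypePerm_apply, MulAction.toPerm_apply]
  rw [cosetPerm_smul, mem_fixedSubgroup.mp c.2]

theorem otherPerm_ne_one [IsSimpleGroup L] {σ : MulAut L} (hσ : σ ≠ 1) : otherPerm σ ≠ 1 := by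
  intro h
  apply cosetPerm_ne_one hσ
  ext q
  by_cases hq : q = ((1 : L) : L ⧸ fixedSubgroup σ)
  · subst hq; simp [cosetPerm_one_coset]
  · have := congrArg (fun e : Equiv.Perm (OtherCoset σ) => ((e ⟨q, hq⟩ : OtherCoset σ) : L ⧸ fixedSubgroup σ)) h
    simpa [otherPerm] using this

theorem orderOf_otherPerm [IsSimpleGroup L] {σ : MulAut L} {p : ℕ} (hp : p.Prime)
    (hσ : orderOf σ = p) : orderOf (otherPerm σ) = p := by
  have : Fact p.Prime := ⟨hp⟩
  have h1 : σ ≠ 1 := by rintro rfl; simp at hσ; exact hp.one_lt.ne hσ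
  apply orderOf_eq_prime _ (otherPerm_ne_one h1)
  ext q
  obtain ⟨q, hq⟩ := q
  rw [otherPerm, Equiv.Perm.subtypePerm_pow]
  simp only [Equiv.Perm.subtypePerm_apply, Equiv.Perm.coe_one, id_eq]
  induction q using QuotientGroup.induction_on with
  | H y => rw [cosetPerm_pow_mk, ← hσ, pow_orderOf_eq_one]; rfl

variable [Finite L]

theorem card_otherCoset (σ : MulAut L) : Nat.card (OtherCoset σ) = (fixedSubgroup σ).index - 1 := by
  classical
  have := Fintype.ofFinite (L ⧸ fixedSubgroup σ)
  rw [Nat.card_eq_fintype_card, Fintype.card_subtype_compl, Fintype.card_subtype_eq,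
    ← Nat.card_eq_fintype_card, Subgroup.index]

/-- The fixed subgroup embeds into the centralizer of a permutation of cycle type `p ^ n` on the
cosets other than the base coset. -/
theorem exists_card_fixedSubgroup_dvd [IsSimpleGroup L] {σ : MulAut L}
    [Fintype (OtherCoset σ)] [DecidableEq (OtherCoset σ)] {p : ℕ} (hp : p.Prime)
    (hσ : orderOf σ = p) :
    ∃ n, 1 ≤ n ∧ n * p ≤ (fixedSubgroup σ).index - 1 ∧
      Nat.card (Subgroup.centralizer {otherPerm σ}) =
        ((fixedSubgroup σ).index - 1 - n * p)! * p ^ n * n ! ∧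
      Nat.card (fixedSubgroup σ) ∣ ((fixedSubgroup σ).index - 1 - n * p)! * p ^ n * n ! ∧
      Equiv.Perm.sign (otherPerm σ) = (-1) ^ (n * (p + 1)) := by
  have h1 : σ ≠ 1 := by rintro rfl; simp at hσ; exact hp.one_lt.ne hσ
  have ho := orderOf_otherPerm hp hσ
  obtain ⟨n, hn⟩ := Equiv.Perm.cycleType_prime_order (σ := otherPerm σ) (by rw [ho]; exact hp)
  rw [ho] at hn
  have hk := card_otherCoset σ
  have hc : Nat.card (Subgroup.centralizer {otherPerm σ}) =
        ((fixedSubgroup σ).index - 1 - (n + 1) * p)! * p ^ (n + 1) * (n + 1)! := by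
    rw [Equiv.Perm.nat_card_centralizer, hn, ← hk, Nat.card_eq_fintype_card]
    have hf : (Multiset.replicate (n + 1) p).toFinset = {p} := by
      ext a
      simp only [Multiset.mem_toFinset, Multiset.mem_replicate, Finset.mem_singleton]
      omega
    rw [hf, Finset.prod_singleton, Multiset.count_replicate_self, Multiset.sum_replicate,
      Multiset.prod_replicate, smul_eq_mul]
  refine ⟨n + 1, by omega, ?_, hc, ?_, ?_⟩
  · have := Equiv.Perm.sum_cycleType_le (otherPerm σ)
    rw [hn, ← Nat.card_eq_fintype_card, hk] at this
    rwa [Multiset.sum_replicate, smul_eq_mul] at this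
  · rw [← hc]
    exact Subgroup.card_dvd_of_injective
      ((otherHom σ).codRestrict _ (otherHom_mem_centralizer σ))
      ((MonoidHom.injective_codRestrict _ _ _).mpr (otherHom_injective h1))
  · rw [Equiv.Perm.sign_of_cycleType, hn, Multiset.sum_replicate, Multiset.card_replicate,
      smul_eq_mul, mul_add, mul_one]

end FixedSubgroup

/-! ### Fixed subgroups of automorphisms have index at least eight -/

section IndexEight
variable {L : Type*} [Group L] [IsSimpleGroup L]

/-- A nonabelian simple group acts by even permutations. -/
theorem sign_toPerm_eq_one (hL : ∃ a b : L, a * b ≠ b * a) {X : Type*} [Fintype X] [DecidableEq X]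
    [MulAction L X] (x : L) : Equiv.Perm.sign (MulAction.toPerm x : Equiv.Perm X) = 1 := by
  let f : L →* ℤˣ := Equiv.Perm.sign.comp (MulAction.toPermHom L X)
  rcases (inferInstance : f.ker.Normal).eq_bot_or_eq_top with h | h
  · rw [MonoidHom.ker_eq_bot_iff] at h
    obtain ⟨a, b, hab⟩ := hL
    exact absurd (h (by rw [map_mul, map_mul, mul_comm])) hab
  · have : x ∈ f.ker := by rw [h]; trivial
    exact this

variable [Finite L]

/-- An automorphism of order `2` of a simple group of order `168` cannot have fixed subgroup of
index `7` and act as an odd permutation on the cosets: some transposition would then normalize the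
image of the group in the symmetric group of degree `7`, which Jordan's theorem excludes. -/
theorem false_of_index_seven (hL : ∃ a b : L, a * b ≠ b * a) {σ : MulAut L} (hσ : orderOf σ = 2)
    (hidx : (fixedSubgroup σ).index = 7) (hcard : Nat.card (fixedSubgroup σ) = 24)
    (hcent : Nat.card (Subgroup.centralizer {otherPerm σ}) = 48)
    [Fintype (OtherCoset σ)] [DecidableEq (OtherCoset σ)]
    (hsign : Equiv.Perm.sign (otherPerm σ) = -1) : False := by
  classical
  have hσ1 : σ ≠ 1 := by rintro rfl; simp at hσ
  have hCtop := fixedSubgroup_ne_top hσ1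
  set X := L ⧸ fixedSubgroup σ with hX
  have := Fintype.ofFinite X
  have hX7 : Nat.card X = 7 := hidx
  set Z := Subgroup.centralizer {otherPerm σ} with hZ
  -- the image of the fixed subgroup in the centralizer is the subgroup of even permutations
  have hsC : ∀ c : fixedSubgroup σ, Equiv.Perm.sign (otherHom σ c) = 1 := by
    intro c
    have h := Equiv.Perm.sign_subtypePerm (MulAction.toPerm (c : L) : Equiv.Perm X)
      (p := fun q => q ≠ ((1 : L) : L ⧸ fixedSubgroup σ)) (fun q => by
        rw [not_iff_not, MulAction.toPerm_apply]
        nth_rw 1 [← smul_one_coset c.2]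
        exact smul_left_cancel_iff _) (by
        rintro q hq rfl
        exact hq (smul_one_coset c.2))
    rw [sign_toPerm_eq_one hL] at h
    have h2 : Equiv.Perm.sign (otherHom σ c) = 1 := by convert h; rfl
    exact h2
  let R : Subgroup Z := ((otherHom σ).codRestrict Z (otherHom_mem_centralizer σ)).range
  let E : Subgroup Z := (Equiv.Perm.sign.comp Z.subtype).ker
  have hRE : R ≤ E := by
    rintro _ ⟨c, rfl⟩
    exact hsC c
  have hRcard : Nat.card R = 24 := by
    rw [← hcard]
    exact (Nat.card_congr (MonoidHom.ofInjective
      ((MonoidHom.injective_codRestrict _ _ (otherHom_mem_centralizer σ)).mpr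
        (otherHom_injective hσ1))).toEquiv).symm
  have hEcard : Nat.card E ≤ 24 := by
    have hne : E ≠ ⊤ := by
      intro h
      have : (⟨otherPerm σ, Subgroup.mem_centralizer_singleton_iff.mpr rfl⟩ : Z) ∈ E := by
        rw [h]; trivial
      have h1 : Equiv.Perm.sign (otherPerm σ) = 1 := this
      rw [hsign] at h1
      exact absurd h1 (by decide)
    have h1 := E.card_mul_index
    rw [hcent] at h1
    have h2 : E.index ≠ 1 := by rwa [Ne, Subgroup.index_eq_one]
    have h3 : E.index ≠ 0 := Subgroup.index_ne_zero_of_finite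
    have : 2 ≤ E.index := by omega
    nlinarith
  have hREeq : R = E := Subgroup.eq_of_le_of_card_ge hRE (by omega)
  -- a transposition exchanging two points in one orbit of `otherPerm σ`
  obtain ⟨a, ha⟩ : ∃ a, otherPerm σ a ≠ a := by
    by_contra! h
    exact otherPerm_ne_one hσ1 (Equiv.ext h)
  have hinv : ∀ q, otherPerm σ (otherPerm σ q) = q := by
    intro q
    have := pow_orderOf_eq_one (otherPerm σ)
    rw [orderOf_otherPerm Nat.prime_two hσ, pow_two] at this
    exact congrArg (fun e => e q) this
  set τ := Equiv.swap a (otherPerm σ a) with hτ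
  have hτs : τ.IsSwap := ⟨a, otherPerm σ a, ha.symm, rfl⟩
  have hτZ : τ ∈ Z := by
    rw [hZ, Subgroup.mem_centralizer_singleton_iff]
    have := Equiv.swap_mul_eq_mul_swap (otherPerm σ) a (otherPerm σ a)
    have hi : ∀ q, (otherPerm σ)⁻¹ q = otherPerm σ q := by
      intro q
      rw [Equiv.Perm.inv_eq_iff_eq, hinv]
    rw [hi, hi, hinv, Equiv.swap_comm (otherPerm σ a) a] at this
    exact this
  obtain ⟨c, hc⟩ : ∃ c, otherHom σ c = τ * otherPerm σ := by
    have hmem : (⟨τ * otherPerm σ, Z.mul_mem hτZ (Subgroup.mem_centralizer_singleton_iff.mpr rfl)⟩ :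
        Z) ∈ E := by
      change Equiv.Perm.sign (τ * otherPerm σ) = 1
      rw [map_mul, hsign, hτs.sign_eq]
      decide
    rw [← hREeq] at hmem
    obtain ⟨c, hc⟩ := hmem
    exact ⟨c, congrArg Subtype.val hc⟩
  -- the corresponding transposition of all the cosets
  set ρ : Equiv.Perm X := Equiv.swap (a : X) (otherPerm σ a : X) with hρ
  have hρs : ρ.IsSwap := ⟨a, otherPerm σ a, fun h => ha (Subtype.ext h.symm), rfl⟩
  have hρeq : ∀ q : X, (c : L) • q = ρ (cosetPerm σ q) := by
    intro q
    by_cases hq : q = ((1 : L) : L ⧸ fixedSubgroup σ)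
    · subst hq
      rw [smul_one_coset c.2, cosetPerm_one_coset, hρ, Equiv.swap_apply_of_ne_of_ne]
      · exact a.2.symm
      · exact (otherPerm σ a).2.symm
    · have h := congrArg (fun e : Equiv.Perm (OtherCoset σ) => ((e ⟨q, hq⟩ : OtherCoset σ) : X)) hc
      have h1 : ((otherPerm σ ⟨q, hq⟩ : OtherCoset σ) : X) = cosetPerm σ q := rfl
      have h2 : ((otherHom σ c ⟨q, hq⟩ : OtherCoset σ) : X) = (c : L) • q := rfl
      simp only [Equiv.Perm.mul_apply] at h
      rw [h2] at h
      rw [h, hρ, ← h1, hτ]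
      rw [Equiv.swap_apply_def, Equiv.swap_apply_def]
      simp only [Subtype.ext_iff]
      split_ifs <;> rfl
  let Λ : Subgroup (Equiv.Perm X) := (MulAction.toPermHom L X).range
  have hρΛ : ρ ∈ Subgroup.normalizer (Λ : Set (Equiv.Perm X)) := by
    have hc' : (MulAction.toPerm (c : L) : Equiv.Perm X) = ρ * cosetPerm σ := Equiv.ext hρeq
    have h1 : cosetPerm σ ∈ Subgroup.normalizer (Λ : Set (Equiv.Perm X)) := by
      rw [Subgroup.mem_normalizer_iff]
      have hconj : ∀ x : L, cosetPerm σ * MulAction.toPerm x * (cosetPerm σ)⁻¹ =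
          (MulAction.toPerm (σ x) : Equiv.Perm X) := by
        intro x
        rw [mul_inv_eq_iff_eq_mul]
        exact Equiv.ext fun q => cosetPerm_smul σ x q
      intro h
      constructor
      · rintro ⟨x, rfl⟩
        exact ⟨σ x, (hconj x).symm⟩
      · rintro ⟨x, hx⟩
        refine ⟨σ.symm x, ?_⟩
        have := hconj (σ.symm x)
        rw [MulEquiv.apply_symm_apply] at this
        have h2 := this.trans hx
        exact mul_left_cancel (mul_right_cancel h2)
    have h2 : ρ = MulAction.toPerm (c : L) * (cosetPerm σ)⁻¹ := by rw [hc', mul_inv_cancel_right]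
    rw [h2]
    refine Subgroup.mul_mem _ (Subgroup.le_normalizer ?_) (Subgroup.inv_mem _ h1)
    exact ⟨c, rfl⟩
  have hΛtrans : MulAction.IsPretransitive (Λ ⊔ Subgroup.zpowers ρ : Subgroup (Equiv.Perm X)) X := by
    refine ⟨fun p q => ?_⟩
    obtain ⟨x, hx⟩ := MulAction.exists_smul_eq L p q
    exact ⟨⟨MulAction.toPerm x, Subgroup.mem_sup_left ⟨x, rfl⟩⟩, hx⟩
  have htop := Equiv.Perm.subgroup_eq_top_of_isPreprimitive_of_isSwap_mem
    (G := Λ ⊔ Subgroup.zpowers ρ)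
    (MulAction.IsPreprimitive.of_prime_card (by rw [hX7]; norm_num)) ρ hρs
    (Subgroup.mem_sup_right (Subgroup.mem_zpowers ρ))
  have hn : Λ.Normal := by
    rw [← Subgroup.normalizer_eq_top_iff, eq_top_iff, ← htop, sup_le_iff]
    exact ⟨Subgroup.le_normalizer, by rwa [Subgroup.zpowers_le]⟩
  have hrel := Subgroup.relIndex_sup_right (Subgroup.zpowers ρ) Λ
  rw [sup_comm, htop, Subgroup.relIndex_top_right] at hrel
  have hle : Λ.index ≤ 2 := by
    rw [hrel]
    have h1 : Λ.relIndex (Subgroup.zpowers ρ) ∣ Nat.card (Subgroup.zpowers ρ) :=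
      Subgroup.relIndex_dvd_card _ _
    have hρ2 : orderOf ρ ∣ 2 := orderOf_dvd_of_pow_eq_one (by rw [pow_two, hρ, Equiv.swap_mul_self])
    rw [Nat.card_zpowers] at h1
    exact Nat.le_of_dvd (by norm_num) (h1.trans hρ2)
  have hΛcard : Nat.card Λ = 168 := by
    rw [← Nat.card_congr (MonoidHom.ofInjective (toPermHom_quotient_injective hCtop)).toEquiv]
    rw [← (fixedSubgroup σ).card_mul_index, hidx, hcard]
  have := Λ.card_mul_index
  rw [hΛcard, Nat.card_perm, hX7] at this
  have h7 : (7)! = 5040 := rfl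
  omega

/-- The case of index `7` and fixed subgroup of order dividing `48`: the group has order `56` or
`168`. -/
theorem false_of_index_seven_of_dvd (hL : ∃ a b : L, a * b ≠ b * a) {σ : MulAut L} (hσ1 : σ ≠ 1)
    (hk : (fixedSubgroup σ).index = 7) (h48 : Nat.card (fixedSubgroup σ) ∣ 48)
    (hne : Nat.card (fixedSubgroup σ) ≠ 24) : False := by
  have hCtop := fixedSubgroup_ne_top hσ1
  have hmul := (fixedSubgroup σ).card_mul_index
  rw [hk] at hmul
  obtain ⟨c, hc⟩ : ∃ c, Nat.card (fixedSubgroup σ) = c := ⟨_, rfl⟩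
  rw [hc] at hmul h48 hne
  have : Fact (Nat.Prime 7) := ⟨by norm_num⟩
  have h1 : Nat.card L ∣ 336 := hmul ▸ Nat.mul_dvd_mul_right h48 7
  have h2 : Nat.card L ∣ 168 := by
    have : Nat.card L ∣ 2520 := by
      classical
      have hX7 : Nat.card (L ⧸ fixedSubgroup σ) = 7 := hk
      have := Fintype.ofFinite (L ⧸ fixedSubgroup σ)
      let f : L →* alternatingGroup (L ⧸ fixedSubgroup σ) :=
        (MulAction.toPermHom L (L ⧸ fixedSubgroup σ)).codRestrict _
          (fun x => Equiv.Perm.mem_alternatingGroup.mpr (sign_toPerm_eq_one hL x))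
      have hf := Subgroup.card_dvd_of_injective f
        ((MonoidHom.injective_codRestrict _ _ _).mpr (toPermHom_quotient_injective hCtop))
      have : Nontrivial (L ⧸ fixedSubgroup σ) := by
        rw [← Finite.one_lt_card_iff_nontrivial, hX7]; norm_num
      rwa [nat_card_alternatingGroup, hX7] at hf
    exact Nat.dvd_gcd h1 this
  have hc24 : c ∣ 24 :=
    Nat.dvd_of_mul_dvd_mul_right (by norm_num : 0 < 7) (by rw [hmul]; exact h2)
  have h7c : ¬ 7 ∣ c := fun h => absurd (h.trans hc24) (by norm_num)
  obtain ⟨s, hs5, hsc, hs⟩ := exists_dvd_sylow hL 7 (a := 1) (m := c) (by rw [← hmul]; ring)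
    one_ne_zero h7c
  have aux : ∀ s ≤ 24, s ∣ 24 → 5 ≤ s → s % 7 = 1 → s = 8 := by decide
  have hs8 := aux s (Nat.le_of_dvd (by norm_num) (hsc.trans hc24)) (hsc.trans hc24) hs5 hs
  rw [hs8] at hsc
  have aux2 : ∀ c ≤ 24, c ∣ 24 → 8 ∣ c → c = 8 ∨ c = 24 := by decide
  rcases aux2 c (Nat.le_of_dvd (by norm_num) hc24) hc24 hsc with rfl | rfl
  · exact card_ne_fiftySix hL hmul.symm
  · exact hne rfl

/-- The index `k` of the fixed subgroup is `5`, `6` or `7` if it is less than `8`, so `p` is `2`, `3` or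
`5`, and `otherPerm σ` is a product of `n` cycles of length `p` with `n * p ≤ k - 1`. The order of the
fixed subgroup divides the order of the centralizer of such a permutation. Sylow's theorem excludes
most of the resulting orders of the group; order `168` with `k = 7` is left to
`false_of_index_seven`. -/
theorem eight_le_index_of_prime (hL : ∃ a b : L, a * b ≠ b * a) {σ : MulAut L} {p : ℕ}
    (hp : p.Prime) (hσ : orderOf σ = p) : 8 ≤ (fixedSubgroup σ).index := by
  classical
  have hσ1 : σ ≠ 1 := by rintro rfl; simp at hσ; exact hp.one_lt.ne hσ
  have hCtop := fixedSubgroup_ne_top hσ1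
  have h5 := five_le_index hL hCtop
  have := Fintype.ofFinite (OtherCoset σ)
  obtain ⟨n, hn1, hn, hcent, hdvd, hsign⟩ := exists_card_fixedSubgroup_dvd hp hσ
  have hmul := (fixedSubgroup σ).card_mul_index
  have hfac := card_dvd_factorial_index hCtop
  by_contra! hlt
  have f2 : Fact (Nat.Prime 2) := ⟨by norm_num⟩
  have f3 : Fact (Nat.Prime 3) := ⟨by norm_num⟩
  have f5 : Fact (Nat.Prime 5) := ⟨by norm_num⟩
  have f7 : Fact (Nat.Prime 7) := ⟨by norm_num⟩
  have hp2 := hp.two_le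
  have hp7 : p ≤ 6 := (Nat.le_mul_of_pos_left p hn1).trans (by omega)
  have hn3 : n ≤ 3 := by
    have : n * 2 ≤ n * p := Nat.mul_le_mul_left n hp2
    omega
  have hp' : p = 2 ∨ p = 3 ∨ p = 5 := by
    interval_cases p
    · exact .inl rfl
    · exact .inr (.inl rfl)
    · exact absurd hp (by norm_num)
    · exact .inr (.inr rfl)
    · exact absurd hp (by norm_num)
  have h30 : Squarefree 30 := by
    rw [show (30 : ℕ) = 2 * (3 * 5) by norm_num, Nat.squarefree_mul (by norm_num),
      Nat.squarefree_mul (by norm_num)]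
    exact ⟨Nat.prime_two.prime.squarefree, Nat.prime_three.prime.squarefree,
      Nat.prime_five.prime.squarefree⟩
  obtain ⟨c, hc⟩ : ∃ c, Nat.card (fixedSubgroup σ) = c := ⟨_, rfl⟩
  obtain ⟨k, hk⟩ : ∃ k, (fixedSubgroup σ).index = k := ⟨_, rfl⟩
  rw [hc, hk] at hmul
  rw [hk] at h5 hlt hn hfac
  rw [hc, hk] at hdvd
  rw [hk] at hcent
  have hkL : k ∣ Nat.card L := Dvd.intro_left _ hmul
  have hbound : ∀ d, c ∣ d → Nat.card L ∣ d * k := fun d hd => hmul ▸ Nat.mul_dvd_mul_right hd k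
  have hLd := hbound _ hdvd
  have sylow : ∀ q b m, q.Prime → q ∣ Nat.card L → Nat.card L ∣ q ^ b * m →
      (∀ s ≤ m, 5 ≤ s → s ∣ m → s % q ≠ 1) → m ≠ 0 → False := by
    intro q b m hq hqL hd hs hm
    have : Fact q.Prime := ⟨hq⟩
    exact not_dvd_of_sylow hL q hd hqL
      (fun s h5 hsm => hs s (Nat.le_of_dvd (Nat.pos_of_ne_zero hm) hsm) h5 hsm)
  -- the cases `p = 2`, `3`, `5`, and within them `k = 5`, `6`, `7`
  rcases hp' with rfl | rfl | rfl
  · interval_cases k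
    · have : n = 1 ∨ n = 2 := by omega
      rcases this with rfl | rfl
      · exact sylow 5 1 4 (by norm_num) hkL hLd (by decide) (by norm_num)
      · exact sylow 5 1 8 (by norm_num) hkL hLd (by decide) (by norm_num)
    · have : n = 1 ∨ n = 2 := by omega
      rcases this with rfl | rfl
      · exact sylow 3 2 8 (by norm_num) (dvd_trans (by norm_num) hkL) hLd (by decide) (by norm_num)
      · exact sylow 2 4 3 (by norm_num) (dvd_trans (by norm_num) hkL) hLd (by decide) (by norm_num)
    · have : n = 1 ∨ n = 2 ∨ n = 3 := by omega
      rcases this with rfl | rfl | rfl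
      · refine false_of_index_seven_of_dvd hL hσ1 hk (hc ▸ hdvd) fun h => ?_
        exact false_of_index_seven hL hσ hk h hcent (by rw [hsign]; decide)
      · refine false_of_index_seven_of_dvd hL hσ1 hk (hc ▸ hdvd.trans (by decide)) fun h => ?_
        rw [← hc, h] at hdvd
        exact absurd hdvd (by decide)
      · refine false_of_index_seven_of_dvd hL hσ1 hk (hc ▸ hdvd) fun h => ?_
        exact false_of_index_seven hL hσ hk h hcent (by rw [hsign]; decide)
  · interval_cases k
    · have : n = 1 := by omega
      subst this
      exact sylow 5 1 3 (by norm_num) hkL hLd (by decide) (by norm_num)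
    · have : n = 1 := by omega
      subst this
      exact sylow 3 2 4 (by norm_num) (dvd_trans (by norm_num) hkL) hLd (by decide) (by norm_num)
    · have h18 : c ∣ 18 := by
        have : n = 1 ∨ n = 2 := by omega
        rcases this with rfl | rfl
        · exact hdvd
        · exact hdvd
      exact sylow 7 1 18 (by norm_num) hkL (hbound 18 h18) (by decide) (by norm_num)
  · have hn' : n = 1 := by omega
    subst hn'
    interval_cases k
    · omega
    · exact not_squarefree_card hL (Squarefree.squarefree_of_dvd hLd h30)
    · exact sylow 7 1 5 (by norm_num) hkL (hbound 5 (hdvd.trans (by decide))) (by decide) (by norm_num)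

/-- The fixed subgroup of a nontrivial automorphism of a nonabelian finite simple group has index
at least `8`. -/
theorem eight_le_index_fixedSubgroup (hL : ∃ a b : L, a * b ≠ b * a) {σ : MulAut L} (hσ : σ ≠ 1) :
    8 ≤ (fixedSubgroup σ).index := by
  have ho : orderOf σ ≠ 1 := by rwa [Ne, orderOf_eq_one_iff]
  obtain ⟨p, hp, hpo⟩ := Nat.exists_prime_and_dvd ho
  have hpos : 0 < orderOf σ := orderOf_pos σ
  have h1 : orderOf (σ ^ (orderOf σ / p)) = p := by
    rw [orderOf_pow_of_dvd (Nat.div_pos (Nat.le_of_dvd hpos hpo) hp.pos).ne'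
      (Nat.div_dvd_of_dvd hpo), Nat.div_div_self hpo hpos.ne']
  exact (eight_le_index_of_prime hL hp h1).trans (Nat.le_of_dvd
    (Nat.pos_of_ne_zero Subgroup.index_ne_zero_of_finite)
    (Subgroup.index_dvd_of_le (fixedSubgroup_le_pow σ _)))

/-- A nonabelian finite simple group has order at least `60`: a nontrivial central element of a
Sylow subgroup `P` has centralizer of order at least `|P|` and index at least `8`. -/
theorem sixty_le_card (hL : ∃ a b : L, a * b ≠ b * a) : 60 ≤ Nat.card L := by
  have hconj : ∀ x : L, x ≠ 1 → MulAut.conj x ≠ 1 := by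
    intro x hx h
    have hc : x ∈ Subgroup.center L := by
      rw [Subgroup.mem_center_iff]
      intro y
      have := congrArg (fun e : MulAut L => e y) h
      simp only [MulAut.conj_apply, MulAut.one_apply] at this
      exact (mul_inv_eq_iff_eq_mul.mp this).symm
    rcases (inferInstance : (Subgroup.center L).Normal).eq_bot_or_eq_top with hb | hb
    · rw [hb] at hc; exact hx hc
    · obtain ⟨a, b, hab⟩ := hL
      have ha : b ∈ Subgroup.center L := by rw [hb]; trivial
      exact hab (Subgroup.mem_center_iff.mp ha a)
  have key : ∀ p a, p.Prime → a ≠ 0 → p ^ a ∣ Nat.card L → 8 * p ^ a ≤ Nat.card L := by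
    intro p a hp ha hd
    have : Fact p.Prime := ⟨hp⟩
    obtain ⟨P⟩ : Nonempty (Sylow p L) := inferInstance
    have hP : p ^ a ∣ Nat.card P := P.pow_dvd_card_of_pow_dvd_card hd
    have hle : p ^ a ≤ Nat.card P := Nat.le_of_dvd Nat.card_pos hP
    have hnt : Nontrivial P := by
      rw [← Finite.one_lt_card_iff_nontrivial]
      exact (Nat.one_lt_pow ha hp.one_lt).trans_le hle
    have hcn : Nontrivial (Subgroup.center P) := P.isPGroup'.center_nontrivial
    obtain ⟨⟨⟨x, hxP⟩, hxc⟩, hx1⟩ := exists_ne (1 : Subgroup.center P)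
    have hx : x ≠ 1 := fun h => hx1 (Subtype.ext (Subtype.ext h))
    have hPF : (P : Subgroup L) ≤ fixedSubgroup (MulAut.conj x) := by
      intro y hy
      rw [mem_fixedSubgroup, MulAut.conj_apply, mul_inv_eq_iff_eq_mul]
      exact (congrArg Subtype.val (Subgroup.mem_center_iff.mp hxc ⟨y, hy⟩)).symm
    have h8 := eight_le_index_fixedSubgroup hL (hconj x hx)
    have hc := Subgroup.card_le_of_le hPF
    rw [← (fixedSubgroup (MulAut.conj x)).card_mul_index, mul_comm]
    exact Nat.mul_le_mul (hle.trans hc) h8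
  have h1 : Nat.card L ≠ 1 := fun h => card_ne_prime_pow hL 2 0 (by rw [h, pow_zero])
  have h0 : Nat.card L ≠ 0 := Nat.card_pos.ne'
  have e : ∀ q, q.Prime → q ∣ Nat.card L → 8 * q ≤ Nat.card L := fun q hq hd => by
    simpa using key q 1 hq one_ne_zero (by simpa using hd)
  have e2 := e 2 (by norm_num)
  have e4 := key 2 2 (by norm_num) (by norm_num)
  have e8 := key 2 3 (by norm_num) (by norm_num)
  have e3 := e 3 (by norm_num)
  have e9 := key 3 2 (by norm_num) (by norm_num)
  have e5 := e 5 (by norm_num)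
  have e25 := key 5 2 (by norm_num) (by norm_num)
  have e7 := e 7 (by norm_num)
  generalize Nat.card L = f at *
  by_contra! hlt
  have n11 : ∀ q, q.Prime → 8 ≤ q → ¬ q ∣ f := fun q hq h8 hd => by have := e q hq hd; omega
  have m11 := n11 11 (by norm_num) (by norm_num)
  have m13 := n11 13 (by norm_num) (by norm_num)
  have m17 := n11 17 (by norm_num) (by norm_num)
  have m19 := n11 19 (by norm_num) (by norm_num)
  have m23 := n11 23 (by norm_num) (by norm_num)
  have m29 := n11 29 (by norm_num) (by norm_num)
  by_cases hp : f.Prime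
  · by_cases h8 : 8 ≤ f
    · exact n11 f hp h8 dvd_rfl
    · have := e f hp dvd_rfl
      have := hp.pos
      omega
  · clear e key n11 hconj
    interval_cases f <;> first | omega | exact hp (by norm_num)

end IndexEight

/-! ### The simple factors of a minimal normal subgroup -/

section Factors

/-- A group `H` permuting a family of commuting nonabelian simple subgroups `T i` of `A`, recorded
by the properties of the `T i` which are used to bound fixed point ratios: the `T i` are permuted as
`H` acts on the indices, they commute pairwise and have trivial centres, and the centralizers in
`T i` of elements acting nontrivially on `T i` have index at least `8`. Moreover `H` acts faithfully
on the family and has no nontrivial abelian normal subgroup. -/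
structure IsFactorSystem {H ι : Type*} [Group H] [MulAction H ι] (A : Subgroup H)
    (T : ι → Subgroup H) : Prop where
  le : ∀ i, T i ≤ A
  conj_mem : ∀ h i x, x ∈ T i → h * x * h⁻¹ ∈ T (h • i)
  comm : ∀ i j, i ≠ j → ∀ x ∈ T i, ∀ y ∈ T j, x * y = y * x
  center : ∀ i x, x ∈ T i → x ∈ Subgroup.centralizer (T i : Set H) → x = 1
  sixty : ∀ i, 60 ≤ Nat.card (T i)
  eight : ∀ i h, h • i = i → h ∉ Subgroup.centralizer (T i : Set H) →
    8 * Nat.card (T i ⊓ Subgroup.centralizer {h} : Subgroup H) ≤ Nat.card (T i)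
  faithful : ∀ h, (∀ i, h ∈ Subgroup.centralizer (T i : Set H)) → h = 1
  abelian : ∀ N : Subgroup H, N.Normal → (∀ x ∈ N, ∀ y ∈ N, x * y = y * x) → N = ⊥

/-- A nontrivial element normalizing a nonabelian finite simple subgroup and acting nontrivially on
it has centralizer of index at least `8` in it. -/
theorem eight_mul_card_inf_centralizer_le {H : Type*} [Group H] {T : Subgroup H} [Finite T]
    [IsSimpleGroup T] (hT : ∃ a b : T, a * b ≠ b * a) {h : H}
    (hn : h ∈ Subgroup.normalizer (T : Set H)) (hc : h ∉ Subgroup.centralizer (T : Set H)) :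
    8 * Nat.card (T ⊓ Subgroup.centralizer {h} : Subgroup H) ≤ Nat.card T := by
  let σ : MulAut T := T.normalizerMonoidHom ⟨h, hn⟩
  have hσx : ∀ x : T, ((σ x : T) : H) = h * x * h⁻¹ := fun x => rfl
  have hσ : σ ≠ 1 := by
    intro h1
    apply hc
    rw [Subgroup.mem_centralizer_iff]
    intro y hy
    have := hσx ⟨y, hy⟩
    rw [h1] at this
    exact (eq_mul_inv_iff_mul_eq.mp this)
  have h8 := eight_le_index_fixedSubgroup hT hσ
  have hcard : Nat.card (T ⊓ Subgroup.centralizer {h} : Subgroup H) =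
      Nat.card (fixedSubgroup σ) := by
    symm
    refine Nat.card_congr ⟨fun x => ⟨x.1, x.1.2, ?_⟩, fun x => ⟨⟨x.1, x.2.1⟩, ?_⟩,
      fun _ => rfl, fun _ => rfl⟩
    · refine Subgroup.mem_centralizer_singleton_iff.mpr ?_
      have := hσx x.1
      rw [mem_fixedSubgroup.mp x.2] at this
      exact (eq_mul_inv_iff_mul_eq.mp this)
    · rw [mem_fixedSubgroup]
      apply Subtype.ext
      rw [hσx]
      exact mul_inv_eq_iff_eq_mul.mpr (Subgroup.mem_centralizer_singleton_iff.mp x.2.2).symm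
  rw [hcard, ← (fixedSubgroup σ).card_mul_index, mul_comm]
  exact Nat.mul_le_mul_left _ h8

variable {H : Type*} [Group H] [Finite H]

/-- The factors are the conjugates of a subgroup `T₀` which is minimal among the nontrivial
`A`-invariant subgroups of `A`; they are indexed by the cosets of the normalizer of `T₀`, so that
different indices give different factors and `H` permutes the indices transitively. -/
theorem exists_isFactorSystem {A : Subgroup H} (hA : IsMinimalNormal A)
    (hab : ∃ a ∈ A, ∃ b ∈ A, a * b ≠ b * a) (hcent : Subgroup.centralizer (A : Set H) = ⊥)
    (hns : ¬ IsSimpleGroup A) :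
    ∃ (T₀ : Subgroup H) (T : H ⧸ Subgroup.normalizer (T₀ : Set H) → Subgroup H),
      Nontrivial (H ⧸ Subgroup.normalizer (T₀ : Set H)) ∧ IsFactorSystem A T := by
  have hAn : A.Normal := hA.prop.1
  let P : Subgroup H → Prop := fun T => T ≤ A ∧ T ≠ ⊥ ∧ ∀ a ∈ A, ∀ x ∈ T, a * x * a⁻¹ ∈ T
  have hPA : P A := ⟨le_rfl, hA.prop.2, fun a _ x hx => A.mul_mem (A.mul_mem ‹_› hx) (A.inv_mem ‹_›)⟩
  obtain ⟨T₀, -, hT₀⟩ := exists_minimal_le_of_wellFoundedLT P A hPA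
  have hconj : ∀ (T : Subgroup H) (h x : H), x ∈ T.map (MulAut.conj h).toMonoidHom ↔ h⁻¹ * x * h ∈ T := by
    intro T h x
    rw [Subgroup.mem_map]
    constructor
    · rintro ⟨y, hy, rfl⟩
      simpa [mul_assoc] using hy
    · intro hx
      exact ⟨_, hx, by simp [mul_assoc]⟩
  -- conjugates of a minimal `A`-invariant subgroup are again minimal
  have hPconj : ∀ (T : Subgroup H) (h : H), P T → P (T.map (MulAut.conj h).toMonoidHom) := by
    rintro T h ⟨h1, h2, h3⟩
    refine ⟨fun x hx => ?_, ?_, fun a ha x hx => ?_⟩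
    · rw [hconj] at hx
      have := hAn.conj_mem _ (h1 hx) h
      simpa [mul_assoc] using this
    · rwa [Ne, Subgroup.map_eq_bot_iff_of_injective _ (MulAut.conj h).injective]
    · rw [hconj] at hx ⊢
      have := h3 (h⁻¹ * a * h) (by simpa using hAn.conj_mem a ha h⁻¹) _ hx
      convert this using 1
      group
  have hmin : ∀ (h : H) (U : Subgroup H), P U → U ≤ T₀.map (MulAut.conj h).toMonoidHom →
      U = T₀.map (MulAut.conj h).toMonoidHom := by
    intro h U hU hle
    have h1 := hPconj U h⁻¹ hU
    have h2 : U.map (MulAut.conj h⁻¹).toMonoidHom ≤ T₀ := by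
      intro x hx
      rw [hconj] at hx
      have := hle hx
      rw [hconj] at this
      simpa [mul_assoc] using this
    have h3 := hT₀.eq_of_le h1 h2
    apply le_antisymm hle
    intro x hx
    rw [hconj, ← h3, hconj] at hx
    simpa [mul_assoc] using hx
  let T : H ⧸ Subgroup.normalizer (T₀ : Set H) → Subgroup H := fun q =>
    Quotient.liftOn' q (fun h => T₀.map (MulAut.conj h).toMonoidHom) (by
      intro a b hab
      rw [QuotientGroup.leftRel_apply, Subgroup.mem_normalizer_iff] at hab
      ext x
      rw [hconj, hconj]
      rw [hab (b⁻¹ * x * b)]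
      convert Iff.rfl using 2
      group)
  have hTmk : ∀ h x : H, x ∈ T (h : H ⧸ Subgroup.normalizer (T₀ : Set H)) ↔ h⁻¹ * x * h ∈ T₀ :=
    fun h x => hconj T₀ h x
  have hP : ∀ i, P (T i) := by
    intro i
    induction i using QuotientGroup.induction_on with
    | H h => exact hPconj T₀ h hT₀.prop
  have hTmin : ∀ i U, P U → U ≤ T i → U = T i := by
    intro i
    induction i using QuotientGroup.induction_on with
    | H h => exact hmin h
  have hinj : ∀ i j, T i = T j → i = j := by
    intro i j
    induction i using QuotientGroup.induction_on with
    | H a =>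
      induction j using QuotientGroup.induction_on with
      | H b =>
        intro h
        rw [QuotientGroup.eq, Subgroup.mem_normalizer_iff]
        intro x
        have h1 := hTmk a (b * x * b⁻¹)
        have h2 := hTmk b (b * x * b⁻¹)
        rw [h, h2] at h1
        convert h1 using 2 <;> group
  have hsmul : ∀ h i x, x ∈ T i → h * x * h⁻¹ ∈ T (h • i) := by
    intro h i x
    induction i using QuotientGroup.induction_on with
    | H a =>
      rw [MulAction.Quotient.smul_coe, hTmk, hTmk]
      intro hx
      convert hx using 1
      simp [mul_assoc]
  -- distinct minimal invariant subgroups meet trivially and normalize each other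
  have hcomm : ∀ i j, i ≠ j → ∀ x ∈ T i, ∀ y ∈ T j, x * y = y * x := by
    intro i j hij x hx y hy
    by_cases hbot : T i ⊓ T j = ⊥
    · have hmem : x * y * x⁻¹ * y⁻¹ ∈ T i ⊓ T j := by
        constructor
        · have := (hP i).2.2 y ((hP j).1 hy) x⁻¹ ((T i).inv_mem hx)
          have := (T i).mul_mem hx this
          simpa [mul_assoc] using this
        · have := (hP j).2.2 x ((hP i).1 hx) y hy
          exact (T j).mul_mem this ((T j).inv_mem hy)
      rw [hbot, Subgroup.mem_bot] at hmem
      rw [mul_inv_eq_one, mul_inv_eq_iff_eq_mul] at hmem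
      exact hmem
    · have hPi : P (T i ⊓ T j) := ⟨inf_le_left.trans (hP i).1, hbot,
        fun a ha x hx => ⟨(hP i).2.2 a ha x hx.1, (hP j).2.2 a ha x hx.2⟩⟩
      exact absurd (hinj i j ((hTmin i _ hPi inf_le_left).symm.trans (hTmin j _ hPi inf_le_right))) hij
  -- the factors generate a normal subgroup of `H` inside the minimal normal subgroup `A`
  have hsup : ⨆ i, T i = A := by
    refine hA.eq_of_le ⟨⟨fun x hx g => ?_⟩, ?_⟩ (iSup_le fun i => (hP i).1)
    · refine Subgroup.iSup_induction T (C := fun x => g * x * g⁻¹ ∈ ⨆ i, T i) hx ?_ ?_ ?_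
      · exact fun i x hx => Subgroup.mem_iSup_of_mem (g • i) (hsmul g i x hx)
      · simp
      · intro x y hx hy
        have := Subgroup.mul_mem _ hx hy
        simpa [mul_assoc] using this
    · intro h
      rw [iSup_eq_bot] at h
      exact (hP ((1 : H) : H ⧸ Subgroup.normalizer (T₀ : Set H))).2.1 (h _)
  have hfaith : ∀ h : H, (∀ i, h ∈ Subgroup.centralizer (T i : Set H)) → h = 1 := by
    intro h hh
    rw [← Subgroup.mem_bot, ← hcent, Subgroup.mem_centralizer_iff]
    intro y hy
    rw [SetLike.mem_coe, ← hsup] at hy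
    refine Subgroup.iSup_induction T (C := fun y => y * h = h * y) hy ?_ ?_ ?_
    · exact fun i x hx => Subgroup.mem_centralizer_iff.mp (hh i) x hx
    · simp
    · intro x y hx hy
      rw [mul_assoc, hy, ← mul_assoc, hx, mul_assoc]
  have hcenter : ∀ i x, x ∈ T i → x ∈ Subgroup.centralizer (T i : Set H) → x = 1 := by
    intro i x hx hxc
    refine hfaith x fun j => ?_
    by_cases hij : j = i
    · rwa [hij]
    · rw [Subgroup.mem_centralizer_iff]
      exact fun y hy => hcomm j i hij y hy x hx
  have hnab : ∀ i, ∃ a b : T i, a * b ≠ b * a := by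
    intro i
    by_contra! h
    apply (hP i).2.1
    rw [Subgroup.eq_bot_iff_forall]
    intro x hx
    refine hcenter i x hx (Subgroup.mem_centralizer_iff.mpr fun y hy => ?_)
    exact congrArg Subtype.val (h ⟨y, hy⟩ ⟨x, hx⟩)
  -- a normal subgroup of `T i` is invariant under `A`, the other factors acting trivially on it
  have hsimple : ∀ i, IsSimpleGroup (T i) := by
    intro i
    have hnt : Nontrivial (T i) := by
      obtain ⟨a, b, h⟩ := hnab i
      exact ⟨a * b, b * a, h⟩
    refine ⟨fun N hN => ?_⟩
    by_cases hb : N = ⊥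
    · exact .inl hb
    right
    have hPN : P (N.map (T i).subtype) := by
      refine ⟨(Subgroup.map_subtype_le N).trans (hP i).1, ?_, fun a ha x hx => ?_⟩
      · rwa [Ne, Subgroup.map_eq_bot_iff_of_injective _ (T i).subtype_injective]
      · rw [← hsup] at ha
        refine Subgroup.iSup_induction T (C := fun a => ∀ x ∈ N.map (T i).subtype,
          a * x * a⁻¹ ∈ N.map (T i).subtype) ha ?_ ?_ ?_ x hx
        · intro j a haj x hx
          by_cases hij : j = i
          · subst hij
            obtain ⟨y, hy, rfl⟩ := hx
            exact ⟨_, hN.conj_mem y hy ⟨a, haj⟩, rfl⟩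
          · rw [hcomm j i hij a haj x (Subgroup.map_subtype_le N hx), mul_inv_cancel_right]
            exact hx
        · intro x hx
          simpa using hx
        · intro a b ha hb x hx
          have := ha _ (hb _ hx)
          simpa [mul_assoc] using this
    have := hTmin i _ hPN (Subgroup.map_subtype_le N)
    rw [eq_top_iff]
    intro x _
    have hx : (x : H) ∈ N.map (T i).subtype := by rw [this]; exact x.2
    obtain ⟨y, hy, hyx⟩ := hx
    rwa [← Subtype.ext hyx]
  refine ⟨T₀, T, ?_, ⟨fun i => (hP i).1, hsmul, hcomm, hcenter, fun i => ?_, fun i h hi hc => ?_,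
    hfaith, fun N hN hNab => ?_⟩⟩
  · rw [← not_subsingleton_iff_nontrivial]
    intro hss
    have h1 : T ((1 : H) : H ⧸ Subgroup.normalizer (T₀ : Set H)) = A := by
      rw [← hsup]
      refine le_antisymm (le_iSup T _) (iSup_le fun i => ?_)
      rw [Subsingleton.elim i]
    have h2 := hsimple ((1 : H) : H ⧸ Subgroup.normalizer (T₀ : Set H))
    rw [h1] at h2
    exact hns h2
  · have := hsimple i
    exact sixty_le_card (hnab i)
  · have := hsimple i
    refine eight_mul_card_inf_centralizer_le (hnab i) ?_ hc
    rw [Subgroup.mem_normalizer_iff]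
    intro x
    refine ⟨fun hx => hi ▸ hsmul h i x hx, fun hx => ?_⟩
    have := hsmul h⁻¹ i _ hx
    rw [inv_smul_eq_iff.mpr hi.symm] at this
    simpa [mul_assoc] using this
  · by_contra hNb
    have hne : N ⊓ A = ⊥ := by
      by_contra hb
      have := hA.eq_of_le ⟨inferInstance, hb⟩ inf_le_right
      obtain ⟨a, ha, b, hb, h⟩ := hab
      rw [← this] at ha hb
      exact h (hNab a ha.1 b hb.1)
    apply hNb
    rw [eq_bot_iff, ← hcent]
    intro x hx
    rw [Subgroup.mem_centralizer_iff]
    intro y hy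
    exact (Subgroup.commute_of_normal_of_disjoint N A hN hAn (disjoint_iff.mpr hne) x y hx hy).symm

end Factors

/-! ### Fixed point ratios -/

section FixRatio

variable {H : Type*} [Group H]

/-- The proportion of the elements of `A` which commute with `y`: the fixed point ratio of `y`
acting on `A` by conjugation. -/
noncomputable def fixRatio (A : Subgroup H) (y : H) : ℚ :=
  (Nat.card (A ⊓ Subgroup.centralizer {y} : Subgroup H) : ℚ) / Nat.card A

theorem fixRatio_nonneg (A : Subgroup H) (y : H) : 0 ≤ fixRatio A y := by
  unfold fixRatio; positivity

variable [Finite H]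

theorem fixRatio_le_one (A : Subgroup H) (y : H) : fixRatio A y ≤ 1 := by
  unfold fixRatio
  apply div_le_one_of_le₀ _ (by positivity)
  exact_mod_cast Subgroup.card_le_of_le inf_le_left

theorem fixRatio_eq_inv_relIndex (A : Subgroup H) (y : H) :
    fixRatio A y = ((Subgroup.centralizer {y}).relIndex A : ℚ)⁻¹ := by
  have h := (Subgroup.centralizer {y} ⊓ A).card_mul_index
  have h1 := Subgroup.card_mul_index ((Subgroup.centralizer {y}).subgroupOf A)
  have h2 : Nat.card ((Subgroup.centralizer {y}).subgroupOf A) =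
      Nat.card (A ⊓ Subgroup.centralizer {y} : Subgroup H) := by
    rw [← Subgroup.inf_subgroupOf_left]
    exact Nat.card_congr (Subgroup.subgroupOfEquivOfLe inf_le_left).toEquiv
  rw [h2] at h1
  have h3 : ((Subgroup.centralizer {y}).subgroupOf A).index = (Subgroup.centralizer {y}).relIndex A :=
    rfl
  rw [h3] at h1
  unfold fixRatio
  rw [← h1]
  have : (Nat.card (A ⊓ Subgroup.centralizer {y} : Subgroup H) : ℚ) ≠ 0 := by
    exact_mod_cast Nat.card_pos.ne'
  have : (((Subgroup.centralizer {y}).relIndex A : ℕ) : ℚ) ≠ 0 := by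
    have : (Subgroup.centralizer {y}).relIndex A ≠ 0 := Subgroup.index_ne_zero_of_finite
    exact_mod_cast this
  push_cast
  field_simp

/-- Fixed point ratios grow on passing to a subgroup, which need not be invariant. -/
theorem fixRatio_le_of_le {S A : Subgroup H} (h : S ≤ A) (y : H) :
    fixRatio A y ≤ fixRatio S y := by
  rw [fixRatio_eq_inv_relIndex, fixRatio_eq_inv_relIndex]
  have h0 : (Subgroup.centralizer {y}).relIndex S ≠ 0 := Subgroup.index_ne_zero_of_finite
  have h1 : (Subgroup.centralizer {y}).relIndex S ≤ (Subgroup.centralizer {y}).relIndex A :=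
    Subgroup.relIndex_le_of_le_right h Subgroup.index_ne_zero_of_finite
  apply inv_anti₀
  · exact_mod_cast Nat.pos_of_ne_zero h0
  · exact_mod_cast h1

variable {ι : Type*} [MulAction H ι] {A : Subgroup H} {T : ι → Subgroup H}

open Classical in
/-- The bound for the fixed point ratio of `y` which the factor `T i` supplies: `1` if `y` acts
trivially on `T i`, `1 / 8` if `y` induces a nontrivial automorphism of `T i`, and `1 / 60` if `y` moves
`T i`, for then `y` commutes with no nontrivial element of `T i`. -/
noncomputable def weight (T : ι → Subgroup H) (i : ι) (y : H) : ℚ :=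
  if y ∈ Subgroup.centralizer (T i : Set H) then 1 else if y • i = i then 1 / 8 else 1 / 60

namespace IsFactorSystem

omit [Finite H] in
theorem eq_one_of_mem_of_ne (hT : IsFactorSystem A T) {i k : ι} (hik : i ≠ k) {x : H}
    (hi : x ∈ T i) (hk : x ∈ T k) : x = 1 :=
  hT.center i x hi (Subgroup.mem_centralizer_iff.mpr fun y hy => hT.comm i k hik y hy x hk)

omit [Finite H] in
theorem smul_eq_of_mem_centralizer (hT : IsFactorSystem A T) {i : ι} {y : H}
    (hy : y ∈ Subgroup.centralizer (T i : Set H)) : y • i = i := by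
  by_contra hne
  have h60 := hT.sixty i
  have hb : T i = ⊥ := by
    rw [Subgroup.eq_bot_iff_forall]
    intro x hx
    have h1 := hT.conj_mem y i x hx
    rw [← Subgroup.mem_centralizer_iff.mp hy x hx, mul_inv_cancel_right] at h1
    exact hT.eq_one_of_mem_of_ne (Ne.symm hne) hx h1
  rw [hb, Subgroup.card_bot] at h60
  omega

theorem fixRatio_factor_le (hT : IsFactorSystem A T) (i : ι) (y : H) :
    fixRatio (T i) y ≤ weight T i y := by
  unfold weight
  split_ifs with h1 h2
  · exact fixRatio_le_one _ _
  · have := hT.eight i y h2 h1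
    have hpos : (0 : ℚ) < Nat.card (T i) := by exact_mod_cast Nat.card_pos
    unfold fixRatio
    rw [div_le_iff₀ hpos]
    have : (8 : ℚ) * Nat.card (T i ⊓ Subgroup.centralizer {y} : Subgroup H) ≤ Nat.card (T i) := by
      exact_mod_cast this
    linarith
  · have hb : T i ⊓ Subgroup.centralizer {y} = ⊥ := by
      rw [Subgroup.eq_bot_iff_forall]
      rintro x ⟨hx, hxy⟩
      have h3 := hT.conj_mem y i x hx
      rw [← Subgroup.mem_centralizer_singleton_iff.mp hxy, mul_inv_cancel_right] at h3
      exact hT.eq_one_of_mem_of_ne (Ne.symm h2) hx h3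
    unfold fixRatio
    rw [hb, Subgroup.card_bot, Nat.cast_one]
    apply one_div_le_one_div_of_le (by norm_num)
    exact_mod_cast hT.sixty i

theorem fixRatio_le_weight (hT : IsFactorSystem A T) (i : ι) (y : H) :
    fixRatio A y ≤ weight T i y :=
  (fixRatio_le_of_le (hT.le i) y).trans (hT.fixRatio_factor_le i y)

omit [Finite H] in
/-- If `y` carries `T k` to a third factor, an element of `T i * T k` commuting with `y` has no component
in `T k`, since that component would give one in the third factor. -/
theorem mem_centralizer_of_moved (hT : IsFactorSystem A T) {i k : ι} (hik : i ≠ k) {y s t : H}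
    (hs : s ∈ T i) (ht : t ∈ T k) (hyi : y • k ≠ i) (hyk : y • k ≠ k)
    (h : s * t * y = y * (s * t)) : t = 1 ∧ s * y = y * s := by
  have h1 : y * t * y⁻¹ = (y * s * y⁻¹)⁻¹ * s * t := by
    have : y * s * y⁻¹ * (y * t * y⁻¹) = s * t := by
      rw [show y * s * y⁻¹ * (y * t * y⁻¹) = y * (s * t) * y⁻¹ by group, ← h, mul_inv_cancel_right]
    rw [mul_assoc _ s t, ← this, inv_mul_cancel_left]
  have h2 : y * t * y⁻¹ = 1 := by
    refine hT.center (y • k) _ (hT.conj_mem y k t ht) (Subgroup.mem_centralizer_iff.mpr ?_)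
    intro z hz
    have hne : y • k ≠ y • i := fun e => hik (MulAction.injective y e).symm
    have c1 : Commute z (y * s * y⁻¹) := hT.comm _ _ hne z hz _ (hT.conj_mem y i s hs)
    have c2 : Commute z s := hT.comm _ _ hyi z hz s hs
    have c3 : Commute z t := hT.comm _ _ hyk z hz t ht
    rw [h1]
    exact ((c1.inv_right.mul_right c2).mul_right c3)
  have ht1 : t = 1 := by simpa using h2
  subst ht1
  exact ⟨rfl, by simpa using h⟩

omit [Finite H] in
/-- If `y` does not interchange the factors `T i` and `T k`, an element of `T i * T k` commutes with `y`
only if its components do. An interchange is a genuine exception: there `y` commutes with the products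
`s * (y * s * y⁻¹)` if `y ^ 2 = 1`. -/
theorem mem_centralizer_of_not_swapped (hT : IsFactorSystem A T) {i k : ι} (hik : i ≠ k) {y s t : H}
    (hs : s ∈ T i) (ht : t ∈ T k) (hsw : ¬ (y • i = k ∧ y • k = i))
    (h : s * t * y = y * (s * t)) : s * y = y * s ∧ t * y = y * t := by
  by_cases h1 : y • k ≠ i ∧ y • k ≠ k
  · obtain ⟨rfl, h2⟩ := hT.mem_centralizer_of_moved hik hs ht h1.1 h1.2 h
    exact ⟨h2, by simp⟩
  by_cases h2 : y • i ≠ k ∧ y • i ≠ i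
  · have hst := hT.comm i k hik s hs t ht
    rw [hst] at h
    obtain ⟨rfl, h2⟩ := hT.mem_centralizer_of_moved hik.symm ht hs h2.1 h2.2 h
    exact ⟨by simp, h2⟩
  have hinj := MulAction.injective (β := ι) y
  have hk : y • k = k := by
    by_contra hk
    have h3 : y • k = i := by tauto
    have h4 : y • i = i := by tauto
    exact hik (hinj (h4.trans h3.symm))
  have hi : y • i = i := by
    by_contra hi
    have h4 : y • i = k := by tauto
    exact hik (hinj (h4.trans hk.symm))
  have e : s⁻¹ * (y * s * y⁻¹) = t * (y * t * y⁻¹)⁻¹ := by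
    rw [eq_mul_inv_iff_mul_eq, mul_assoc,
      show y * s * y⁻¹ * (y * t * y⁻¹) = y * (s * t) * y⁻¹ by group, ← h]
    group
  have m1 : s⁻¹ * (y * s * y⁻¹) ∈ T i :=
    (T i).mul_mem ((T i).inv_mem hs) (by have := hT.conj_mem y i s hs; rwa [hi] at this)
  have m2 : t * (y * t * y⁻¹)⁻¹ ∈ T k :=
    (T k).mul_mem ht ((T k).inv_mem (by have := hT.conj_mem y k t ht; rwa [hk] at this))
  have z1 := hT.eq_one_of_mem_of_ne hik m1 (e ▸ m2)
  have z2 := e.symm.trans z1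
  rw [inv_mul_eq_one, eq_mul_inv_iff_mul_eq] at z1
  rw [mul_inv_eq_one, eq_mul_inv_iff_mul_eq] at z2
  exact ⟨z1, z2⟩

/-- Two factors which `y` does not interchange bound the fixed point ratio by the product of
their weights. -/
theorem fixRatio_le_weight_mul (hT : IsFactorSystem A T) {i k : ι} (hik : i ≠ k) {y : H}
    (hsw : ¬ (y • i = k ∧ y • k = i)) : fixRatio A y ≤ weight T i y * weight T k y := by
  let f : T i × T k →* H := MonoidHom.noncommCoprod (T i).subtype (T k).subtype
    (fun a b => hT.comm i k hik a a.2 b b.2)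
  have hf : ∀ p, f p = p.1 * p.2 := fun p => rfl
  have hinj : Function.Injective f := by
    rw [injective_iff_map_eq_one]
    rintro ⟨⟨s, hs⟩, ⟨t, ht⟩⟩ h
    rw [hf] at h
    have h1 : s = t⁻¹ := eq_inv_of_mul_eq_one_left h
    have h2 := hT.eq_one_of_mem_of_ne hik hs (h1 ▸ (T k).inv_mem ht)
    subst h2
    simp only [eq_comm (a := (1 : H)), inv_eq_one] at h1
    subst h1
    rfl
  have hle : f.range ≤ A := by
    rintro _ ⟨p, rfl⟩
    exact A.mul_mem (hT.le i p.1.2) (hT.le k p.2.2)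
  have hcard : Nat.card f.range = Nat.card (T i) * Nat.card (T k) := by
    rw [← Nat.card_congr (MonoidHom.ofInjective hinj).toEquiv, Nat.card_prod]
  have hfix : Nat.card (f.range ⊓ Subgroup.centralizer {y} : Subgroup H) ≤
      Nat.card (T i ⊓ Subgroup.centralizer {y} : Subgroup H) *
        Nat.card (T k ⊓ Subgroup.centralizer {y} : Subgroup H) := by
    rw [← Nat.card_prod]
    let g : (T i ⊓ Subgroup.centralizer {y} : Subgroup H) ×
        (T k ⊓ Subgroup.centralizer {y} : Subgroup H) →
        (f.range ⊓ Subgroup.centralizer {y} : Subgroup H) := fun p =>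
      ⟨p.1.1 * p.2.1, ⟨⟨(⟨p.1.1, p.1.2.1⟩, ⟨p.2.1, p.2.2.1⟩), rfl⟩,
        Subgroup.mul_mem _ p.1.2.2 p.2.2.2⟩⟩
    apply Nat.card_le_card_of_surjective g
    rintro ⟨_, ⟨⟨⟨⟨s, hs⟩, ⟨t, ht⟩⟩, rfl⟩, hc⟩⟩
    have hc' := Subgroup.mem_centralizer_singleton_iff.mp hc
    rw [hf] at hc'
    obtain ⟨h1, h2⟩ := hT.mem_centralizer_of_not_swapped hik hs ht hsw hc'
    exact ⟨(⟨s, hs, Subgroup.mem_centralizer_singleton_iff.mpr h1⟩,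
      ⟨t, ht, Subgroup.mem_centralizer_singleton_iff.mpr h2⟩), rfl⟩
  have hprod : fixRatio f.range y ≤ fixRatio (T i) y * fixRatio (T k) y := by
    unfold fixRatio
    rw [hcard, div_mul_div_comm, Nat.cast_mul]
    gcongr
    exact_mod_cast hfix
  exact (fixRatio_le_of_le hle y).trans (hprod.trans (mul_le_mul (hT.fixRatio_factor_le i y)
    (hT.fixRatio_factor_le k y) (fixRatio_nonneg _ _)
    ((fixRatio_nonneg _ _).trans (hT.fixRatio_factor_le i y))))

end IsFactorSystem
end FixRatio

/-! ### Averages of fixed point ratios over a cyclic group -/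

section Average

variable {H : Type*} [Group H]

/-- The average fixed point ratio over the cyclic group generated by `x`, that is, the orbit ratio
of `x` acting on `A` by conjugation. -/
noncomputable def avgFix (A : Subgroup H) (x : H) : ℚ :=
  (∑ j ∈ Finset.range (orderOf x), fixRatio A (x ^ j)) / orderOf x

/-- The indicator of the multiples of `d`. -/
def multInd (d j : ℕ) : ℚ := if d ∣ j then 1 else 0

theorem sum_multInd {d n : ℕ} (hd : d ∣ n) (hn : n ≠ 0) :
    ∑ j ∈ Finset.range n, multInd d j = (n : ℚ) / d := by
  obtain ⟨m, rfl⟩ := hd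
  have hd0 : d ≠ 0 := by rintro rfl; simp at hn
  have hf : (Finset.range (d * m)).filter (d ∣ ·) = (Finset.range m).image (d * ·) := by
    ext j
    simp only [Finset.mem_filter, Finset.mem_range, Finset.mem_image]
    constructor
    · rintro ⟨h1, k, rfl⟩
      exact ⟨k, lt_of_mul_lt_mul_left h1 (Nat.zero_le d), rfl⟩
    · rintro ⟨k, hk, rfl⟩
      exact ⟨Nat.mul_lt_mul_of_pos_left hk (Nat.pos_of_ne_zero hd0), Dvd.intro k rfl⟩
  unfold multInd
  rw [Finset.sum_ite, hf]
  simp only [Finset.sum_const_zero, add_zero, Finset.sum_const, nsmul_eq_mul, mul_one]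
  rw [Finset.card_image_of_injective _ (fun a b h => Nat.eq_of_mul_eq_mul_left (Nat.pos_of_ne_zero hd0) h), Finset.card_range]
  push_cast
  field_simp

theorem multInd_mul (d e j : ℕ) : multInd d j * multInd e j = multInd (d.lcm e) j := by
  unfold multInd
  simp only [Nat.lcm_dvd_iff]
  split_ifs <;> simp_all

variable [Finite H]

/-- A bound for the fixed point ratios of the powers of `x` by a combination of indicators of
multiples averages to the corresponding combination of reciprocals. -/
theorem avgFix_le (A : Subgroup H) (x : H) {c₀ c₁ c₂ c₃ : ℚ} {d₁ d₂ d₃ : ℕ}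
    (h₁ : d₁ ∣ orderOf x) (h₂ : d₂ ∣ orderOf x) (h₃ : d₃ ∣ orderOf x)
    (h : ∀ j, fixRatio A (x ^ j) ≤
      c₀ + c₁ * multInd d₁ j + c₂ * multInd d₂ j + c₃ * multInd d₃ j) :
    avgFix A x ≤ c₀ + c₁ / d₁ + c₂ / d₂ + c₃ / d₃ := by
  have ho : orderOf x ≠ 0 := (orderOf_pos x).ne'
  have hoq : (orderOf x : ℚ) ≠ 0 := by exact_mod_cast ho
  have hpos : (0 : ℚ) < orderOf x := by exact_mod_cast orderOf_pos x
  unfold avgFix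
  rw [div_le_iff₀ hpos]
  refine (Finset.sum_le_sum fun j _ => h j).trans (le_of_eq ?_)
  simp only [Finset.sum_add_distrib, ← Finset.mul_sum]
  rw [sum_multInd h₁ ho, sum_multInd h₂ ho, sum_multInd h₃ ho]
  simp only [Finset.sum_const, Finset.card_range, nsmul_eq_mul]
  ring

variable {ι : Type*} [MulAction H ι] {A : Subgroup H} {T : ι → Subgroup H}

/-- The least positive `n` such that `x ^ n` centralizes `T i`, encoded as the period of the base
point of the cosets of the centralizer of `T i`. It is a multiple of the length of the cycle of `x`
through `i`, and the order of `x` is the least common multiple of these numbers over all `i`. -/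
noncomputable def factorPeriod (T : ι → Subgroup H) (x : H) (i : ι) : ℕ :=
  MulAction.period x ((1 : H) : H ⧸ Subgroup.centralizer (T i : Set H))

omit [Finite H] [MulAction H ι] in
theorem pow_mem_centralizer_iff {x : H} {i : ι} {n : ℕ} :
    x ^ n ∈ Subgroup.centralizer (T i : Set H) ↔ factorPeriod T x i ∣ n := by
  unfold factorPeriod
  rw [← MulAction.pow_smul_eq_iff_period_dvd, MulAction.Quotient.smul_coe, eq_comm,
    QuotientGroup.eq]
  simp

omit [MulAction H ι] [Finite H] in
theorem factorPeriod_dvd_orderOf (x : H) (i : ι) : factorPeriod T x i ∣ orderOf x := by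
  rw [← pow_mem_centralizer_iff, pow_orderOf_eq_one]
  exact one_mem _

omit [MulAction H ι] in
theorem factorPeriod_pos (x : H) (i : ι) : 0 < factorPeriod T x i :=
  Nat.pos_of_dvd_of_pos (factorPeriod_dvd_orderOf x i) (orderOf_pos x)

omit [Finite H] in
theorem period_dvd_orderOf' (x : H) (i : ι) : MulAction.period x i ∣ orderOf x := by
  rw [← MulAction.pow_smul_eq_iff_period_dvd, pow_orderOf_eq_one, one_smul]

theorem period_pos' (x : H) (i : ι) : 0 < MulAction.period x i :=
  Nat.pos_of_dvd_of_pos (period_dvd_orderOf' x i) (orderOf_pos x)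

namespace IsFactorSystem

omit [Finite H] in
theorem period_dvd_factorPeriod (hT : IsFactorSystem A T) (x : H) (i : ι) :
    MulAction.period x i ∣ factorPeriod T x i := by
  rw [← MulAction.pow_smul_eq_iff_period_dvd]
  exact hT.smul_eq_of_mem_centralizer (pow_mem_centralizer_iff.mpr dvd_rfl)

omit [Finite H] in
theorem orderOf_dvd_iff (hT : IsFactorSystem A T) {x : H} {n : ℕ} :
    orderOf x ∣ n ↔ ∀ i, factorPeriod T x i ∣ n := by
  refine ⟨fun h i => (factorPeriod_dvd_orderOf x i).trans h, fun h => ?_⟩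
  rw [orderOf_dvd_iff_pow_eq_one]
  exact hT.faithful _ fun i => pow_mem_centralizer_iff.mpr (h i)

omit [Finite H] in
theorem exists_not_dvd (hT : IsFactorSystem A T) {x : H} {n : ℕ} (h : ¬ orderOf x ∣ n) :
    ∃ i, ¬ factorPeriod T x i ∣ n := by
  by_contra! h'
  exact h (hT.orderOf_dvd_iff.mpr h')

omit [Finite H] in
theorem conj_mem_centralizer (hT : IsFactorSystem A T) {y : H} {i : ι} (h : H)
    (hy : y ∈ Subgroup.centralizer (T i : Set H)) :
    h * y * h⁻¹ ∈ Subgroup.centralizer (T (h • i) : Set H) := by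
  rw [Subgroup.mem_centralizer_iff] at *
  intro t ht
  have h1 := hT.conj_mem h⁻¹ _ t ht
  rw [inv_smul_smul] at h1
  have h2 := hy _ h1
  rw [inv_inv] at h2
  calc t * (h * y * h⁻¹) = h * ((h⁻¹ * t * h) * y) * h⁻¹ := by group
    _ = h * (y * (h⁻¹ * t * h)) * h⁻¹ := by rw [h2]
    _ = _ := by group

omit [Finite H] in
/-- The factors in one cycle of `x` have the same period, as `x` commutes with its powers. -/
theorem factorPeriod_smul (hT : IsFactorSystem A T) (x : H) (i : ι) :
    factorPeriod T x (x • i) = factorPeriod T x i := by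
  apply Nat.dvd_antisymm
  · rw [← pow_mem_centralizer_iff]
    have := hT.conj_mem_centralizer x (pow_mem_centralizer_iff.mpr (dvd_refl (factorPeriod T x i)))
    rwa [← pow_succ', pow_succ, mul_inv_cancel_right] at this
  · rw [← pow_mem_centralizer_iff]
    have := hT.conj_mem_centralizer x⁻¹
      (pow_mem_centralizer_iff.mpr (dvd_refl (factorPeriod T x (x • i))))
    rwa [inv_smul_smul, inv_inv, mul_assoc, ← pow_succ, pow_succ', inv_mul_cancel_left] at this

omit [Finite H] in
theorem weight_pow (x : H) (i : ι) (j : ℕ) : weight T i (x ^ j) =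
    if factorPeriod T x i ∣ j then 1 else if MulAction.period x i ∣ j then 1 / 8 else 1 / 60 := by
  classical
  unfold weight
  simp only [pow_mem_centralizer_iff, MulAction.pow_smul_eq_iff_period_dvd]

omit [Finite H] in
theorem weight_pow_le (x : H) (i : ι) (j : ℕ) (h : ¬ factorPeriod T x i ∣ j) :
    weight T i (x ^ j) ≤ 1 / 8 := by
  rw [weight_pow, if_neg h]
  split_ifs <;> norm_num

omit [Finite H] in
theorem weight_nonneg (i : ι) (y : H) : 0 ≤ weight T i y := by
  unfold weight
  split_ifs <;> norm_num

omit [Finite H] in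
theorem weight_smul (hT : IsFactorSystem A T) (x : H) (i : ι) (j : ℕ) :
    weight T (x • i) (x ^ j) = weight T i (x ^ j) := by
  rw [weight_pow, weight_pow, hT.factorPeriod_smul]
  congr 2
  rw [eq_iff_iff, ← MulAction.pow_smul_eq_iff_period_dvd, ← MulAction.pow_smul_eq_iff_period_dvd,
    smul_smul, ← pow_succ, pow_succ', mul_smul, smul_left_cancel_iff]

/-- The bound obtained from a single factor: a power of `x` which does not centralize it has fixed point
ratio at most `1 / 8`. -/
theorem avgFix_le_of_factor (hT : IsFactorSystem A T) (x : H) (i : ι) :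
    avgFix A x ≤ 1 / 8 + 7 / 8 / factorPeriod T x i := by
  have := avgFix_le A x (c₀ := 1 / 8) (c₁ := 7 / 8) (c₂ := 0) (c₃ := 0)
    (factorPeriod_dvd_orderOf (T := T) x i) (one_dvd (orderOf x)) (one_dvd (orderOf x)) (fun j => by
      refine (hT.fixRatio_le_weight i _).trans ?_
      by_cases h : factorPeriod T x i ∣ j
      · rw [weight_pow, if_pos h, multInd, if_pos h]; norm_num
      · refine (weight_pow_le x i j h).trans ?_
        rw [multInd, if_neg h]; norm_num)
  simpa using this

/-- The bound obtained from a factor `i` in a cycle of length `2` of `x` and a further factor `k`,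
which is used only for the powers of `x` centralizing `T i`. -/
theorem avgFix_le_of_two (hT : IsFactorSystem A T) {x : H} {i : ι} (hi : MulAction.period x i = 2)
    (k : ι) : avgFix A x ≤ 1 / 60 + (1 / 64 - 1 / 60) / 2 + (1 / 8 - 1 / 64) / factorPeriod T x i +
      7 / 8 / (Nat.lcm (factorPeriod T x i) (factorPeriod T x k) : ℕ) := by
  have hd := hT.period_dvd_factorPeriod x i
  have := avgFix_le A x (c₀ := 1 / 60) (c₁ := 1 / 64 - 1 / 60) (c₂ := 1 / 8 - 1 / 64) (c₃ := 7 / 8)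
    (period_dvd_orderOf' x i) (factorPeriod_dvd_orderOf (T := T) x i)
    (Nat.lcm_dvd (factorPeriod_dvd_orderOf x i) (factorPeriod_dvd_orderOf x k)) (fun j => by
      unfold multInd
      by_cases h2 : MulAction.period x i ∣ j
      · by_cases h : factorPeriod T x i ∣ j
        · by_cases hk : factorPeriod T x k ∣ j
          · refine (fixRatio_le_one _ _).trans ?_
            rw [if_pos h2, if_pos h, if_pos (Nat.lcm_dvd h hk)]; norm_num
          · refine (hT.fixRatio_le_weight k _).trans ((weight_pow_le x k j hk).trans ?_)
            rw [if_pos h2, if_pos h, if_neg (fun hl => hk ((Nat.dvd_lcm_right _ _).trans hl))]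
            norm_num
        · have hne : i ≠ x • i := by
            intro e
            have : MulAction.period x i ∣ 1 := by
              rw [← MulAction.pow_smul_eq_iff_period_dvd, pow_one, ← e]
            rw [hi] at this
            norm_num at this
          have hfix := MulAction.pow_smul_eq_iff_period_dvd.mpr h2
          refine (hT.fixRatio_le_weight_mul hne (y := x ^ j) (fun hs => hne (hfix.symm.trans hs.1))).trans ?_
          rw [hT.weight_smul, weight_pow, if_neg h, if_pos h2, if_pos h2, if_neg h,
            if_neg (fun hl => h ((Nat.dvd_lcm_left _ _).trans hl))]
          norm_num
      · have h : ¬ factorPeriod T x i ∣ j := fun h => h2 (hd.trans h)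
        refine (hT.fixRatio_le_weight i _).trans ?_
        rw [weight_pow, if_neg h, if_neg h2, if_neg h2, if_neg h,
            if_neg (fun hl => h ((Nat.dvd_lcm_left _ _).trans hl))]
        norm_num)
  rw [hi] at this
  simpa using this

/-- The analogue of `avgFix_le_of_two` for cycles of length at least `3`. Here no power of `x`
interchanges `T i` and `T (x • i)`, so the product of their weights, `1 / 3600` or `1 / 64`, bounds
the fixed point ratio. -/
theorem avgFix_le_of_three (hT : IsFactorSystem A T) {x : H} {i : ι}
    (hi : 3 ≤ MulAction.period x i) (k : ι) :
    avgFix A x ≤ 1 / 3600 + (1 / 64 - 1 / 3600) / MulAction.period x i +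
      (1 / 8 - 1 / 64) / factorPeriod T x i +
      7 / 8 / (Nat.lcm (factorPeriod T x i) (factorPeriod T x k) : ℕ) := by
  have hd := hT.period_dvd_factorPeriod x i
  have hne : i ≠ x • i := by
    intro e
    have : MulAction.period x i ∣ 1 := by
      rw [← MulAction.pow_smul_eq_iff_period_dvd, pow_one, ← e]
    have := Nat.le_of_dvd one_pos this
    omega
  have hpair : ∀ j, fixRatio A (x ^ j) ≤ weight T i (x ^ j) * weight T i (x ^ j) := by
    intro j
    have := hT.fixRatio_le_weight_mul hne (y := x ^ j) (by
      rintro ⟨h1, h2⟩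
      have h3 : x ^ 2 • i = i := by
        rw [pow_two, mul_smul, ← h1, smul_smul, ← pow_succ', pow_succ, mul_smul, h2]
      have := Nat.le_of_dvd two_pos (MulAction.pow_smul_eq_iff_period_dvd.mp h3)
      omega)
    rwa [hT.weight_smul] at this
  have := avgFix_le A x (c₀ := 1 / 3600) (c₁ := 1 / 64 - 1 / 3600) (c₂ := 1 / 8 - 1 / 64)
    (c₃ := 7 / 8) (period_dvd_orderOf' x i) (factorPeriod_dvd_orderOf (T := T) x i)
    (Nat.lcm_dvd (factorPeriod_dvd_orderOf x i) (factorPeriod_dvd_orderOf x k)) (fun j => by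
      unfold multInd
      by_cases h2 : MulAction.period x i ∣ j
      · by_cases h : factorPeriod T x i ∣ j
        · by_cases hk : factorPeriod T x k ∣ j
          · refine (fixRatio_le_one _ _).trans ?_
            rw [if_pos h2, if_pos h, if_pos (Nat.lcm_dvd h hk)]; norm_num
          · refine (hT.fixRatio_le_weight k _).trans ((weight_pow_le x k j hk).trans ?_)
            rw [if_pos h2, if_pos h, if_neg (fun hl => hk ((Nat.dvd_lcm_right _ _).trans hl))]
            norm_num
        · refine (hpair j).trans ?_
          rw [weight_pow, if_neg h, if_pos h2, if_pos h2, if_neg h,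
            if_neg (fun hl => h ((Nat.dvd_lcm_left _ _).trans hl))]
          norm_num
      · have h : ¬ factorPeriod T x i ∣ j := fun h => h2 (hd.trans h)
        refine (hpair j).trans ?_
        rw [weight_pow, if_neg h, if_neg h2, if_neg h2, if_neg h,
            if_neg (fun hl => h ((Nat.dvd_lcm_left _ _).trans hl))]
        norm_num)
  exact this

/-- The bound obtained from a factor `k` fixed by `x` and another factor `i`, whose weight is at most
`a` for the powers of `x` which do not centralize it. -/
theorem avgFix_le_of_pair (hT : IsFactorSystem A T) {x : H} {i k : ι} (hik : i ≠ k)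
    (hk : x • k = k) {a : ℚ}
    (ha : ∀ j, ¬ factorPeriod T x i ∣ j → weight T i (x ^ j) ≤ a) :
    avgFix A x ≤ a / 8 + (1 - a) / 8 / factorPeriod T x i + a * 7 / 8 / factorPeriod T x k +
      (1 - a) * 7 / 8 / (Nat.lcm (factorPeriod T x i) (factorPeriod T x k) : ℕ) := by
  have hkj : ∀ j : ℕ, x ^ j • k = k := fun j => by
    rw [MulAction.pow_smul_eq_iff_period_dvd]
    exact ((MulAction.pow_smul_eq_iff_period_dvd (n := 1)).mp (by rwa [pow_one])).trans (one_dvd j)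
  refine avgFix_le A x (c₀ := a / 8) (c₁ := (1 - a) / 8) (c₂ := a * 7 / 8) (c₃ := (1 - a) * 7 / 8)
    (factorPeriod_dvd_orderOf x i) (factorPeriod_dvd_orderOf x k)
    (Nat.lcm_dvd (factorPeriod_dvd_orderOf x i) (factorPeriod_dvd_orderOf x k)) (fun j => ?_)
  refine (hT.fixRatio_le_weight_mul hik (y := x ^ j) fun h => hik (h.2.symm.trans (hkj j))).trans ?_
  rw [← multInd_mul]
  have h1 : weight T i (x ^ j) ≤ a + (1 - a) * multInd (factorPeriod T x i) j := by
    unfold multInd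
    split_ifs with h
    · rw [weight_pow, if_pos h]; linarith
    · simpa using ha j h
  have h2 : weight T k (x ^ j) ≤ 1 / 8 + 7 / 8 * multInd (factorPeriod T x k) j := by
    unfold multInd
    split_ifs with h
    · rw [weight_pow, if_pos h]; norm_num
    · simpa using weight_pow_le x k j h
  refine (mul_le_mul h1 h2 (weight_nonneg _ _) ((weight_nonneg _ _).trans h1)).trans (le_of_eq ?_)
  ring

end IsFactorSystem
end Average

/-! ### Orbit ratio bounds by order

The decimal constants are roundings of the rational bounds which the preceding section supplies. -/

section Bounds

theorem div_natCast_le_div {c : ℚ} (hc : 0 ≤ c) {m n : ℕ} (hm : 0 < m) (h : m ≤ n) :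
    c / (n : ℚ) ≤ c / m := by
  apply div_le_div_of_nonneg_left hc
  · exact_mod_cast hm
  · exact_mod_cast h

/-- A multiple of `a` which is not `a` is at least `2 * a`. -/
theorem two_mul_le_lcm {a b : ℕ} (ha : 0 < a) (hb : 0 < b) (h : ¬ b ∣ a) :
    2 * a ≤ Nat.lcm a b := by
  obtain ⟨m, hm⟩ := Nat.dvd_lcm_left a b
  have h0 : 0 < Nat.lcm a b := Nat.lcm_pos ha hb
  have h1 : m ≠ 0 := by rintro rfl; omega
  have h2 : m ≠ 1 := by
    rintro rfl
    exact h (by have := Nat.dvd_lcm_right a b; rwa [hm, mul_one] at this)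
  rw [hm, mul_comm]
  exact Nat.mul_le_mul_left a (by omega)

variable {H ι : Type*} [Group H] [Finite H] [MulAction H ι] {A : Subgroup H} {T : ι → Subgroup H}

namespace IsFactorSystem

/-- `avgFix_le_of_three` in terms of lower bounds for the two orders involved. -/
theorem avgFix_le_three (hT : IsFactorSystem A T) {x : H} {i : ι} (hi : 3 ≤ MulAction.period x i)
    (k : ι) {a l : ℕ} (ha : 0 < a) (hl : 0 < l) (hae : a ≤ factorPeriod T x i)
    (hle : l ≤ Nat.lcm (factorPeriod T x i) (factorPeriod T x k)) :
    avgFix A x ≤ 1 / 3600 + (1 / 64 - 1 / 3600) / 3 + (1 / 8 - 1 / 64) / a + 7 / 8 / l := by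
  have h := hT.avgFix_le_of_three hi k
  have h1 := div_natCast_le_div (c := 1 / 64 - 1 / 3600) (by norm_num) (by norm_num : 0 < 3) hi
  have h2 := div_natCast_le_div (c := 1 / 8 - 1 / 64) (by norm_num) ha hae
  have h3 := div_natCast_le_div (c := 7 / 8) (by norm_num) hl hle
  push_cast at h1
  linarith

/-- `avgFix_le_of_three` without a further factor, for cycles of length at least `r`. -/
theorem avgFix_le_three_self (hT : IsFactorSystem A T) {x : H} {i : ι} {r : ℕ} (hr : 0 < r)
    (hi : 3 ≤ MulAction.period x i) (hri : r ≤ MulAction.period x i) {a : ℕ} (ha : 0 < a)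
    (hae : a ≤ factorPeriod T x i) :
    avgFix A x ≤ 1 / 3600 + (1 / 64 - 1 / 3600) / r + 63 / 64 / a := by
  have h := hT.avgFix_le_of_three hi i
  rw [Nat.lcm_self] at h
  have h1 := div_natCast_le_div (c := 1 / 64 - 1 / 3600) (by norm_num) hr hri
  have h2 := div_natCast_le_div (c := 1 / 8 - 1 / 64) (by norm_num) ha hae
  have h3 := div_natCast_le_div (c := 7 / 8) (by norm_num) ha hae
  have h4 : (1 / 8 - 1 / 64) / (a : ℚ) + 7 / 8 / a = 63 / 64 / a := by ring
  linarith

/-- `avgFix_le_of_two` in terms of lower bounds for the two orders involved. -/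
theorem avgFix_le_two (hT : IsFactorSystem A T) {x : H} {i : ι} (hi : MulAction.period x i = 2)
    (k : ι) {a l : ℕ} (ha : 0 < a) (hl : 0 < l) (hae : a ≤ factorPeriod T x i)
    (hle : l ≤ Nat.lcm (factorPeriod T x i) (factorPeriod T x k)) :
    avgFix A x ≤ 1 / 60 + (1 / 64 - 1 / 60) / 2 + (1 / 8 - 1 / 64) / a + 7 / 8 / l := by
  have h := hT.avgFix_le_of_two hi k
  have h2 := div_natCast_le_div (c := 1 / 8 - 1 / 64) (by norm_num) ha hae
  have h3 := div_natCast_le_div (c := 7 / 8) (by norm_num) hl hle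
  linarith

/-- A factor fixed by `x` together with a factor in a cycle of length `2` on which `x ^ 2` acts
trivially. -/
theorem avgFix_le_two_fixed (hT : IsFactorSystem A T) {x : H} {i k : ι}
    (hi : MulAction.period x i = 2) (hi2 : factorPeriod T x i = 2) (hk : x • k = k) {a l : ℕ}
    (ha : 0 < a) (hl : 0 < l) (hae : a ≤ factorPeriod T x k)
    (hle : l ≤ Nat.lcm 2 (factorPeriod T x k)) :
    avgFix A x ≤ 1 / 480 + 59 / 960 + 7 / 480 / a + 413 / 480 / l := by
  have hik : i ≠ k := by
    rintro rfl
    rw [← pow_one x, MulAction.pow_smul_eq_iff_period_dvd, hi] at hk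
    norm_num at hk
  have h := hT.avgFix_le_of_pair hik hk (a := 1 / 60) (fun j hj => by
    rw [weight_pow, if_neg hj, if_neg (by rwa [hi, ← hi2])])
  rw [hi2] at h
  have h2 := div_natCast_le_div (c := 1 / 60 * 7 / 8) (by norm_num) ha hae
  have h3 := div_natCast_le_div (c := (1 - 1 / 60) * 7 / 8) (by norm_num) hl hle
  norm_num at h h2 h3 ⊢
  linarith

/-- `avgFix_le_of_pair` with weight `1 / 8`, in terms of lower bounds for the orders involved. -/
theorem avgFix_le_pair (hT : IsFactorSystem A T) {x : H} {i k : ι} (hik : i ≠ k)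
    (hk : x • k = k) {a b l : ℕ} (ha : 0 < a) (hb : 0 < b) (hl : 0 < l)
    (hae : a ≤ factorPeriod T x i) (hbe : b ≤ factorPeriod T x k)
    (hle : l ≤ Nat.lcm (factorPeriod T x i) (factorPeriod T x k)) :
    avgFix A x ≤ 1 / 64 + 7 / 64 / a + 7 / 64 / b + 49 / 64 / l := by
  have h := hT.avgFix_le_of_pair hik hk (a := 1 / 8) (weight_pow_le x i)
  have h1 := div_natCast_le_div (c := (1 - 1 / 8) / 8) (by norm_num) ha hae
  have h2 := div_natCast_le_div (c := 1 / 8 * 7 / 8) (by norm_num) hb hbe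
  have h3 := div_natCast_le_div (c := (1 - 1 / 8) * 7 / 8) (by norm_num) hl hle
  norm_num at h h1 h2 h3 ⊢
  linarith

/-! ### Elements with a cycle of length at least three on the factors -/

theorem avgFix_le_of_three_le_period (hT : IsFactorSystem A T) {x : H} {i : ι}
    (hi : 3 ≤ MulAction.period x i) : avgFix A x ≤ 0.33352 := by
  have hd := Nat.le_of_dvd (factorPeriod_pos x i) (hT.period_dvd_factorPeriod x i)
  have := hT.avgFix_le_three_self (by norm_num) hi hi (by norm_num) (hi.trans hd)
  norm_num at this ⊢
  linarith

theorem avgFix_le_of_three_le_period_of_eq (hT : IsFactorSystem A T) {x : H} {i : ι}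
    (hi : 3 ≤ MulAction.period x i) (ho : orderOf x = 4 ∨ orderOf x = 5) :
    avgFix A x ≤ 1 / orderOf x + 0.0003 := by
  have hd : MulAction.period x i ∣ orderOf x := period_dvd_orderOf' x i
  have hle := Nat.le_of_dvd (factorPeriod_pos x i) (hT.period_dvd_factorPeriod x i)
  have hr : MulAction.period x i = orderOf x := by
    have := Nat.le_of_dvd (orderOf_pos x) hd
    rcases ho with ho | ho <;> rw [ho] at hd this ⊢ <;>
    · generalize MulAction.period x i = r at *
      interval_cases r <;> first | rfl | (exfalso; revert hd; decide)
  have := hT.avgFix_le_three_self (orderOf_pos x) hi hr.ge (orderOf_pos x) (hr ▸ hle)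
  rcases ho with ho | ho <;> rw [ho] at this ⊢ <;> norm_num at this ⊢ <;> linarith

/-- If `x` has order at least `6` but smaller order on `T i`, some further factor raises the least common
multiple of the two orders to `6` or more. -/
theorem avgFix_le_of_three_le_period_of_six_le (hT : IsFactorSystem A T) {x : H} {i : ι}
    (hi : 3 ≤ MulAction.period x i) (ho : 6 ≤ orderOf x) : avgFix A x ≤ 0.19 := by
  have hle := Nat.le_of_dvd (factorPeriod_pos x i) (hT.period_dvd_factorPeriod x i)
  by_cases h6 : 6 ≤ factorPeriod T x i
  · have := hT.avgFix_le_three_self (by norm_num) hi hi (by norm_num) h6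
    norm_num at this ⊢
    linarith
  have hnd : ¬ orderOf x ∣ factorPeriod T x i := fun h => by
    have := Nat.le_of_dvd (factorPeriod_pos x i) h
    omega
  obtain ⟨k, hk⟩ := hT.exists_not_dvd hnd
  have h2 := two_mul_le_lcm (factorPeriod_pos x i) (factorPeriod_pos x k) hk
  have := hT.avgFix_le_three hi k (a := 3) (l := 6) (by norm_num) (by norm_num) (hi.trans hle)
    (by omega)
  norm_num at this ⊢
  linarith

/-- Analogous to `avgFix_le_of_three_le_period_of_six_le`. If `x` has order `3` on `T i`, the further factor
is taken with order not dividing `6`, which makes the least common multiple at least `9`. -/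
theorem avgFix_le_of_three_le_period_of_seven_le (hT : IsFactorSystem A T) {x : H} {i : ι}
    (hi : 3 ≤ MulAction.period x i) (ho : 7 ≤ orderOf x) : avgFix A x ≤ 0.1529 := by
  have hdvd := hT.period_dvd_factorPeriod x i
  have hle := Nat.le_of_dvd (factorPeriod_pos x i) hdvd
  by_cases h7 : 7 ≤ factorPeriod T x i
  · have := hT.avgFix_le_three_self (by norm_num) hi hi (by norm_num) h7
    norm_num at this ⊢
    linarith
  by_cases h3 : factorPeriod T x i = 3
  · have hnd : ¬ orderOf x ∣ 6 := fun h => by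
      have := Nat.le_of_dvd (by norm_num) h
      omega
    obtain ⟨k, hk⟩ := hT.exists_not_dvd hnd
    have hl : 9 ≤ Nat.lcm (factorPeriod T x i) (factorPeriod T x k) := by
      rw [h3]
      obtain ⟨m, hm⟩ := Nat.dvd_lcm_left 3 (factorPeriod T x k)
      have hpos : 0 < Nat.lcm 3 (factorPeriod T x k) := Nat.lcm_pos (by norm_num) (factorPeriod_pos x k)
      have hkd := Nat.dvd_lcm_right 3 (factorPeriod T x k)
      rw [hm] at hpos hkd ⊢
      have : m ≠ 1 := by rintro rfl; exact hk (hkd.trans (by norm_num))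
      have : m ≠ 2 := by rintro rfl; exact hk (hkd.trans (by norm_num))
      omega
    have := hT.avgFix_le_three hi k (a := 3) (l := 9) (by norm_num) (by norm_num) (hi.trans hle) hl
    norm_num at this ⊢
    linarith
  have hnd : ¬ orderOf x ∣ factorPeriod T x i := fun h => by
    have := Nat.le_of_dvd (factorPeriod_pos x i) h
    omega
  obtain ⟨k, hk⟩ := hT.exists_not_dvd hnd
  have h2 := two_mul_le_lcm (factorPeriod_pos x i) (factorPeriod_pos x k) hk
  have := hT.avgFix_le_three hi k (a := 4) (l := 8) (by norm_num) (by norm_num) (by omega)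
    (by omega)
  norm_num at this ⊢
  linarith

/-! ### Elements acting on the factors as involutions -/

omit [Finite H] in
theorem two_dvd_factorPeriod (hT : IsFactorSystem A T) {x : H} {i : ι}
    (hi : MulAction.period x i = 2) : 2 ∣ factorPeriod T x i :=
  hi ▸ hT.period_dvd_factorPeriod x i

theorem smul_eq_of_period_ne_two {x : H} {k : ι} (h3 : MulAction.period x k < 3)
    (h : MulAction.period x k ≠ 2) : x • k = k := by
  have := period_pos' x k
  rw [← pow_one x, MulAction.pow_smul_eq_iff_period_dvd]
  have : MulAction.period x k = 1 := by omega
  rw [this]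

theorem avgFix_le_of_orderOf_eq_two (hT : IsFactorSystem A T) {x : H} {i : ι}
    (hi : MulAction.period x i = 2) : avgFix A x ≤ 0.50834 := by
  have h2 := Nat.le_of_dvd (factorPeriod_pos x i) (hT.two_dvd_factorPeriod hi)
  have := hT.avgFix_le_two hi i (a := 2) (l := 2) (by norm_num) (by norm_num) h2
    (by rwa [Nat.lcm_self])
  norm_num at this ⊢
  linarith

/-- The weaker second bound occurs if `x ^ 2` acts trivially on the factors moved by `x`; then `x` acts with
order `4` on a factor which it fixes. -/
theorem avgFix_le_of_orderOf_eq_four (hT : IsFactorSystem A T) {x : H} {i : ι}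
    (hi : MulAction.period x i = 2) (hx : ∀ k : ι, MulAction.period x k < 3) (ho : orderOf x = 4) :
    avgFix A x ≤ 0.2623 ∨ (∃ k : ι, x • k = k) ∧ avgFix A x ≤ 0.2824 := by
  have key : ∀ j, MulAction.period x j = 2 → 4 ≤ factorPeriod T x j → avgFix A x ≤ 0.2623 := by
    intro j hj h4
    have := hT.avgFix_le_two hj j (a := 4) (l := 4) (by norm_num) (by norm_num) h4
      (by rwa [Nat.lcm_self])
    norm_num at this ⊢
    linarith
  by_cases h4 : 4 ≤ factorPeriod T x i
  · exact .inl (key i hi h4)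
  have h2 := hT.two_dvd_factorPeriod hi
  have hpos := factorPeriod_pos (T := T) x i
  have hi2 : factorPeriod T x i = 2 := by omega
  obtain ⟨k, hk⟩ := hT.exists_not_dvd (x := x) (n := 2) (by rw [ho]; norm_num)
  have hk4 : factorPeriod T x k = 4 := by
    have hd := factorPeriod_dvd_orderOf (T := T) x k
    rw [ho] at hd
    have := Nat.le_of_dvd (by norm_num) hd
    generalize factorPeriod T x k = e at *
    interval_cases e <;> revert hd hk <;> decide
  by_cases hk2 : MulAction.period x k = 2
  · exact .inl (key k hk2 hk4.ge)
  · right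
    have hkf := smul_eq_of_period_ne_two (hx k) hk2
    refine ⟨⟨k, hkf⟩, ?_⟩
    have := hT.avgFix_le_two_fixed hi hi2 hkf (a := 4) (l := 4) (by norm_num) (by norm_num) hk4.ge
      (by rw [hk4]; decide)
    norm_num at this ⊢
    linarith

/-- If `x ^ 2` acts trivially on the factors moved by `x`, the order `6` comes from a factor fixed by `x`
with order `3` or `6`. -/
theorem avgFix_le_of_orderOf_eq_six (hT : IsFactorSystem A T) {x : H} {i : ι}
    (hi : MulAction.period x i = 2) (hx : ∀ k : ι, MulAction.period x k < 3) (ho : orderOf x = 6) :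
    avgFix A x ≤ 0.2119 := by
  have key : ∀ j, MulAction.period x j = 2 → 6 ≤ factorPeriod T x j → avgFix A x ≤ 0.2119 := by
    intro j hj h4
    have := hT.avgFix_le_two hj j (a := 6) (l := 6) (by norm_num) (by norm_num) h4
      (by rwa [Nat.lcm_self])
    norm_num at this ⊢
    linarith
  have aux : ∀ e ≤ 6, e ∣ 6 → 2 ∣ e → ¬ 6 ≤ e → e = 2 := by decide
  by_cases h4 : 6 ≤ factorPeriod T x i
  · exact key i hi h4
  have hi2 : factorPeriod T x i = 2 :=
    aux _ (by omega) (ho ▸ factorPeriod_dvd_orderOf x i) (hT.two_dvd_factorPeriod hi) h4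
  obtain ⟨k, hk⟩ := hT.exists_not_dvd (x := x) (n := 2) (by rw [ho]; norm_num)
  have hkd : factorPeriod T x k ∣ 6 := ho ▸ factorPeriod_dvd_orderOf x k
  have hk6 := Nat.le_of_dvd (by norm_num) hkd
  by_cases hk2 : MulAction.period x k = 2
  · refine key k hk2 ?_
    by_contra h6
    exact hk (aux _ hk6 hkd (hT.two_dvd_factorPeriod hk2) h6 ▸ dvd_rfl)
  · have hkf := smul_eq_of_period_ne_two (hx k) hk2
    have aux2 : ∀ e ≤ 6, e ∣ 6 → ¬ e ∣ 2 → 3 ≤ e ∧ 6 ≤ Nat.lcm 2 e := by decide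
    obtain ⟨h3, h6⟩ := aux2 _ hk6 hkd hk
    have := hT.avgFix_le_two_fixed hi hi2 hkf (a := 3) (l := 6) (by norm_num) (by norm_num) h3 h6
    norm_num at this ⊢
    linarith

/-- The exceptional elements have order `8`, and their squares act trivially on the factors which they move;
then the least common multiple available from two factors is `8` only. -/
theorem avgFix_le_of_seven_le_orderOf (hT : IsFactorSystem A T) {x : H} {i : ι}
    (hi : MulAction.period x i = 2) (hx : ∀ k : ι, MulAction.period x k < 3) (ho : 7 ≤ orderOf x) :
    avgFix A x ≤ 0.1529 ∨
      (orderOf x = 8 ∧ (∀ j : ι, x • j ≠ j → factorPeriod T x j ∣ 2) ∧ avgFix A x ≤ 0.1748) := by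
  have key : ∀ j, MulAction.period x j = 2 → factorPeriod T x j ≠ 2 → avgFix A x ≤ 0.1529 := by
    intro j hj h2
    have hev := hT.two_dvd_factorPeriod hj
    have hpos := factorPeriod_pos (T := T) x j
    by_cases h8 : 8 ≤ factorPeriod T x j
    · have := hT.avgFix_le_two hj j (a := 8) (l := 8) (by norm_num) (by norm_num) h8
        (by rwa [Nat.lcm_self])
      norm_num at this ⊢
      linarith
    · obtain ⟨k, hk⟩ := hT.exists_not_dvd (x := x) (n := factorPeriod T x j)
        (fun h => by have := Nat.le_of_dvd hpos h; omega)
      have h2 := two_mul_le_lcm hpos (factorPeriod_pos x k) hk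
      have := hT.avgFix_le_two hj k (a := 4) (l := 8) (by norm_num) (by norm_num) (by omega)
        (by omega)
      norm_num at this ⊢
      linarith
  by_cases hall : ∀ j, MulAction.period x j = 2 → factorPeriod T x j = 2
  swap
  · push Not at hall
    obtain ⟨j, hj, h2⟩ := hall
    exact .inl (key j hj h2)
  have hi2 := hall i hi
  have hfix : ∀ k, ¬ factorPeriod T x k ∣ 2 → x • k = k := fun k hk =>
    smul_eq_of_period_ne_two (hx k) fun h => hk (hall k h ▸ dvd_rfl)
  have key2 : ∀ k, ¬ factorPeriod T x k ∣ 2 → 10 ≤ Nat.lcm 2 (factorPeriod T x k) →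
      avgFix A x ≤ 0.1529 := by
    intro k hk h10
    have h5 : 5 ≤ factorPeriod T x k := by
      by_contra h
      have hpos := factorPeriod_pos (T := T) x k
      generalize factorPeriod T x k = e at *
      have : e ≤ 4 := by omega
      interval_cases e <;> revert h10 <;> decide
    have := hT.avgFix_le_two_fixed hi hi2 (hfix k hk) (a := 5) (l := 10) (by norm_num) (by norm_num)
      h5 h10
    norm_num at this ⊢
    linarith
  by_cases h10 : ∃ k, ¬ factorPeriod T x k ∣ 2 ∧ 10 ≤ Nat.lcm 2 (factorPeriod T x k)
  · obtain ⟨k, hk, h⟩ := h10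
    exact .inl (key2 k hk h)
  push Not at h10
  have hsmall : ∀ k, ¬ factorPeriod T x k ∣ 2 → factorPeriod T x k ≤ 8 ∧
      (factorPeriod T x k = 3 ∨ factorPeriod T x k = 4 ∨ factorPeriod T x k = 6 ∨
        factorPeriod T x k = 8) := by
    intro k hk
    have h := h10 k hk
    have hpos := factorPeriod_pos (T := T) x k
    have hle := Nat.le_of_dvd (Nat.lcm_pos two_pos hpos) (Nat.dvd_lcm_right 2 (factorPeriod T x k))
    generalize factorPeriod T x k = e at *
    have : e ≤ 9 := by omega
    interval_cases e <;> revert h hk <;> decide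
  by_cases h8 : orderOf x ∣ 8
  · right
    have ho8 : orderOf x = 8 := by
      have := Nat.le_of_dvd (by norm_num) h8
      generalize orderOf x = o at *
      interval_cases o <;> revert h8 <;> decide
    refine ⟨ho8, fun j hj => ?_, ?_⟩
    · by_contra h
      exact hj (hfix j h)
    · obtain ⟨k, hk⟩ := hT.exists_not_dvd (x := x) (n := 4) (by rw [ho8]; norm_num)
      have hk2 : ¬ factorPeriod T x k ∣ 2 := fun h => hk (h.trans (by norm_num))
      have hk8 : factorPeriod T x k = 8 := by
        have hd := (factorPeriod_dvd_orderOf (T := T) x k).trans h8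
        rcases (hsmall k hk2).2 with h | h | h | h <;> rw [h] at hk hd ⊢ <;> revert hk hd <;> decide
      have := hT.avgFix_le_two_fixed hi hi2 (hfix k hk2) (a := 8) (l := 8) (by norm_num)
        (by norm_num) hk8.ge (by rw [hk8]; decide)
      norm_num at this ⊢
      linarith
  · left
    obtain ⟨k, hk⟩ := hT.exists_not_dvd h8
    obtain ⟨m, hm⟩ := hT.exists_not_dvd (x := x) (n := 6) (fun h => by
      have := Nat.le_of_dvd (by norm_num) h
      omega)
    have hk2 : ¬ factorPeriod T x k ∣ 2 := fun h => hk (h.trans (by norm_num))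
    have hm2 : ¬ factorPeriod T x m ∣ 2 := fun h => hm (h.trans (by norm_num))
    have hk36 : factorPeriod T x k = 3 ∨ factorPeriod T x k = 6 := by
      rcases (hsmall k hk2).2 with h | h | h | h <;> rw [h] at hk ⊢ <;> revert hk <;> decide
    have hm48 : factorPeriod T x m = 4 ∨ factorPeriod T x m = 8 := by
      rcases (hsmall m hm2).2 with h | h | h | h <;> rw [h] at hm ⊢ <;> revert hm <;> decide
    have hkm : k ≠ m := by rintro rfl; omega
    have := hT.avgFix_le_pair hkm (hfix m hm2) (a := 3) (b := 4) (l := 12) (by norm_num)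
      (by norm_num) (by norm_num) (by omega) (by omega)
      (by rcases hk36 with h | h <;> rcases hm48 with h' | h' <;> rw [h, h'] <;> decide)
    norm_num at this ⊢
    linarith

end IsFactorSystem
end Bounds

/-! ### Orders of generating triples -/

section Triangle

variable {H : Type*} [Group H]

/-- `x * y * z = 1` and `x, y, z` generate the group. -/
structure IsTriple (x y z : H) : Prop where
  prod : x * y * z = 1
  gen : Subgroup.closure {x, y, z} = ⊤

namespace IsTriple

variable {x y z : H}

theorem of_le {a b c : H} (h : IsTriple x y z) (hp : a * b * c = 1)
    (hx : x ∈ Subgroup.closure {a, b, c}) (hy : y ∈ Subgroup.closure {a, b, c})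
    (hz : z ∈ Subgroup.closure {a, b, c}) : IsTriple a b c := by
  refine ⟨hp, ?_⟩
  rw [eq_top_iff, ← h.gen, Subgroup.closure_le]
  rintro _ (rfl | rfl | rfl)
  exacts [hx, hy, hz]

theorem rotate (h : IsTriple x y z) : IsTriple y z x := by
  refine h.of_le ?_ (Subgroup.subset_closure (by simp)) (Subgroup.subset_closure (by simp))
    (Subgroup.subset_closure (by simp))
  have := h.prod
  rw [mul_assoc] at this
  exact mul_eq_one_iff_eq_inv.mpr (eq_inv_of_mul_eq_one_right this)

/-- The braid move, which exchanges the orders of the first two members. -/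
theorem swap (h : IsTriple x y z) : IsTriple y (y⁻¹ * x * y) z := by
  have hy : y ∈ Subgroup.closure {y, y⁻¹ * x * y, z} := Subgroup.subset_closure (by simp)
  have hm : y⁻¹ * x * y ∈ Subgroup.closure {y, y⁻¹ * x * y, z} := Subgroup.subset_closure (by simp)
  refine h.of_le ?_ ?_ hy (Subgroup.subset_closure (by simp))
  · have := h.prod
    rw [← this]; group
  · have := Subgroup.mul_mem _ (Subgroup.mul_mem _ hy hm) (Subgroup.inv_mem _ hy)
    simpa [mul_assoc] using this

theorem closure_pair (h : IsTriple x y z) : Subgroup.closure {x, y} = ⊤ := by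
  rw [eq_top_iff, ← h.gen, Subgroup.closure_le]
  have hx : x ∈ Subgroup.closure {x, y} := Subgroup.subset_closure (by simp)
  have hy : y ∈ Subgroup.closure {x, y} := Subgroup.subset_closure (by simp)
  rintro _ (rfl | rfl | rfl)
  · exact hx
  · exact hy
  · rw [eq_inv_of_mul_eq_one_right h.prod]
    exact Subgroup.inv_mem _ (Subgroup.mul_mem _ hx hy)

end IsTriple

/-- No nontrivial normal subgroup of `H` is abelian. -/
def NoAbelianNormal (H : Type*) [Group H] : Prop :=
  ∀ N : Subgroup H, N.Normal → (∀ x ∈ N, ∀ y ∈ N, x * y = y * x) → N = ⊥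

variable [Finite H]

/-- A set of commuting elements generating a subgroup invariant under two generators of the group
is trivial if there are no abelian normal subgroups. -/
theorem NoAbelianNormal.eq_one_of_mem (hH : NoAbelianNormal H) {x y : H}
    (hxy : Subgroup.closure {x, y} = ⊤) {S : Set H} (hS : ∀ s ∈ S, ∀ t ∈ S, s * t = t * s)
    (hx : ∀ s ∈ S, x * s * x⁻¹ ∈ Subgroup.closure S)
    (hy : ∀ s ∈ S, y * s * y⁻¹ ∈ Subgroup.closure S) : ∀ s ∈ S, s = 1 := by
  have hle : ∀ g : H, (∀ s ∈ S, g * s * g⁻¹ ∈ Subgroup.closure S) →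
      g ∈ Subgroup.normalizer (Subgroup.closure S : Set H) := by
    intro g hg
    have h1 : (Subgroup.closure S).map (MulAut.conj g).toMonoidHom = Subgroup.closure S := by
      apply Subgroup.eq_of_le_of_card_ge
      · rw [MonoidHom.map_closure, Subgroup.closure_le]
        rintro _ ⟨s, hs, rfl⟩
        exact hg s hs
      · exact (Subgroup.card_map_of_injective (MulAut.conj g).injective).ge
    rw [Subgroup.mem_normalizer_iff]
    intro t
    constructor
    · intro ht
      rw [← h1]
      exact ⟨t, ht, rfl⟩
    · intro ht
      rw [← h1] at ht
      obtain ⟨u, hu, hut⟩ := ht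
      have : u = t := (MulAut.conj g).injective hut
      exact this ▸ hu
  have hN : (Subgroup.closure S).Normal := by
    rw [← Subgroup.normalizer_eq_top_iff, eq_top_iff, ← hxy, Subgroup.closure_le]
    rintro _ (rfl | rfl)
    exacts [hle _ hx, hle _ hy]
  have hcomm : ∀ a ∈ Subgroup.closure S, ∀ b ∈ Subgroup.closure S, a * b = b * a := by
    have h1 : Subgroup.closure S ≤ Subgroup.centralizer S := by
      rw [Subgroup.closure_le]
      exact fun s hs => Subgroup.mem_centralizer_iff.mpr fun t ht => hS t ht s hs
    have h2 : Subgroup.closure S ≤ Subgroup.centralizer (Subgroup.closure S : Set H) := by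
      rw [Subgroup.closure_le]
      refine fun s hs => Subgroup.mem_centralizer_iff.mpr fun t ht => ?_
      exact (Subgroup.mem_centralizer_iff.mp (h1 ht) s hs).symm
    exact fun a ha b hb => (Subgroup.mem_centralizer_iff.mp (h2 ha) b hb).symm
  have hb := hH _ hN hcomm
  intro s hs
  rw [← Subgroup.mem_bot, ← hb]
  exact Subgroup.subset_closure hs

variable {x y : H}

theorem NoAbelianNormal.not_commute [Nontrivial H] (hH : NoAbelianNormal H)
    (hxy : Subgroup.closure {x, y} = ⊤) : x * y ≠ y * x := by
  intro hc
  have h := hH.eq_one_of_mem hxy (S := {x, y}) (by rintro _ (rfl | rfl) _ (rfl | rfl) <;> simp [hc])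
    (by rintro s (rfl | rfl)
        · exact Subgroup.subset_closure (by simp)
        · rw [hc, mul_inv_cancel_right]; exact Subgroup.subset_closure (by simp))
    (by rintro s (rfl | rfl)
        · rw [← hc, mul_inv_cancel_right]; exact Subgroup.subset_closure (by simp)
        · exact Subgroup.subset_closure (by simp))
  have h1 : ({x, y} : Set H) ⊆ (⊥ : Subgroup H) := fun s hs => h s hs
  have := (Subgroup.closure_le _).mpr h1
  rw [hxy] at this
  exact bot_ne_top (top_le_iff.mp this)

/-- The product `x * y` is inverted by `x` and by `y`: the group is dihedral. -/
theorem NoAbelianNormal.not_two_two [Nontrivial H] (hH : NoAbelianNormal H)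
    (hxy : Subgroup.closure {x, y} = ⊤) (hx : x ^ 2 = 1) (hy : y ^ 2 = 1) : False := by
  have hxi : x⁻¹ = x := inv_eq_of_mul_eq_one_left (by rw [← pow_two, hx])
  have hyi : y⁻¹ = y := inv_eq_of_mul_eq_one_left (by rw [← pow_two, hy])
  have hm : (x * y)⁻¹ ∈ Subgroup.closure {x * y} :=
    Subgroup.inv_mem _ (Subgroup.subset_closure rfl)
  have h := hH.eq_one_of_mem hxy (S := {x * y}) (by rintro _ rfl _ rfl; rfl)
    (by rintro _ rfl; convert hm using 1; rw [mul_inv_rev, hxi, hyi, ← mul_assoc, ← pow_two, hx]; simp)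
    (by rintro _ rfl; convert hm using 1; rw [mul_inv_rev, hyi, hxi, mul_assoc, mul_assoc, ← pow_two, hy]; simp)
    _ rfl
  apply hH.not_commute hxy
  rw [h, ← hxi, ← hyi, ← mul_inv_rev, h, inv_one]

/-- In the tetrahedral group, `x` and its conjugates by `y` form a Klein four-group. -/
theorem NoAbelianNormal.not_two_three_three [Nontrivial H] (hH : NoAbelianNormal H)
    (hxy : Subgroup.closure {x, y} = ⊤) (hx : x ^ 2 = 1) (hy : y ^ 3 = 1) (hz : (x * y) ^ 3 = 1) :
    False := by
  have hx2 : x * x = 1 := by rw [← pow_two, hx]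
  have hy3 : y * y * y = 1 := by rw [← hy]; simp only [pow_succ, pow_zero, one_mul, mul_assoc]
  have hz3 : x * y * x * y * x * y = 1 := by rw [← hz]; simp only [pow_succ, pow_zero, one_mul, mul_assoc]
  have hxi : x⁻¹ = x := inv_eq_of_mul_eq_one_left hx2
  have hyi : y⁻¹ = y * y := inv_eq_of_mul_eq_one_left hy3
  have h := hH.eq_one_of_mem hxy (S := {x, y * x * y * y, y * y * x * y})
    (by rintro s (rfl | rfl | rfl) t (rfl | rfl | rfl) <;> grind)
    (by rintro s (rfl | rfl | rfl) <;> rw [hxi] <;> apply Subgroup.subset_closure <;>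
          simp only [Set.mem_insert_iff, Set.mem_singleton_iff]
        · left; grind
        · right; left; grind
        · right; right; grind)
    (by rintro s (rfl | rfl | rfl) <;> rw [hyi] <;> apply Subgroup.subset_closure <;>
          simp only [Set.mem_insert_iff, Set.mem_singleton_iff]
        · right; left; grind
        · right; right; grind
        · left; grind)
    x (by simp)
  exact hH.not_commute hxy (by rw [h, one_mul, mul_one])

/-- In the octahedral group, `(x * y) ^ 2` and its conjugates form a Klein four-group; modulo it the group
is generated by two involutions. -/
theorem NoAbelianNormal.not_two_three_four [Nontrivial H] (hH : NoAbelianNormal H)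
    (hxy : Subgroup.closure {x, y} = ⊤) (hx : x ^ 2 = 1) (hy : y ^ 3 = 1) (hz : (x * y) ^ 4 = 1) :
    False := by
  have hx2 : x * x = 1 := by rw [← pow_two, hx]
  have hy3 : y * y * y = 1 := by rw [← hy]; simp only [pow_succ, pow_zero, one_mul, mul_assoc]
  have hz4 : x * y * x * y * x * y * x * y = 1 := by rw [← hz]; simp only [pow_succ, pow_zero, one_mul, mul_assoc]
  have hxi : x⁻¹ = x := inv_eq_of_mul_eq_one_left hx2
  have hyi : y⁻¹ = y * y := inv_eq_of_mul_eq_one_left hy3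
  have h := hH.eq_one_of_mem hxy (S := {x * y * x * y, y * x * y * x, y * y * x * y * x * y * y})
    (by rintro s (rfl | rfl | rfl) t (rfl | rfl | rfl) <;> grind)
    (by rintro s (rfl | rfl | rfl) <;> rw [hxi] <;> apply Subgroup.subset_closure <;>
          simp only [Set.mem_insert_iff, Set.mem_singleton_iff]
        · right; left; grind
        · left; grind
        · right; right; grind)
    (by rintro s (rfl | rfl | rfl) <;> rw [hyi] <;> apply Subgroup.subset_closure <;>
          simp only [Set.mem_insert_iff, Set.mem_singleton_iff]
        · right; left; grind
        · right; right; grind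
        · left; grind)
    (x * y * x * y) (by simp)
  have hc : Subgroup.closure {x, x * y} = ⊤ := by
    rw [eq_top_iff, ← hxy, Subgroup.closure_le]
    have h1 : x ∈ Subgroup.closure {x, x * y} := Subgroup.subset_closure (by simp)
    have h2 : x * y ∈ Subgroup.closure {x, x * y} := Subgroup.subset_closure (by simp)
    rintro _ (rfl | rfl)
    · exact h1
    · have := Subgroup.mul_mem _ (Subgroup.inv_mem _ h1) h2
      rwa [inv_mul_cancel_left] at this
  exact hH.not_two_two hc hx (by rw [pow_two, ← h]; group)

/-- The commutator of `x` and `y` is a translation of the Euclidean triangle group `(2, 3, 6)`. -/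
theorem NoAbelianNormal.not_two_three_six [Nontrivial H] (hH : NoAbelianNormal H)
    (hxy : Subgroup.closure {x, y} = ⊤) (hx : x ^ 2 = 1) (hy : y ^ 3 = 1) (hz : (x * y) ^ 6 = 1) :
    False := by
  have hx2 : x * x = 1 := by rw [← pow_two, hx]
  have hy3 : y * y * y = 1 := by rw [← hy]; simp only [pow_succ, pow_zero, one_mul, mul_assoc]
  have hxi : x⁻¹ = x := inv_eq_of_mul_eq_one_left hx2
  have hyi : y⁻¹ = y * y := inv_eq_of_mul_eq_one_left hy3
  have hyx : y * x * y * x * y * x = x * y⁻¹ * x * y⁻¹ * x * y⁻¹ := by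
    have h1 : (y * x) ^ 6 = 1 := by
      have : y * x = x⁻¹ * (x * y) * x⁻¹⁻¹ := by group
      rw [this, conj_pow, hz]; group
    have h2 : (y * x) ^ 3 = ((y * x) ^ 3)⁻¹ := by
      rw [eq_inv_iff_mul_eq_one, ← pow_add, h1]
    have h3 : (y * x)⁻¹ = x * y⁻¹ := by rw [mul_inv_rev, hxi]
    rw [← inv_pow, h3] at h2
    simpa only [pow_succ, pow_zero, one_mul, mul_assoc] using h2
  -- three translations permuted by `y` and inverted by `x`
  set a := x * y * x * y⁻¹ with ha
  have hab : a * (y * a * y⁻¹) = y * a * y⁻¹ * a := by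
    have e1 : a * (y * a * y⁻¹) = x * y⁻¹ * x * y := by
      have : a * (y * a * y⁻¹) = x * y * (x * x) * y * x * (y⁻¹ * y⁻¹) := by rw [ha]; group
      have e4 : y⁻¹ * y⁻¹ = y := by rw [inv_mul_eq_iff_eq_mul, hyi]
      have e5 : y * y = y⁻¹ := hyi.symm
      rw [this, hx2, e4, mul_one, mul_assoc x y y, e5]
    have e2 : y * a * y⁻¹ * a = x * y⁻¹ * x * y := by
      have e3 : y * a * y⁻¹ * a = y * x * y * x * (y⁻¹ * y⁻¹) * x * y * x * y⁻¹ := by rw [ha]; group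
      have e4 : y⁻¹ * y⁻¹ = y := by rw [inv_mul_eq_iff_eq_mul, hyi]
      rw [e3, e4]
      calc y * x * y * x * y * x * y * x * y⁻¹ = (y * x * y * x * y * x) * (y * x * y⁻¹) := by group
        _ = x * y⁻¹ * x * y⁻¹ * (x * x) * (y⁻¹) := by rw [hyx]; group
        _ = _ := by rw [hx2, mul_one, mul_assoc _ y⁻¹ y⁻¹, e4]
    rw [e1, e2]
  set b := y * a * y⁻¹ with hb
  set c := y * b * y⁻¹ with hc
  have hca : y * c * y⁻¹ = a := by
    have : y * c * y⁻¹ = (y * y * y) * a * (y * y * y)⁻¹ := by rw [hc, hb]; group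
    rw [this, hy3, inv_one, one_mul, mul_one]
  have hbc : b * c = c * b := by
    have : y * (a * b) * y⁻¹ = y * (b * a) * y⁻¹ := by rw [hab]
    calc b * c = y * (a * b) * y⁻¹ := by rw [hc, hb]; group
      _ = y * (b * a) * y⁻¹ := this
      _ = c * b := by rw [hc, hb]; group
  have hca' : c * a = a * c := by
    have : y * (b * c) * y⁻¹ = y * (c * b) * y⁻¹ := by rw [hbc]
    calc c * a = (y * b * y⁻¹) * (y * c * y⁻¹) := by rw [hca]
      _ = y * (b * c) * y⁻¹ := by group
      _ = y * (c * b) * y⁻¹ := this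
      _ = (y * c * y⁻¹) * (y * b * y⁻¹) := by group
      _ = a * c := by rw [hca]
  have xa : x * a * x⁻¹ = a⁻¹ := by
    calc x * a * x⁻¹ = (x * x) * (y * x * y⁻¹) * x⁻¹ := by rw [ha]; group
      _ = y * x⁻¹ * y⁻¹ * x⁻¹ := by rw [hx2, one_mul, hxi]
      _ = a⁻¹ := by rw [ha]; group
  have xc : x * c * x⁻¹ = c⁻¹ := by
    have h1 : c = y⁻¹ * x * y * x := by
      calc c = y⁻¹ * (y * c * y⁻¹) * y := by group
        _ = y⁻¹ * x * y * x := by rw [hca, ha]; group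
    calc x * c * x⁻¹ = x * y⁻¹ * x * y * (x * x⁻¹) := by rw [h1]; group
      _ = c⁻¹ := by rw [h1]; simp only [mul_inv_rev, hxi, hx2, mul_one, mul_assoc, inv_inv]
  have xb : x * b * x⁻¹ = b⁻¹ := by
    have e4 : y⁻¹ * y⁻¹ = y := by rw [inv_mul_eq_iff_eq_mul, hyi]
    have h1 : b = y * x * y * x * y := by
      have : b = y * x * y * x * (y⁻¹ * y⁻¹) := by rw [hb, ha]; group
      rw [this, e4]
    have h2 : x * y * x * y * x * y = y⁻¹ * x * y⁻¹ * x * y⁻¹ * x := by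
      have : y⁻¹ * (y * x * y * x * y * x) * y = y⁻¹ * (x * y⁻¹ * x * y⁻¹ * x * y⁻¹) * y := by rw [hyx]
      calc _ = y⁻¹ * (y * x * y * x * y * x) * y := by group
        _ = _ := by rw [this]; group
    calc x * b * x⁻¹ = (x * y * x * y * x * y) * x⁻¹ := by rw [h1]; group
      _ = y⁻¹ * x * y⁻¹ * x * y⁻¹ := by rw [h2]; group
      _ = b⁻¹ := by rw [h1]; simp only [mul_inv_rev, hxi, mul_assoc]
  have hmem : ∀ s ∈ ({a, b, c} : Set H), s⁻¹ ∈ Subgroup.closure ({a, b, c} : Set H) :=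
    fun s hs => Subgroup.inv_mem _ (Subgroup.subset_closure hs)
  have h := hH.eq_one_of_mem hxy (S := {a, b, c})
    (by rintro s (rfl | rfl | rfl) t (rfl | rfl | rfl) <;>
          first | rfl | exact hab | exact hab.symm | exact hbc | exact hbc.symm | exact hca' | exact hca'.symm)
    (by rintro s (rfl | rfl | rfl)
        · rw [xa]; exact hmem _ (by simp)
        · rw [xb]; exact hmem _ (by simp)
        · rw [xc]; exact hmem _ (by simp))
    (by rintro s (rfl | rfl | rfl) <;> apply Subgroup.subset_closure
        · simp [hb]
        · simp [hc]
        · simp [hca])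
    a (by simp)
  apply hH.not_commute hxy
  rw [ha] at h
  calc x * y = (x * y * x * y⁻¹) * (y * x⁻¹) := by group
    _ = y * x := by rw [h, one_mul, hxi]

/-- In the Euclidean triangle group `(2, 4, 4)`, the elements `x * y ^ 2` and `y * x * y` are
translations. -/
theorem NoAbelianNormal.not_two_four_four [Nontrivial H] (hH : NoAbelianNormal H)
    (hxy : Subgroup.closure {x, y} = ⊤) (hx : x ^ 2 = 1) (hy : y ^ 4 = 1) (hz : (x * y) ^ 4 = 1) :
    False := by
  have hx2 : x * x = 1 := by rw [← pow_two, hx]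
  have hy4 : y * y = y⁻¹ * y⁻¹ := by
    have : y * y = y ^ 4 * (y⁻¹ * y⁻¹) := by
      simp only [pow_succ, pow_zero, one_mul, mul_assoc, mul_inv_cancel_left, mul_inv_cancel,
        mul_one]
    rwa [hy, one_mul] at this
  have hxi : x⁻¹ = x := inv_eq_of_mul_eq_one_left hx2
  have hyxy : y * x * y = x * y⁻¹ * x * y⁻¹ * x := by
    have : y * x * y = x⁻¹ * (x * y) ^ 4 * (y⁻¹ * x⁻¹ * y⁻¹ * x⁻¹) := by
      simp only [pow_succ, pow_zero, one_mul]; group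
    rw [this, hz, mul_one, hxi]
    simp only [mul_assoc]
  have hc : x * y * y * (y * x * y) = y * x * y * (x * y * y) := by
    calc x * y * y * (y * x * y) = x * y * (y * y) * x * y := by group
      _ = x * y * (y⁻¹ * y⁻¹) * x * y := by rw [hy4]
      _ = x * y⁻¹ * x * y⁻¹ * 1 * (y * y) := by group
      _ = x * y⁻¹ * x * y⁻¹ * (x * x) * (y * y) := by rw [hx2]
      _ = x * y⁻¹ * x * y⁻¹ * x * (x * y * y) := by group
      _ = y * x * y * (x * y * y) := by rw [hyxy]
  have hinv : (x * y * y)⁻¹ = y * y * x := by rw [hy4, mul_assoc x, mul_inv_rev, mul_inv_rev, hxi]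
  have hmem : ∀ s ∈ ({x * y * y, y * x * y} : Set H),
      s⁻¹ ∈ Subgroup.closure ({x * y * y, y * x * y} : Set H) :=
    fun s hs => Subgroup.inv_mem _ (Subgroup.subset_closure hs)
  have h := hH.eq_one_of_mem hxy (S := {x * y * y, y * x * y})
    (by rintro s (rfl | rfl) t (rfl | rfl) <;> first | rfl | exact hc | exact hc.symm)
    (by rintro s (rfl | rfl)
        · convert hmem (x * y * y) (by simp) using 1
          rw [hinv, mul_assoc x y, ← mul_assoc x x, hx2, one_mul, hxi]
        · convert hmem (y * x * y) (by simp) using 1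
          rw [mul_inv_rev, mul_inv_rev, hyxy, hxi]
          calc _ = (x * x) * (y⁻¹ * x * y⁻¹) * (x * x) := by group
            _ = _ := by rw [hx2, mul_one, one_mul, mul_assoc])
    (by rintro s (rfl | rfl)
        · apply Subgroup.subset_closure
          right
          rw [Set.mem_singleton_iff]; group
        · convert hmem (x * y * y) (by simp) using 1
          rw [hinv]; group)
    (x * y * y) (by simp)
  apply hH.not_commute hxy
  have : x = y⁻¹ * y⁻¹ := by
    rw [mul_assoc] at h
    rw [eq_inv_of_mul_eq_one_left h, mul_inv_rev]
  rw [this]; group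

/-- In the Euclidean triangle group `(3, 3, 3)`, the element `x * y⁻¹` and its conjugates are
translations. -/
theorem NoAbelianNormal.not_three_three_three [Nontrivial H] (hH : NoAbelianNormal H)
    (hxy : Subgroup.closure {x, y} = ⊤) (hx : x ^ 3 = 1) (hy : y ^ 3 = 1) (hz : (x * y) ^ 3 = 1) :
    False := by
  have hx3 : x * x * x = 1 := by rw [← hx]; simp only [pow_succ, pow_zero, one_mul, mul_assoc]
  have hy3 : y * y * y = 1 := by rw [← hy]; simp only [pow_succ, pow_zero, one_mul, mul_assoc]
  have hz3 : x * y * x * y * x * y = 1 := by rw [← hz]; simp only [pow_succ, pow_zero, one_mul, mul_assoc]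
  have hxi : x⁻¹ = x * x := inv_eq_of_mul_eq_one_left hx3
  have hyi : y⁻¹ = y * y := inv_eq_of_mul_eq_one_left hy3
  have h := hH.eq_one_of_mem hxy (S := {x * y * y, y * y * x, y * x * y})
    (by rintro s (rfl | rfl | rfl) t (rfl | rfl | rfl) <;> grind)
    (by rintro s (rfl | rfl | rfl) <;> rw [hxi] <;> apply Subgroup.subset_closure <;>
          simp only [Set.mem_insert_iff, Set.mem_singleton_iff]
        · right; right; grind
        · left; grind
        · right; left; grind)
    (by rintro s (rfl | rfl | rfl) <;> rw [hyi] <;> apply Subgroup.subset_closure <;>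
          simp only [Set.mem_insert_iff, Set.mem_singleton_iff]
        · right; right; grind
        · left; grind
        · right; left; grind)
    (x * y * y) (by simp)
  apply hH.not_commute hxy
  clear hxy
  grind

/-- The right cosets of `⟨z⟩` in the `(2, 3, 5)` triangle group with generators `x` and `z` of orders `2`
and `5`: representatives for the twelve vertices of the icosahedron. -/
def icosahedralWord (x z : H) : Fin 12 → H :=
  ![1, x, x * z, x * z * z, x * z * z * z, x * z * z * z * z,
    x * z * z * x, x * z * z * x * z, x * z * z * x * z * z, x * z * z * x * z * z * z,
    x * z * z * x * z * z * z * z, x * z * z * x * z * z * z * x]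

omit [Finite H] in
/-- A quotient of the icosahedral group: right multiplication by `x` and by `z` permutes the twelve cosets
of `⟨z⟩` represented by the words `icosahedralWord x z`. -/
theorem card_le_sixty_of_two_three_five {z : H} (hxz : Subgroup.closure {x, z} = ⊤)
    (hx : x ^ 2 = 1) (hz : z ^ 5 = 1) (hy : (x * z) ^ 3 = 1) : Nat.card H ≤ 60 := by
  have hx2 : x * x = 1 := by rw [← pow_two, hx]
  have hz5 : z * z * z * z * z = 1 := by rw [← hz]; simp only [pow_succ, pow_zero, one_mul, mul_assoc]
  have hxz3 : x * z * x * z * x * z = 1 := by rw [← hy]; simp only [pow_succ, pow_zero, one_mul, mul_assoc]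
  have z4 : z ^ 4 = z * z * z * z := by simp only [pow_succ, pow_zero, one_mul]
  have z1 : z ^ 1 = z := pow_one z
  have z0 : z ^ 0 = 1 := pow_zero z
  have hX : ∀ i, ∃ (a : ℕ) (j : Fin 12), icosahedralWord x z i * x = z ^ a * icosahedralWord x z j := by
    intro i
    fin_cases i
    · exact ⟨0, 1, by simp [icosahedralWord]⟩
    · exact ⟨0, 0, by simp [icosahedralWord, hx2]⟩
    · exact ⟨4, 5, by rw [z4]; change x * z * x = z * z * z * z * (x * z * z * z * z); grind⟩
    · exact ⟨0, 6, by simp [icosahedralWord]⟩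
    · exact ⟨1, 7, by rw [z1]; change x * z * z * z * x = z * (x * z * z * x * z); grind⟩
    · exact ⟨1, 2, by rw [z1]; change x * z * z * z * z * x = z * (x * z); grind⟩
    · exact ⟨0, 3, by rw [z0]; change x * z * z * x * x = 1 * (x * z * z); grind⟩
    · exact ⟨4, 4, by rw [z4]; change x * z * z * x * z * x = z * z * z * z * (x * z * z * z); grind⟩
    · exact ⟨4, 10, by
        rw [z4]
        change x * z * z * x * z * z * x = z * z * z * z * (x * z * z * x * z * z * z * z)
        grind⟩
    · exact ⟨0, 11, by simp [icosahedralWord]⟩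
    · exact ⟨1, 8, by
        rw [z1]; change x * z * z * x * z * z * z * z * x = z * (x * z * z * x * z * z); grind⟩
    · exact ⟨0, 9, by
        rw [z0]; change x * z * z * x * z * z * z * x * x = 1 * (x * z * z * x * z * z * z); grind⟩
  have hZ : ∀ i, ∃ (a : ℕ) (j : Fin 12), icosahedralWord x z i * z = z ^ a * icosahedralWord x z j := by
    intro i
    fin_cases i
    · exact ⟨1, 0, by simp [icosahedralWord]⟩
    · exact ⟨0, 2, by simp [icosahedralWord]⟩
    · exact ⟨0, 3, by simp [icosahedralWord]⟩
    · exact ⟨0, 4, by simp [icosahedralWord]⟩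
    · exact ⟨0, 5, by simp [icosahedralWord]⟩
    · exact ⟨0, 1, by rw [z0]; change x * z * z * z * z * z = 1 * x; grind⟩
    · exact ⟨0, 7, by simp [icosahedralWord]⟩
    · exact ⟨0, 8, by simp [icosahedralWord]⟩
    · exact ⟨0, 9, by simp [icosahedralWord]⟩
    · exact ⟨0, 10, by simp [icosahedralWord]⟩
    · exact ⟨0, 6, by rw [z0]; change x * z * z * x * z * z * z * z * z = 1 * (x * z * z * x); grind⟩
    · exact ⟨4, 11, by
        rw [z4]
        change x * z * z * x * z * z * z * x * z = z * z * z * z * (x * z * z * x * z * z * z * x)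
        grind⟩
  let Q : H → Prop := fun h => ∃ (a : ℕ) (j : Fin 12), h = z ^ a * icosahedralWord x z j
  have QX : ∀ h, Q h → Q (h * x) := by
    rintro _ ⟨a, j, rfl⟩
    obtain ⟨b, k, h⟩ := hX j
    exact ⟨a + b, k, by rw [mul_assoc, h, pow_add, mul_assoc]⟩
  have QZ : ∀ h, Q h → Q (h * z) := by
    rintro _ ⟨a, j, rfl⟩
    obtain ⟨b, k, h⟩ := hZ j
    exact ⟨a + b, k, by rw [mul_assoc, h, pow_add, mul_assoc]⟩
  have hall : ∀ h, Q h := by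
    intro h
    have hh : h ∈ Subgroup.closure {x, z} := by rw [hxz]; trivial
    induction hh using Subgroup.closure_induction_right with
    | one => exact ⟨0, 0, by simp [icosahedralWord]⟩
    | mul_right g hg s hs ih =>
      rcases hs with rfl | rfl
      exacts [QX _ ih, QZ _ ih]
    | mul_inv_cancel g hg s hs ih =>
      rcases hs with rfl | rfl
      · rw [inv_eq_of_mul_eq_one_left hx2]
        exact QX _ ih
      · rw [inv_eq_of_mul_eq_one_left hz5]
        have := QZ _ (QZ _ (QZ _ (QZ _ ih)))
        simpa only [mul_assoc] using this
  have hsurj : Function.Surjective (fun p : Fin 5 × Fin 12 => z ^ (p.1 : ℕ) * icosahedralWord x z p.2) := by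
    intro h
    obtain ⟨a, j, rfl⟩ := hall h
    refine ⟨(⟨a % 5, Nat.mod_lt _ (by norm_num)⟩, j), ?_⟩
    have h : z ^ a = z ^ (a % 5) := by
      conv_lhs => rw [← Nat.div_add_mod a 5, pow_add, pow_mul, hz, one_pow, one_mul]
    simp only [h]
  have := Nat.card_le_card_of_surjective _ hsurj
  simpa using this

omit [Finite H] in
theorem orderOf_inv_mul_mul (x y : H) : orderOf (y⁻¹ * x * y) = orderOf x := by
  have : y⁻¹ * x * y = MulAut.conj y⁻¹ x := by simp
  rw [this, MulEquiv.orderOf_eq]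

omit [Finite H] in
/-- To prove a property of generating triples that is invariant under rotation and braiding, one
may assume that the triple is sorted by a class function. -/
theorem IsTriple.sorted_induction {P : H → H → H → Prop} (f : H → ℕ)
    (hf : ∀ x y, f (y⁻¹ * x * y) = f x) (hrot : ∀ x y z, P y z x → P x y z)
    (hswap : ∀ x y z, P y (y⁻¹ * x * y) z → P x y z)
    (hs : ∀ x y z, IsTriple x y z → f x ≤ f y → f y ≤ f z → P x y z) {x y z : H}
    (h : IsTriple x y z) : P x y z := by
  have key : ∀ x y z, IsTriple x y z → f x ≤ f z → f y ≤ f z → P x y z := by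
    intro x y z h hxz hyz
    rcases le_total (f x) (f y) with hle | hle
    · exact hs x y z h hle hyz
    · exact hswap x y z (hs _ _ _ h.swap (by rwa [hf]) (by rwa [hf]))
  by_cases h1 : f x ≤ f z ∧ f y ≤ f z
  · exact key x y z h h1.1 h1.2
  · by_cases h2 : f y ≤ f x ∧ f z ≤ f x
    · exact hrot x y z (key _ _ _ h.rotate h2.1 h2.2)
    · exact hrot x y z (hrot y z x (key _ _ _ h.rotate.rotate (by omega) (by omega)))

/-- The orders of a generating triple of a large group without abelian normal subgroups are those
of a hyperbolic triangle: they satisfy `1 / a + 1 / b + 1 / c < 1`, here with denominators cleared. -/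
theorem IsTriple.hyperbolic [Nontrivial H] {z : H} (h : IsTriple x y z) (hH : NoAbelianNormal H)
    (hc : 60 < Nat.card H) :
    orderOf y * orderOf z + orderOf x * orderOf z + orderOf x * orderOf y <
      orderOf x * orderOf y * orderOf z := by
  refine h.sorted_induction (P := fun x y z => orderOf y * orderOf z + orderOf x * orderOf z +
    orderOf x * orderOf y < orderOf x * orderOf y * orderOf z) orderOf orderOf_inv_mul_mul
    (fun x y z h => by linarith) (fun x y z h => by rw [orderOf_inv_mul_mul] at h; linarith) ?_
  intro x y z h hab hbc
  have hxy := h.closure_pair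
  have hz : z⁻¹ = x * y := inv_eq_of_mul_eq_one_left h.prod
  have px : x ^ orderOf x = 1 := pow_orderOf_eq_one x
  have py : y ^ orderOf y = 1 := pow_orderOf_eq_one y
  have pz : z ^ orderOf z = 1 := pow_orderOf_eq_one z
  have pxy : (x * y) ^ orderOf z = 1 := by rw [← hz, inv_pow, pz, inv_one]
  have ha1 : orderOf x ≠ 1 := by
    intro h1
    have : x = 1 := orderOf_eq_one_iff.mp h1
    exact hH.not_commute hxy (by rw [this, one_mul, mul_one])
  have ha0 := orderOf_pos x
  have hb0 := orderOf_pos y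
  have hc0 := orderOf_pos z
  generalize ha : orderOf x = a at *
  generalize hb : orderOf y = b at *
  generalize hcc : orderOf z = c at *
  by_cases a2 : a = 2
  · subst a2
    by_cases b2 : b = 2
    · subst b2; exact (hH.not_two_two hxy px py).elim
    by_cases b3 : b = 3
    · subst b3
      have c6 : 7 ≤ c := by
        by_contra! hlt
        interval_cases c
        · exact hH.not_two_three_three hxy px py pxy
        · exact hH.not_two_three_four hxy px py pxy
        · refine absurd (card_le_sixty_of_two_three_five (x := x) (z := z) ?_ px pz ?_) (by omega)
          · rw [Set.pair_comm]; exact h.rotate.rotate.closure_pair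
          · have hy' : (x * z) = x * y⁻¹ * x⁻¹ := by
              have : y⁻¹ = z * x := inv_eq_of_mul_eq_one_right (by rw [← mul_assoc]; exact h.rotate.prod)
              rw [this]; group
            rw [hy', conj_pow, inv_pow, py]; group
        · exact hH.not_two_three_six hxy px py pxy
      omega
    by_cases b4 : b = 4
    · subst b4
      have : c ≠ 4 := by
        rintro rfl
        exact hH.not_two_four_four hxy px py pxy
      omega
    have : 5 ≤ b := by omega
    nlinarith
  · by_cases a3 : a = 3
    · subst a3
      by_cases b3 : b = 3
      · subst b3
        have : c ≠ 3 := by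
          rintro rfl
          exact hH.not_three_three_three hxy px py pxy
        omega
      have : 4 ≤ b := by omega
      nlinarith
    · have h1 : 4 * (b * c) ≤ a * b * c := by
        rw [mul_assoc]; exact Nat.mul_le_mul_right _ (by omega)
      have h2 : a * c ≤ b * c := Nat.mul_le_mul_right _ hab
      have h3 : a * b ≤ b * c := by rw [mul_comm]; exact Nat.mul_le_mul_left _ (by omega)
      have h4 : 0 < b * c := Nat.mul_pos hb0 hc0
      omega

end Triangle

/-! ### Generating triples acting on a system of factors -/

section Components

variable {H ι : Type*} [Group H] [MulAction H ι] {A : Subgroup H} {T : ι → Subgroup H}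

namespace IsFactorSystem

/-- An element fixing the factor `T i` normalizes its centralizer. -/
theorem conj_mem_centralizer_of_fixes (hT : IsFactorSystem A T) {g h : H} {i : ι} (hg : g • i = i)
    (hh : h ∈ Subgroup.centralizer (T i : Set H)) :
    g * h * g⁻¹ ∈ Subgroup.centralizer (T i : Set H) := by
  have := hT.conj_mem_centralizer g hh
  rwa [hg] at this

/-- Elements which fix all factors commute if no factor is acted on nontrivially by both. -/
theorem commute_of_disjoint (hT : IsFactorSystem A T) {g h : H} (hg : ∀ i : ι, g • i = i)
    (hh : ∀ i : ι, h • i = i) (hgh : ∀ i, g ∈ Subgroup.centralizer (T i : Set H) ∨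
      h ∈ Subgroup.centralizer (T i : Set H)) : g * h = h * g := by
  have h1 : g * h * g⁻¹ * h⁻¹ = 1 := by
    apply hT.faithful
    intro i
    rcases hgh i with h2 | h2
    · have := hT.conj_mem_centralizer_of_fixes (hh i) (Subgroup.inv_mem _ h2)
      have := Subgroup.mul_mem _ h2 this
      simpa only [mul_assoc] using this
    · exact Subgroup.mul_mem _ (hT.conj_mem_centralizer_of_fixes (hg i) h2) (Subgroup.inv_mem _ h2)
  rw [mul_inv_eq_one, mul_inv_eq_iff_eq_mul] at h1
  exact h1

end IsFactorSystem

/-- The conjugates of an element fixing all indices fix all indices. -/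
theorem conj_smul_eq {g h : H} (hg : ∀ i : ι, g • i = i) (i : ι) : (h * g * h⁻¹) • i = i := by
  rw [mul_smul, mul_smul, hg, smul_inv_smul]

/-- An index fixed by a generating pair is fixed by the whole group. -/
theorem smul_eq_of_closure_eq_top {x y : H} (hxy : Subgroup.closure {x, y} = ⊤) {i : ι}
    (hx : x • i = i) (hy : y • i = i) (h : H) : h • i = i := by
  have : Subgroup.closure {x, y} ≤ MulAction.stabilizer H i := by
    rw [Subgroup.closure_le]
    rintro _ (rfl | rfl)
    exacts [hx, hy]
  rw [hxy] at this
  exact this trivial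

variable [Finite H]

omit [Finite H] in
/-- Orbit ratios are class functions. -/
theorem avgFix_inv_mul_mul [A.Normal] (x y : H) : avgFix A (y⁻¹ * x * y) = avgFix A x := by
  have hf : ∀ g, fixRatio A (y⁻¹ * g * y) = fixRatio A g := by
    intro g
    unfold fixRatio
    congr 2
    refine Nat.card_congr ((MulAut.conj y).toEquiv.subtypeEquiv fun a => ?_)
    simp only [Subgroup.mem_inf, Subgroup.mem_centralizer_singleton_iff, MulEquiv.toEquiv_eq_coe,
      EquivLike.coe_coe, MulAut.conj_apply]
    refine and_congr ?_ ?_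
    · constructor
      · exact fun h => Subgroup.Normal.conj_mem ‹_› a h y
      · intro h
        have := Subgroup.Normal.conj_mem ‹A.Normal› _ h y⁻¹
        simpa [mul_assoc] using this
    · constructor <;> intro h
      · have : y * (a * (y⁻¹ * g * y)) * y⁻¹ = y * (y⁻¹ * g * y * a) * y⁻¹ := by rw [h]
        simpa [mul_assoc] using this
      · have : y⁻¹ * (y * a * y⁻¹ * g) * y = y⁻¹ * (g * (y * a * y⁻¹)) * y := by rw [h]
        simpa [mul_assoc] using this
  unfold avgFix
  rw [orderOf_inv_mul_mul]
  congr 1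
  refine Finset.sum_congr rfl fun j _ => ?_
  rw [← hf (x ^ j)]
  congr 1
  have := conj_pow (i := j) (a := y⁻¹) (b := x)
  simpa using this

namespace IsFactorSystem

variable [MulAction.IsPretransitive H ι] {x y z : H}

omit [Finite H] [MulAction.IsPretransitive H ι] in
theorem noAbelianNormal (hT : IsFactorSystem A T) : NoAbelianNormal H := hT.abelian

/-- A triangle triple `(2, 3, 8)` cannot have `z ^ 2` acting trivially on all the factors which are
moved by `z`: the conjugates of `z ^ 2` by powers of `y` would generate an abelian normal
subgroup. -/
theorem false_of_two_three_eight (hT : IsFactorSystem A T) (h : IsTriple x y z)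
    (hx : x ^ 2 = 1) (hy : y ^ 3 = 1) (hz : z ^ 2 ≠ 1)
    (hz2 : ∀ i : ι, (z ^ 2) • i = i)
    (hzc : ∀ i : ι, z • i ≠ i → z ^ 2 ∈ Subgroup.centralizer (T i : Set H))
    (hmoved : ∃ i : ι, z • i ≠ i) : False := by
  have hgen := h.rotate.closure_pair
  have hzyz : z * y * z = y⁻¹ := by
    have h1 : x⁻¹ = y * z := inv_eq_of_mul_eq_one_right (by rw [← mul_assoc]; exact h.prod)
    have h2 : (y * z) * (y * z) = 1 := by rw [← h1, ← mul_inv_rev, ← pow_two, hx, inv_one]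
    rw [eq_inv_iff_mul_eq_one]
    calc z * y * z * y = y⁻¹ * ((y * z) * (y * z)) * y := by group
      _ = 1 := by rw [h2]; group
  have hyi : y⁻¹ = y * y := inv_eq_of_mul_eq_one_left (by rw [← hy]; simp only [pow_succ, pow_zero, one_mul])
  set w := z ^ 2 with hw
  set b := y * w * y⁻¹ with hb
  set c := y * b * y⁻¹ with hc
  have hyc : y * c * y⁻¹ = w := by
    have : y * c * y⁻¹ = y ^ 3 * w * (y ^ 3)⁻¹ := by
      rw [hc, hb]; simp only [pow_succ, pow_zero, one_mul]; group
    rw [this, hy, one_mul, inv_one, mul_one]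
  -- if `z` fixed both `k` and `y⁻¹ • k`, then `z * y * z = y⁻¹` would make `k` a fixed point of
  -- the whole group
  have hwb : w * b = b * w := by
    apply hT.commute_of_disjoint hz2 (conj_smul_eq hz2)
    intro k
    by_cases h1 : z • k = k
    · by_cases h2 : z • (y⁻¹ • k) = y⁻¹ • k
      · exfalso
        have h3 : (z * y * z) • k = y⁻¹ • k := by rw [hzyz]
        rw [mul_smul, mul_smul, h1, ← h2, smul_left_cancel_iff, hyi, mul_smul, smul_left_cancel_iff]
          at h3
        obtain ⟨i, hi⟩ := hmoved
        obtain ⟨g, rfl⟩ := MulAction.exists_smul_eq H k i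
        rw [smul_eq_of_closure_eq_top hgen h3.symm h1 g] at hi
        exact hi h1
      · right
        have := hT.conj_mem_centralizer y (hzc _ h2)
        rwa [smul_inv_smul] at this
    · exact Or.inl (hzc _ h1)
  have conj2 : ∀ p q : H, p * q = q * p → (y * p * y⁻¹) * (y * q * y⁻¹) = (y * q * y⁻¹) * (y * p * y⁻¹) := by
    intro p q hpq
    calc _ = y * (p * q) * y⁻¹ := by group
      _ = y * (q * p) * y⁻¹ := by rw [hpq]
      _ = _ := by group
  have hbc : b * c = c * b := conj2 _ _ hwb
  have hcw : c * w = w * c := by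
    have := conj2 _ _ hbc
    rwa [hyc, ← hc] at this
  have zw : z * w * z⁻¹ = w := by rw [hw]; group
  have zb : z * b * z⁻¹ = c := by
    have h1 : z * y = y⁻¹ * z⁻¹ := by rw [← hzyz]; group
    calc z * b * z⁻¹ = (z * y) * w * (z * y)⁻¹ := by rw [hb]; group
      _ = y⁻¹ * (z⁻¹ * w * z) * y := by rw [h1]; group
      _ = y⁻¹ * (y * c * y⁻¹) * y := by rw [hyc, hw]; group
      _ = c := by group
  have zc : z * c * z⁻¹ = b := by
    have h1 : z * y⁻¹ = w * y * z := by rw [← hzyz, hw, pow_two]; group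
    calc z * c * z⁻¹ = (z * y⁻¹) * (y * c * y⁻¹) * (z * y⁻¹)⁻¹ := by group
      _ = w * y * (z * w * z⁻¹) * y⁻¹ * w⁻¹ := by rw [hyc, h1]; group
      _ = w * b * w⁻¹ := by rw [zw, hb]; group
      _ = b := by rw [hwb]; group
  have := hT.noAbelianNormal.eq_one_of_mem hgen (S := {w, b, c})
    (by rintro s (rfl | rfl | rfl) t (rfl | rfl | rfl) <;>
          first | rfl | exact hwb | exact hwb.symm | exact hbc | exact hbc.symm | exact hcw | exact hcw.symm)
    (by rintro s (rfl | rfl | rfl) <;> apply Subgroup.subset_closure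
        · simp [hb]
        · simp [hc]
        · simp [hyc])
    (by rintro s (rfl | rfl | rfl) <;> apply Subgroup.subset_closure
        · simp [zw]
        · simp [zb]
        · simp [zc])
    w (by simp)
  exact hz this

omit [MulAction.IsPretransitive H ι] in
/-- If `z` fixes all factors and acts nontrivially on one factor only, and a power of `x` is trivial
as soon as it fixes a factor, then the conjugates of `z` by the powers of `x` generate an abelian
normal subgroup. -/
theorem eq_one_of_single (hT : IsFactorSystem A T) (h : IsTriple x y z) (hz : ∀ i : ι, z • i = i)
    (i : ι) (hx : x ^ MulAction.period x i = 1)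
    (hzc : ∀ k, k ≠ i → z ∈ Subgroup.centralizer (T k : Set H)) : z = 1 := by
  have hgen : Subgroup.closure {x, z} = ⊤ := by
    rw [Set.pair_comm]; exact h.rotate.rotate.closure_pair
  set S : Set H := Set.range fun n : ℤ => x ^ n * z * (x ^ n)⁻¹ with hS
  have hzS : z ∈ S := ⟨0, by simp⟩
  have hcomm : ∀ s ∈ S, ∀ t ∈ S, s * t = t * s := by
    rintro _ ⟨m, rfl⟩ _ ⟨n, rfl⟩
    by_cases hmn : x ^ m • i = x ^ n • i
    · have h1 : x ^ m = x ^ n := by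
        have : x ^ (m - n) • i = i := by
          rw [sub_eq_neg_add, zpow_add, mul_smul, hmn, smul_smul, ← zpow_add]; simp
        rw [MulAction.zpow_smul_eq_iff_period_dvd] at this
        obtain ⟨d, hd⟩ := this
        have h2 : x ^ (m - n) = 1 := by rw [hd, zpow_mul, zpow_natCast, hx, one_zpow]
        rwa [zpow_sub, mul_inv_eq_one] at h2
      simp only [h1]
    · apply hT.commute_of_disjoint (conj_smul_eq hz) (conj_smul_eq hz)
      have key : ∀ (n : ℤ) k, k ≠ x ^ n • i →
          x ^ n * z * (x ^ n)⁻¹ ∈ Subgroup.centralizer (T k : Set H) := by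
        intro n k hk
        have := hT.conj_mem_centralizer (x ^ n) (hzc ((x ^ n)⁻¹ • k) (by rwa [Ne, inv_smul_eq_iff]))
        rwa [smul_inv_smul] at this
      intro k
      by_cases hk : k = x ^ m • i
      · exact Or.inr (key n k (by rwa [hk]))
      · exact Or.inl (key m k hk)
  refine hT.noAbelianNormal.eq_one_of_mem hgen hcomm ?_ ?_ z hzS
  · rintro _ ⟨n, rfl⟩
    apply Subgroup.subset_closure
    refine ⟨n + 1, ?_⟩
    simp only [add_comm n, zpow_add, zpow_one]
    group
  · intro s hs
    rw [hcomm z hzS s hs, mul_inv_cancel_right]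
    exact Subgroup.subset_closure hs

omit [Finite H] [MulAction.IsPretransitive H ι] in
/-- With two factors, commutation of elements supported on different factors. -/
theorem commute_of_two (hT : IsFactorSystem A T) {i k : ι} (hι : ∀ j, j = i ∨ j = k) {g h : H}
    (hg : ∀ j : ι, g • j = j) (hh : ∀ j : ι, h • j = j)
    (hgi : g ∈ Subgroup.centralizer (T i : Set H)) (hhk : h ∈ Subgroup.centralizer (T k : Set H)) :
    g * h = h * g := by
  apply hT.commute_of_disjoint hg hh
  intro j
  rcases hι j with rfl | rfl
  exacts [Or.inl hgi, Or.inr hhk]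

omit [Finite H] [MulAction.IsPretransitive H ι] in
theorem eq_one_of_two (hT : IsFactorSystem A T) {i k : ι} (hι : ∀ j, j = i ∨ j = k) {g : H}
    (hgi : g ∈ Subgroup.centralizer (T i : Set H)) (hgk : g ∈ Subgroup.centralizer (T k : Set H)) :
    g = 1 := by
  apply hT.faithful
  intro j
  rcases hι j with rfl | rfl
  exacts [hgi, hgk]

omit [MulAction.IsPretransitive H ι] in
/-- Two factors exchanged by the involution `x`, with `z` acting with order `3` on one and with
order `2` on the other, are incompatible with `(x * z) ^ 4 = 1`. -/
theorem false_of_two_four_six (hT : IsFactorSystem A T) (h : IsTriple x y z) {i k : ι}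
    (hι : ∀ j, j = i ∨ j = k) (hz : ∀ j : ι, z • j = j) (hxi : x • i = k) (hxk : x • k = i)
    (hx : x ^ 2 = 1) (hxz : (x * z) ^ 4 = 1)
    (hi : factorPeriod T z i = 3) (hk : factorPeriod T z k = 2) : False := by
  have hgen : Subgroup.closure {x, z} = ⊤ := by
    rw [Set.pair_comm]; exact h.rotate.rotate.closure_pair
  have hx2 : x * x = 1 := by rw [← pow_two, hx]
  have hxinv : x⁻¹ = x := inv_eq_of_mul_eq_one_left hx2
  have hpow : ∀ (n : ℕ) (j : ι), (z ^ n) • j = j := by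
    intro n j
    induction n with
    | zero => simp
    | succ n ih => rw [pow_succ, mul_smul, hz, ih]
  have hz6 : z ^ 6 = 1 := hT.eq_one_of_two hι
    (pow_mem_centralizer_iff.mpr (by rw [hi]; norm_num))
    (pow_mem_centralizer_iff.mpr (by rw [hk]; norm_num))
  -- `u` acts on `T i` only and `v` on `T k` only
  obtain ⟨u, hu⟩ : ∃ u, u = z ^ 4 := ⟨_, rfl⟩
  obtain ⟨v, hv⟩ : ∃ v, v = z ^ 3 := ⟨_, rfl⟩
  have huv : u * v = z := by
    rw [hu, hv, ← pow_add, show 4 + 3 = 6 + 1 from rfl, pow_add, hz6, one_mul, pow_one]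
  have hvv : v * v = 1 := by rw [hv, ← pow_add]; exact hz6
  have hvinv : v⁻¹ = v := inv_eq_of_mul_eq_one_left hvv
  have huk : u ∈ Subgroup.centralizer (T k : Set H) := by
    rw [hu, pow_mem_centralizer_iff, hk]; norm_num
  have hvi : v ∈ Subgroup.centralizer (T i : Set H) := by
    rw [hv, pow_mem_centralizer_iff, hi]
  have pu : ∀ j : ι, u • j = j := by rw [hu]; exact hpow 4
  have pv : ∀ j : ι, v • j = j := by rw [hv]; exact hpow 3
  obtain ⟨u', hu'⟩ : ∃ u', u' = x * u * x⁻¹ := ⟨_, rfl⟩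
  obtain ⟨v', hv'⟩ : ∃ v', v' = x * v * x⁻¹ := ⟨_, rfl⟩
  have pu' : ∀ j : ι, u' • j = j := by rw [hu']; exact conj_smul_eq pu
  have pv' : ∀ j : ι, v' • j = j := by rw [hv']; exact conj_smul_eq pv
  have hui' : u' ∈ Subgroup.centralizer (T i : Set H) := by
    have := hT.conj_mem_centralizer x huk
    rwa [hxk, ← hu'] at this
  have hvk' : v' ∈ Subgroup.centralizer (T k : Set H) := by
    have := hT.conj_mem_centralizer x hvi
    rwa [hxi, ← hv'] at this
  have huu' : u' * u = u * u' := hT.commute_of_two hι pu' pu hui' huk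
  have huv' : u' * v' = v' * u' := hT.commute_of_two hι pu' pv' hui' hvk'
  have hvu : v * u = u * v := hT.commute_of_two hι pv pu hvi huk
  have hvv' : v * v' = v' * v := hT.commute_of_two hι pv pv' hvi hvk'
  have hsq : (x * z) ^ 2 = (v' * u) * (u' * v) := by
    calc (x * z) ^ 2 = (x * z * x⁻¹) * (x * x) * z := by rw [pow_two]; group
      _ = (u' * v') * (u * v) := by
        rw [hx2, mul_one, ← huv, hu', hv']; group
      _ = v' * (u' * u) * v := by rw [huv']; group
      _ = (v' * u) * (u' * v) := by rw [huu']; group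
  have hcm : (u' * v) * (v' * u) = (v' * u) * (u' * v) :=
    hT.commute_of_two hι (fun j => by rw [mul_smul, pv, pu']) (fun j => by rw [mul_smul, pu, pv'])
      (Subgroup.mul_mem _ hui' hvi) (Subgroup.mul_mem _ hvk' huk)
  -- `(x * z) ^ 4` splits into a part acting on `T i` only and a part acting on `T k` only
  have hone : (v' * u) * (v' * u) = 1 := by
    apply hT.eq_one_of_two hι _
      (Subgroup.mul_mem _ (Subgroup.mul_mem _ hvk' huk) (Subgroup.mul_mem _ hvk' huk))
    have h4 : (v' * u) * (v' * u) * ((u' * v) * (u' * v)) = 1 := by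
      rw [← hxz, show (x * z) ^ 4 = (x * z) ^ 2 * (x * z) ^ 2 by rw [← pow_add], hsq]
      calc (v' * u) * (v' * u) * ((u' * v) * (u' * v))
          = (v' * u) * ((v' * u) * (u' * v)) * (u' * v) := by simp only [mul_assoc]
        _ = (v' * u) * ((u' * v) * (v' * u)) * (u' * v) := by rw [hcm]
        _ = _ := by simp only [mul_assoc]
    rw [eq_inv_of_mul_eq_one_left h4]
    exact Subgroup.inv_mem _
      (Subgroup.mul_mem _ (Subgroup.mul_mem _ hui' hvi) (Subgroup.mul_mem _ hui' hvi))
  have hvuv : v * u' * v = u'⁻¹ := by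
    have h1 : x * ((v' * u) * (v' * u)) * x⁻¹ = (v * u') * (v * u') := by
      rw [hv', hu']
      calc _ = (x * x) * v * (x⁻¹ * u * (x * v * x⁻¹) * u * x⁻¹) := by group
        _ = v * (x * u * x⁻¹ * (v * (x * u * x⁻¹))) := by rw [hx2, one_mul]; simp only [hxinv, mul_assoc]
        _ = _ := by simp only [mul_assoc]
    rw [hone, mul_one, mul_inv_cancel] at h1
    rw [eq_inv_iff_mul_eq_one, mul_assoc]
    exact h1.symm
  have hxu : x * u' * x⁻¹ = u := by
    calc x * u' * x⁻¹ = (x * x) * u * (x * x)⁻¹ := by rw [hu']; group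
      _ = u := by rw [hx2]; group
  have hzu : z * u * z⁻¹ = u := by
    calc z * u * z⁻¹ = u * (v * u) * v⁻¹ * u⁻¹ := by rw [← huv]; group
      _ = u := by rw [hvu]; group
  have hzu' : z * u' * z⁻¹ = u'⁻¹ := by
    calc z * u' * z⁻¹ = u * (v * u' * v⁻¹) * u⁻¹ := by rw [← huv]; group
      _ = u * u'⁻¹ * u⁻¹ := by rw [hvinv, hvuv]
      _ = (u * u' * u⁻¹)⁻¹ := by group
      _ = u'⁻¹ := by rw [← huu']; group
  have := hT.noAbelianNormal.eq_one_of_mem hgen (S := {u, u'})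
    (by rintro s (rfl | rfl) t (rfl | rfl) <;> first | rfl | exact huu' | exact huu'.symm)
    (by rintro s (rfl | rfl) <;> apply Subgroup.subset_closure
        · simp [hu']
        · simp [hxu])
    (by rintro s (rfl | rfl)
        · rw [hzu]; exact Subgroup.subset_closure (by simp)
        · rw [hzu']; exact Subgroup.inv_mem _ (Subgroup.subset_closure (by simp)))
    u (by simp)
  rw [hu] at this
  have h4 : z ^ 4 ∈ Subgroup.centralizer (T i : Set H) := by rw [this]; exact Subgroup.one_mem _
  rw [pow_mem_centralizer_iff, hi] at h4
  norm_num at h4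

omit [MulAction.IsPretransitive H ι] in
/-- Two factors exchanged by `x`, with `x ^ 4 = 1`, and an involution `z` which acts on one of them
only, are incompatible with `(x * z) ^ 6 = 1`, unless `(x * z) ^ 2 = 1`. -/
theorem sq_eq_one_of_four_six_two (hT : IsFactorSystem A T) (h : IsTriple x y z) {i k : ι}
    (hι : ∀ j, j = i ∨ j = k) (hz : ∀ j : ι, z • j = j) (hxi : x • i = k) (hxk : x • k = i)
    (hx : x ^ 4 = 1) (hz2 : z ^ 2 = 1) (hxz : (x * z) ^ 6 = 1)
    (hzi : z ∈ Subgroup.centralizer (T i : Set H)) : (x * z) ^ 2 = 1 := by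
  have hgen : Subgroup.closure {x, z} = ⊤ := by
    rw [Set.pair_comm]; exact h.rotate.rotate.closure_pair
  have hzz : z * z = 1 := by rw [← pow_two, hz2]
  have hzinv : z⁻¹ = z := inv_eq_of_mul_eq_one_left hzz
  obtain ⟨c, hc⟩ : ∃ c, c = x * x := ⟨_, rfl⟩
  have hcc : c * c = 1 := by rw [hc, ← hx]; simp only [pow_succ, pow_zero, one_mul, mul_assoc]
  have hcinv : c⁻¹ = c := inv_eq_of_mul_eq_one_left hcc
  have pc : ∀ j : ι, c • j = j := by
    intro j
    rw [hc, mul_smul]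
    rcases hι j with rfl | rfl
    · rw [hxi, hxk]
    · rw [hxk, hxi]
  obtain ⟨z', hz'⟩ : ∃ z', z' = x * z * x⁻¹ := ⟨_, rfl⟩
  have hzk' : z' ∈ Subgroup.centralizer (T k : Set H) := by
    have := hT.conj_mem_centralizer x hzi
    rwa [hxi, ← hz'] at this
  obtain ⟨p, hp⟩ : ∃ p, p = c * z := ⟨_, rfl⟩
  have pp : ∀ j : ι, p • j = j := fun j => by rw [hp, mul_smul, hz, pc]
  have hpinv : p⁻¹ = z * c := by rw [hp, mul_inv_rev, hzinv, hcinv]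
  have hd : (x * z) ^ 2 = z' * p := by
    rw [hz', hp, hc, pow_two]; group
  have hp3 : p ^ 3 ∈ Subgroup.centralizer (T k : Set H) := by
    have h1 : (z' * p) ^ 3 = 1 := by rw [← hd, ← pow_mul, hxz]
    have h2 : p ^ 3 = (z' * (p * z' * p⁻¹) * (p * (p * z' * p⁻¹) * p⁻¹))⁻¹ * (z' * p) ^ 3 := by
      simp only [pow_succ, pow_zero, one_mul, mul_inv_rev, inv_inv, mul_assoc,
        inv_mul_cancel_left]
    rw [h2, h1, mul_one]
    have h3 := hT.conj_mem_centralizer_of_fixes (pp k) hzk'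
    exact Subgroup.inv_mem _ (Subgroup.mul_mem _ (Subgroup.mul_mem _ hzk' h3)
      (hT.conj_mem_centralizer_of_fixes (pp k) h3))
  have hp2 : p ^ 2 ∈ Subgroup.centralizer (T i : Set H) := by
    have : p ^ 2 = (c * z * c⁻¹) * (c * c) * z := by rw [hp, pow_two]; group
    rw [this, hcc, mul_one]
    exact Subgroup.mul_mem _ (hT.conj_mem_centralizer_of_fixes (pc i) hzi) hzi
  -- `e` acts on `T k` only, and it is inverted by both of the involutions `c` and `z`
  obtain ⟨e, he⟩ : ∃ e, e = p ^ 4 := ⟨_, rfl⟩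
  have hei : e ∈ Subgroup.centralizer (T i : Set H) := by
    rw [he, show p ^ 4 = p ^ 2 * p ^ 2 by rw [← pow_add]]
    exact Subgroup.mul_mem _ hp2 hp2
  have pe : ∀ j : ι, e • j = j := fun j => by
    rw [he]; simp only [pow_succ, pow_zero, one_mul, mul_smul, pp]
  obtain ⟨e', he'⟩ : ∃ e', e' = x * e * x⁻¹ := ⟨_, rfl⟩
  have pe' : ∀ j : ι, e' • j = j := by rw [he']; exact conj_smul_eq pe
  have hek' : e' ∈ Subgroup.centralizer (T k : Set H) := by
    have := hT.conj_mem_centralizer x hei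
    rwa [hxi, ← he'] at this
  have hee' : e * e' = e' * e := hT.commute_of_two hι pe pe' hei hek'
  have hze' : z * e' = e' * z := hT.commute_of_two hι hz pe' hzi hek'
  have hce : c * e * c⁻¹ = e⁻¹ := by
    have : c * p * c⁻¹ = p⁻¹ := by
      rw [hpinv, hp]
      calc _ = (c * c) * z * c⁻¹ := by group
        _ = _ := by rw [hcc, one_mul, hcinv]
    rw [he, ← conj_pow, this, inv_pow]
  have hze : z * e * z⁻¹ = e⁻¹ := by
    have : z * p * z⁻¹ = p⁻¹ := by
      rw [hpinv, hp]; group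
    rw [he, ← conj_pow, this, inv_pow]
  have hinv : e⁻¹ ∈ Subgroup.closure ({e, e'} : Set H) :=
    Subgroup.inv_mem _ (Subgroup.subset_closure (by simp))
  have he1 := hT.noAbelianNormal.eq_one_of_mem hgen (S := {e, e'})
    (by rintro s (rfl | rfl) t (rfl | rfl) <;> first | rfl | exact hee' | exact hee'.symm)
    (by rintro s (rfl | rfl)
        · apply Subgroup.subset_closure
          simp [he']
        · convert hinv using 1
          rw [← hce, he', hc]; group)
    (by rintro s (rfl | rfl)
        · rwa [hze]
        · apply Subgroup.subset_closure
          right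
          rw [Set.mem_singleton_iff, hze', mul_inv_cancel_right])
    e (by simp)
  have hpk : p ∈ Subgroup.centralizer (T k : Set H) := by
    have : p = p ^ 4 * (p ^ 3)⁻¹ := by simp only [pow_succ, pow_zero, one_mul]; group
    rw [this, ← he, he1, one_mul]
    exact Subgroup.inv_mem _ hp3
  have hdk : (x * z) ^ 2 ∈ Subgroup.centralizer (T k : Set H) := by
    rw [hd]; exact Subgroup.mul_mem _ hzk' hpk
  refine hT.eq_one_of_two hι ?_ hdk
  have := hT.conj_mem_centralizer (x * z) hdk
  rw [mul_smul, hz, hxk] at this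
  rwa [← pow_succ', pow_succ, mul_inv_cancel_right] at this

end IsFactorSystem
end Components

/-! ### The sum of the orbit ratios of a generating triple -/

section Sum

variable {H ι : Type*} [Group H] [Finite H] [MulAction H ι] {A : Subgroup H} {T : ι → Subgroup H}
  {x y z : H}

/-- The sorted orders of a hyperbolic triangle. -/
theorem sorted_hyperbolic {a b c : ℕ} (ha : 2 ≤ a) (hab : a ≤ b) (hbc : b ≤ c)
    (h : b * c + a * c + a * b < a * b * c) :
    (a = 2 ∧ b = 3 ∧ 7 ≤ c) ∨ (a = 2 ∧ b = 4 ∧ 5 ≤ c) ∨ (a = 2 ∧ 5 ≤ b ∧ 5 ≤ c) ∨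
      (a = 3 ∧ b = 3 ∧ 4 ≤ c) ∨ (a = 3 ∧ 4 ≤ b ∧ 4 ≤ c) ∨ (4 ≤ a ∧ 4 ≤ b ∧ 4 ≤ c) := by
  by_cases a2 : a = 2
  · subst a2
    rcases (by omega : b = 2 ∨ b = 3 ∨ b = 4 ∨ 5 ≤ b) with rfl | rfl | rfl | hb <;> omega
  · by_cases a3 : a = 3
    · subst a3
      rcases (by omega : b = 3 ∨ 4 ≤ b) with rfl | hb <;> omega
    · omega

namespace IsFactorSystem

/-- Bounds for an element which moves some factor. The second alternatives are the exceptional cases,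
in which `x` acts as an involution on the factors. -/
theorem avgFix_le_of_moved (hT : IsFactorSystem A T) (hx : ∃ i : ι, x • i ≠ i) :
    (orderOf x = 2 → avgFix A x ≤ 0.50834) ∧ (orderOf x = 3 → avgFix A x ≤ 0.33352) ∧
    (orderOf x = 4 → avgFix A x ≤ 0.2623 ∨ (∀ k : ι, MulAction.period x k < 3) ∧
      (∃ k : ι, x • k = k) ∧ avgFix A x ≤ 0.2824) ∧
    (orderOf x = 5 → avgFix A x ≤ 0.2003) ∧
    (orderOf x = 6 → avgFix A x ≤ 0.19 ∨ (∀ k : ι, MulAction.period x k < 3) ∧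
      avgFix A x ≤ 0.2119) ∧
    (7 ≤ orderOf x → avgFix A x ≤ 0.1529 ∨ ((∀ k : ι, MulAction.period x k < 3) ∧
      orderOf x = 8 ∧ (∀ j : ι, x • j ≠ j → factorPeriod T x j ∣ 2) ∧ avgFix A x ≤ 0.1748)) := by
  by_cases h3 : ∀ k : ι, MulAction.period x k < 3
  · obtain ⟨i, hi⟩ := hx
    have hi2 : MulAction.period x i = 2 := by
      by_contra hne
      exact hi (smul_eq_of_period_ne_two (h3 i) hne)
    have h2 : 2 ∣ orderOf x := hi2 ▸ period_dvd_orderOf' x i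
    refine ⟨fun _ => hT.avgFix_le_of_orderOf_eq_two hi2, fun h => by omega, fun h => ?_,
      fun h => by omega, fun h => Or.inr ⟨h3, hT.avgFix_le_of_orderOf_eq_six hi2 h3 h⟩, fun h => ?_⟩
    · rcases hT.avgFix_le_of_orderOf_eq_four hi2 h3 h with h | h
      exacts [Or.inl h, Or.inr ⟨h3, h⟩]
    · rcases hT.avgFix_le_of_seven_le_orderOf hi2 h3 h with h | h
      exacts [Or.inl h, Or.inr ⟨h3, h⟩]
  · push Not at h3
    obtain ⟨i, hi⟩ := h3
    refine ⟨fun h => ?_, fun _ => hT.avgFix_le_of_three_le_period hi, fun h => Or.inl ?_,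
      fun h => ?_, fun h => Or.inl (hT.avgFix_le_of_three_le_period_of_six_le hi h.ge),
      fun h => Or.inl (hT.avgFix_le_of_three_le_period_of_seven_le hi h)⟩
    · have := Nat.le_of_dvd (by norm_num) (h ▸ period_dvd_orderOf' x i)
      omega
    · have := hT.avgFix_le_of_three_le_period_of_eq hi (Or.inl h)
      rw [h] at this; norm_num at this ⊢; linarith
    · have := hT.avgFix_le_of_three_le_period_of_eq hi (Or.inr h)
      rw [h] at this; norm_num at this ⊢; linarith

/-- The bounds of `avgFix_le_of_moved` with the exceptional cases included. -/
theorem avgFix_le_of_moved_of_four_le (hT : IsFactorSystem A T) (hx : ∃ i : ι, x • i ≠ i)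
    (ho : 4 ≤ orderOf x) : avgFix A x ≤ 0.2824 ∧ (5 ≤ orderOf x → avgFix A x ≤ 0.2119) ∧
      (7 ≤ orderOf x → avgFix A x ≤ 0.1748) := by
  obtain ⟨-, -, h4, h5, h6, h7⟩ := hT.avgFix_le_of_moved hx
  rcases (by omega : orderOf x = 4 ∨ orderOf x = 5 ∨ orderOf x = 6 ∨ 7 ≤ orderOf x) with h | h | h | h
  · refine ⟨?_, by omega, by omega⟩
    rcases h4 h with h | h
    · linarith
    · exact h.2.2
  · have := h5 h
    refine ⟨by linarith, fun _ => by linarith, by omega⟩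
  · have : avgFix A x ≤ 0.2119 := by
      rcases h6 h with h | h
      · linarith
      · exact h.2
    refine ⟨by linarith, fun _ => by linarith, by omega⟩
  · have : avgFix A x ≤ 0.1748 := by
      rcases h7 h with h | h
      · linarith
      · exact h.2.2.2
    refine ⟨by linarith, fun _ => by linarith, fun _ => this⟩

theorem sq_smul_eq (hx : ∀ k : ι, MulAction.period x k < 3) (i : ι) : (x ^ 2) • i = i := by
  have := period_pos' x i
  have h3 := hx i
  rw [MulAction.pow_smul_eq_iff_period_dvd]
  rcases (by omega : MulAction.period x i = 1 ∨ MulAction.period x i = 2) with h | h <;> simp [h]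

variable [MulAction.IsPretransitive H ι]

omit [Finite H] in
/-- If `x`, `y` and `z` act as involutions on the factors and `y` fixes a factor, then `y` fixes
all of them. -/
theorem smul_eq_of_involutions (h : IsTriple x y z) (hx : ∀ i : ι, (x ^ 2) • i = i)
    (hy : ∀ i : ι, (y ^ 2) • i = i) (hz : ∀ i : ι, (z ^ 2) • i = i) {k : ι} (hk : y • k = k) (i : ι) :
    y • i = i := by
  have hz' : ∀ i : ι, (x * y * (x * y)) • i = i := by
    intro i
    have h1 : z⁻¹ = x * y := inv_eq_of_mul_eq_one_left h.prod
    rw [← h1, ← mul_inv_rev, ← pow_two, inv_smul_eq_iff, hz]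
  have hcomm : ∀ i : ι, y • x • i = x • y • i := by
    intro i
    have h1 := hz' i
    have h2 : x • y • x • y • i = x • x • y • y • i := by
      have h3 := hx (y • y • i)
      have h4 := hy i
      simp only [pow_two, mul_smul] at h1 h3 h4 ⊢
      rw [h1, h3, h4]
    rw [smul_left_cancel_iff] at h2
    -- replace `i` by `y⁻¹ • i`
    have h5 := hz' (y⁻¹ • i)
    have h6 : x • y • x • i = y⁻¹ • i := by simpa only [mul_smul, smul_inv_smul] using h5
    have h7 := hx (y • x • i)
    rw [pow_two, mul_smul, h6] at h7
    have h8 := hy (y⁻¹ • i)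
    rw [pow_two, mul_smul, smul_inv_smul] at h8
    rw [← h7, ← h8]
  have hall : ∀ h : H, ∀ i : ι, y • h • i = h • y • i := by
    intro g
    have hg : g ∈ Subgroup.closure {x, y} := by rw [h.closure_pair]; trivial
    induction hg using Subgroup.closure_induction with
    | mem s hs => 
      rcases hs with rfl | rfl
      · exact hcomm
      · exact fun _ => rfl
    | one => simp
    | mul a b _ _ ha hb => intro i; rw [mul_smul, ha, hb, mul_smul]
    | inv a _ ha =>
      intro i
      rw [eq_inv_smul_iff, ← ha, smul_inv_smul]
  obtain ⟨g, rfl⟩ := MulAction.exists_smul_eq H k i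
  rw [hall, hk]

/-- The case where each member of the triple moves some factor and the orders are sorted. -/
theorem sum_avgFix_lt_of_moved_of_le (hT : IsFactorSystem A T) [Nontrivial H]
    (hc : 60 < Nat.card H) (h : IsTriple x y z) (hab : orderOf x ≤ orderOf y)
    (hbc : orderOf y ≤ orderOf z) (hx : ∃ i : ι, x • i ≠ i) (hy : ∃ i : ι, y • i ≠ i)
    (hz : ∃ i : ι, z • i ≠ i) : avgFix A x + avgFix A y + avgFix A z < 229 / 230 := by
  have hx1 : orderOf x ≠ 1 := by
    intro h1
    rw [orderOf_eq_one_iff] at h1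
    obtain ⟨i, hi⟩ := hx
    exact hi (by rw [h1, one_smul])
  have px : x ^ orderOf x = 1 := pow_orderOf_eq_one x
  have py : y ^ orderOf y = 1 := pow_orderOf_eq_one y
  have hyp := sorted_hyperbolic (by have := orderOf_pos x; omega) hab hbc
    (h.hyperbolic hT.noAbelianNormal hc)
  obtain ⟨x2, x3, -, -, -, -⟩ := hT.avgFix_le_of_moved hx
  obtain ⟨-, y3, y4, -, -, -⟩ := hT.avgFix_le_of_moved hy
  obtain ⟨-, -, -, z5, z6, z7⟩ := hT.avgFix_le_of_moved hz
  have xx := hT.avgFix_le_of_moved_of_four_le hx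
  have yy := hT.avgFix_le_of_moved_of_four_le hy
  have zz := hT.avgFix_le_of_moved_of_four_le hz
  -- the numerical bounds suffice except for orders `(2, 3, 8)` and `(2, 4, 6)`
  rcases hyp with ⟨ha, hb, hc⟩ | ⟨ha, hb, hc⟩ | ⟨ha, hb, hc⟩ | ⟨ha, hb, hc⟩ | ⟨ha, hb, hc⟩ |
    ⟨ha, hb, hc⟩
  · have hX := x2 ha
    have hY := y3 hb
    rcases z7 hc with hZ | ⟨hp, h8, hm, -⟩
    · linarith only [hX, hY, hZ]
    · exfalso
      refine hT.false_of_two_three_eight h (ha ▸ px) (hb ▸ py) ?_ (sq_smul_eq hp)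
        (fun i hi => pow_mem_centralizer_iff.mpr (hm i hi)) hz
      intro h2
      have := orderOf_dvd_of_pow_eq_one h2
      rw [h8] at this
      norm_num at this
  · have hX := x2 ha
    have hY := (yy hb.ge).1
    rcases (by clear * - hc; omega : orderOf z = 5 ∨ orderOf z = 6 ∨ 7 ≤ orderOf z)
      with hc5 | hc6 | hc7
    · have hZ := z5 hc5
      linarith only [hX, hY, hZ]
    · rcases z6 hc6 with hZ | ⟨hpz, hZ⟩
      · linarith only [hX, hY, hZ]
      · rcases y4 hb with hY | ⟨hpy, ⟨k, hk⟩, -⟩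
        · linarith only [hX, hY, hZ]
        · obtain ⟨i, hi⟩ := hy
          exact (hi (smul_eq_of_involutions h (fun i => by rw [← ha, px, one_smul])
            (sq_smul_eq hpy) (sq_smul_eq hpz) hk i)).elim
    · have hZ := (zz (le_trans (by norm_num) hc7)).2.2 hc7
      linarith only [hX, hY, hZ]
  · have hX := x2 ha
    have hY := (yy (le_trans (by norm_num) hb)).2.1 hb
    have hZ := (zz (le_trans (by norm_num) hc)).2.1 hc
    linarith only [hX, hY, hZ]
  · have hX := x3 ha
    have hY := y3 hb
    have hZ := (zz hc).1
    linarith only [hX, hY, hZ]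
  · have hX := x3 ha
    have hY := (yy hb).1
    have hZ := (zz hc).1
    linarith only [hX, hY, hZ]
  · have hX := (xx ha).1
    have hY := (yy hb).1
    have hZ := (zz hc).1
    linarith only [hX, hY, hZ]

/-- The case where each member of the triple moves some factor. -/
theorem sum_avgFix_lt_of_moved (hT : IsFactorSystem A T) [A.Normal] [Nontrivial H]
    (hc : 60 < Nat.card H) (h : IsTriple x y z) (hx : ∃ i : ι, x • i ≠ i) (hy : ∃ i : ι, y • i ≠ i)
    (hz : ∃ i : ι, z • i ≠ i) : avgFix A x + avgFix A y + avgFix A z < 229 / 230 := by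
  revert hx hy hz
  refine h.sorted_induction (P := fun x y z => (∃ i : ι, x • i ≠ i) → (∃ i : ι, y • i ≠ i) →
    (∃ i : ι, z • i ≠ i) → avgFix A x + avgFix A y + avgFix A z < 229 / 230) orderOf
    orderOf_inv_mul_mul ?_ ?_ ?_
  · intro x y z h hx hy hz
    linarith [h hy hz hx]
  · intro x y z h hx hy hz
    have := h hy ?_ hz
    · rw [avgFix_inv_mul_mul] at this; linarith
    · by_contra! hne
      obtain ⟨i, hi⟩ := hx
      apply hi
      have := conj_smul_eq (h := y) hne i
      simpa [mul_assoc] using this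
  · exact fun x y z h hab hbc => hT.sum_avgFix_lt_of_moved_of_le hc h hab hbc

end IsFactorSystem
end Sum

/-! ### Triples with a member fixing all factors -/

section Fixes

variable {H ι : Type*} [Group H] [MulAction H ι] {A : Subgroup H} {T : ι → Subgroup H}
  {x y z : H}

section Transitive

variable [MulAction.IsPretransitive H ι]

/-- If `z` fixes all factors, then `x` permutes them in a single cycle. -/
theorem IsTriple.exists_zpow_smul_eq (h : IsTriple x y z) (hz : ∀ i : ι, z • i = i) (i k : ι) :
    ∃ n : ℤ, x ^ n • i = k := by
  have key : ∀ g : H, ∃ n : ℤ, ∀ i : ι, g • i = x ^ n • i := by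
    intro g
    have hg : g ∈ Subgroup.closure {z, x} := by rw [h.rotate.rotate.closure_pair]; trivial
    induction hg using Subgroup.closure_induction with
    | mem s hs =>
      rcases hs with rfl | rfl
      · exact ⟨0, fun i => by rw [hz, zpow_zero, one_smul]⟩
      · exact ⟨1, fun i => by rw [zpow_one]⟩
    | one => exact ⟨0, fun i => by rw [zpow_zero]⟩
    | mul a b _ _ ha hb =>
      obtain ⟨m, hm⟩ := ha
      obtain ⟨n, hn⟩ := hb
      exact ⟨m + n, fun i => by rw [mul_smul, hm, hn, smul_smul, zpow_add]⟩
    | inv a _ ha =>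
      obtain ⟨m, hm⟩ := ha
      exact ⟨-m, fun i => by rw [inv_smul_eq_iff, hm, smul_smul, ← zpow_add]; simp⟩
  obtain ⟨g, rfl⟩ := MulAction.exists_smul_eq H i k
  obtain ⟨n, hn⟩ := key g
  exact ⟨n, (hn i).symm⟩

theorem IsTriple.period_eq (h : IsTriple x y z) (hz : ∀ i : ι, z • i = i) (i k : ι) :
    MulAction.period x i = MulAction.period x k := by
  obtain ⟨n, rfl⟩ := h.exists_zpow_smul_eq hz i k
  have : ∀ m : ℕ, x ^ m • x ^ n • i = x ^ n • i ↔ x ^ m • i = i := by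
    intro m
    rw [smul_smul, ((Commute.refl x).pow_left m |>.zpow_right n).eq, mul_smul, smul_left_cancel_iff]
  apply Nat.dvd_antisymm
  · rw [← MulAction.pow_smul_eq_iff_period_dvd, ← this, MulAction.pow_smul_eq_iff_period_dvd]
  · rw [← MulAction.pow_smul_eq_iff_period_dvd, this, MulAction.pow_smul_eq_iff_period_dvd]

theorem IsTriple.two_le_period [Finite H] [Nontrivial ι] (h : IsTriple x y z)
    (hz : ∀ i : ι, z • i = i) (i : ι) : 2 ≤ MulAction.period x i := by
  have h0 := period_pos' x i
  by_contra hlt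
  have h1 : MulAction.period x i = 1 := by omega
  have h2 : x • i = i := MulAction.period_eq_one_iff.mp h1
  obtain ⟨k, hk⟩ := exists_ne i
  obtain ⟨n, rfl⟩ := h.exists_zpow_smul_eq hz i k
  apply hk
  rw [MulAction.zpow_smul_eq_iff_period_dvd, h1]
  exact one_dvd _

omit [MulAction.IsPretransitive H ι] in
theorem IsTriple.period_eq_period (h : IsTriple x y z) (hz : ∀ i : ι, z • i = i) (i : ι) :
    MulAction.period y i = MulAction.period x i := by
  have h1 : ∀ i : ι, y • i = x⁻¹ • i := by
    intro i
    have : x⁻¹ = y * z := inv_eq_of_mul_eq_one_right (by rw [← mul_assoc]; exact h.prod)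
    rw [this, mul_smul, hz]
  have h2 : ∀ (n : ℕ) (i : ι), y ^ n • i = x⁻¹ ^ n • i := by
    intro n
    induction n with
    | zero => simp
    | succ n ih => intro i; rw [pow_succ, mul_smul, h1, ih, pow_succ, mul_smul]
  rw [← MulAction.period_inv x i]
  apply Nat.dvd_antisymm
  · rw [← MulAction.pow_smul_eq_iff_period_dvd, h2, MulAction.pow_smul_eq_iff_period_dvd]
  · rw [← MulAction.pow_smul_eq_iff_period_dvd, ← h2, MulAction.pow_smul_eq_iff_period_dvd]

end Transitive

variable [Finite H]

namespace IsFactorSystem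

/-- As `x` permutes the factors in a single cycle, it has the same order on each of them. -/
theorem factorPeriod_eq_orderOf [MulAction.IsPretransitive H ι] (hT : IsFactorSystem A T)
    (h : IsTriple x y z) (hz : ∀ i : ι, z • i = i) (i : ι) : factorPeriod T x i = orderOf x := by
  apply Nat.dvd_antisymm (factorPeriod_dvd_orderOf x i)
  rw [hT.orderOf_dvd_iff]
  intro k
  obtain ⟨n, hn⟩ := h.exists_zpow_smul_eq hz i k
  obtain ⟨m, hm : x ^ m = x ^ n⟩ := (mem_powers_iff_mem_zpowers (x := x)).mpr ⟨n, rfl⟩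
  rw [← hm] at hn
  subst hn
  clear hm
  induction m with
  | zero => simp
  | succ m ih => rwa [pow_succ', mul_smul, hT.factorPeriod_smul]

/-- Bound for an element which permutes at least three factors cyclically. -/
theorem avgFix_le_of_cycle (hT : IsFactorSystem A T) {i : ι} {t a : ℕ} (ht : 3 ≤ t)
    (hti : t ≤ MulAction.period x i) (ha : 0 < a) (hai : a ≤ factorPeriod T x i) :
    avgFix A x ≤ 1 / 3600 + (1 / 64 - 1 / 3600) / t + 63 / 64 / a :=
  hT.avgFix_le_three_self (by omega) (ht.trans hti) hti ha hai

/-- Bound for an element which exchanges two factors. -/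
theorem avgFix_le_of_swap (hT : IsFactorSystem A T) {i : ι} {a : ℕ}
    (hi : MulAction.period x i = 2) (ha : 0 < a) (hai : a ≤ factorPeriod T x i) :
    avgFix A x ≤ 1 / 60 + (1 / 64 - 1 / 60) / 2 + 63 / 64 / a := by
  refine (hT.avgFix_le_two hi i ha ha hai (by rwa [Nat.lcm_self])).trans (le_of_eq ?_)
  ring

omit [Finite H] in
theorem exists_factorPeriod_ne_one (hT : IsFactorSystem A T) (hz : z ≠ 1) :
    ∃ i, factorPeriod T z i ≠ 1 := by
  obtain ⟨i, hi⟩ := hT.exists_not_dvd (x := z) (n := 1) (fun h => hz (orderOf_eq_one_iff.mp (Nat.dvd_one.mp h)))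
  exact ⟨i, fun h => hi (by rw [h])⟩

omit [MulAction H ι] in
theorem two_le_factorPeriod {i : ι} (h : factorPeriod T z i ≠ 1) : 2 ≤ factorPeriod T z i := by
  have := factorPeriod_pos (T := T) z i
  omega

/-- Bound for an arbitrary nontrivial element, from one factor on which it acts nontrivially. -/
theorem avgFix_le_of_ne_one (hT : IsFactorSystem A T) (hz : z ≠ 1) : avgFix A z ≤ 0.5625 := by
  obtain ⟨i, hi⟩ := hT.exists_factorPeriod_ne_one hz
  have h1 := hT.avgFix_le_of_factor z i
  have h2 := div_natCast_le_div (c := 7 / 8) (by norm_num) (by norm_num) (two_le_factorPeriod hi)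
  norm_num at *
  linarith

theorem exists_three_le_factorPeriod (hT : IsFactorSystem A T) (hz : 3 ≤ orderOf z) :
    ∃ i, 3 ≤ factorPeriod T z i := by
  obtain ⟨i, hi⟩ := hT.exists_not_dvd (x := z) (n := 2)
    (fun h => absurd (Nat.le_of_dvd (by norm_num) h) (by omega))
  refine ⟨i, ?_⟩
  by_contra! hlt
  have := factorPeriod_pos (T := T) z i
  interval_cases factorPeriod T z i <;> omega

theorem avgFix_le_of_three_le_orderOf (hT : IsFactorSystem A T) (hz : 3 ≤ orderOf z) :
    avgFix A z ≤ 0.4167 := by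
  obtain ⟨i, hi⟩ := hT.exists_three_le_factorPeriod hz
  have h1 := hT.avgFix_le_of_factor z i
  have h2 := div_natCast_le_div (c := 7 / 8) (by norm_num) (by norm_num) hi
  norm_num at *
  linarith

section TwoFactors

variable {i k : ι}

/-- Bound for an element which fixes all factors and acts nontrivially on at least two of them. -/
theorem avgFix_le_of_two_factors (hT : IsFactorSystem A T) (hz : ∀ i : ι, z • i = i) (hik : i ≠ k)
    (hi : 2 ≤ factorPeriod T z i) (hk : 2 ≤ factorPeriod T z k) : avgFix A z ≤ 0.5079 := by
  have hl : 2 ≤ Nat.lcm (factorPeriod T z i) (factorPeriod T z k) :=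
    hi.trans (Nat.le_of_dvd (Nat.lcm_pos (by omega) (by omega)) (Nat.dvd_lcm_left _ _))
  have := hT.avgFix_le_pair hik (hz k) (by norm_num) (by norm_num) (by norm_num) hi hk hl
  norm_num at *
  linarith

omit [MulAction H ι] [Finite H] in
/-- If at least two factors are acted on nontrivially, then any factor has a partner among them. -/
theorem exists_partner (hik : i ≠ k)
    (hi : 2 ≤ factorPeriod T z i) (hk : 2 ≤ factorPeriod T z k) (j : ι) :
    ∃ l, j ≠ l ∧ 2 ≤ factorPeriod T z l := by
  by_cases h : j = i
  · exact ⟨k, h ▸ hik, hk⟩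
  · exact ⟨i, h, hi⟩

omit [MulAction H ι] in
theorem lcm_ge (j l : ι) : factorPeriod T z j ≤ Nat.lcm (factorPeriod T z j) (factorPeriod T z l) ∧
    factorPeriod T z l ≤ Nat.lcm (factorPeriod T z j) (factorPeriod T z l) :=
  ⟨Nat.le_of_dvd (Nat.lcm_pos (factorPeriod_pos z j) (factorPeriod_pos z l)) (Nat.dvd_lcm_left _ _),
    Nat.le_of_dvd (Nat.lcm_pos (factorPeriod_pos z j) (factorPeriod_pos z l)) (Nat.dvd_lcm_right _ _)⟩

theorem avgFix_le_of_two_factors_of_three_le (hT : IsFactorSystem A T) (hz : ∀ i : ι, z • i = i)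
    (hik : i ≠ k) (hi : 2 ≤ factorPeriod T z i) (hk : 2 ≤ factorPeriod T z k)
    (ho : 3 ≤ orderOf z) : avgFix A z ≤ 0.3438 := by
  obtain ⟨j, hj⟩ := hT.exists_three_le_factorPeriod ho
  obtain ⟨l, hjl, hl⟩ := exists_partner hik hi hk j
  by_cases h3 : 3 ≤ factorPeriod T z l
  · have := hT.avgFix_le_pair hjl (hz l) (by norm_num) (by norm_num) (by norm_num) hj h3
      (hj.trans (lcm_ge j l).1)
    norm_num at *
    linarith
  · have h4 : 4 ≤ Nat.lcm (factorPeriod T z j) (factorPeriod T z l) := by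
      have h2 : factorPeriod T z l = 2 := by omega
      have := Nat.dvd_lcm_right (factorPeriod T z j) (factorPeriod T z l)
      rw [h2] at this ⊢
      have h5 := (lcm_ge (T := T) (z := z) j l).1
      rw [h2] at h5
      omega
    have := hT.avgFix_le_pair hjl (hz l) (by norm_num) (by norm_num) (by norm_num) hj hl h4
    norm_num at *
    linarith

/-- An element of order at least `4` which does not act with order at least `4` on any factor acts
with order `3` on some factor and with order `2` on another. -/
theorem exists_two_three (hT : IsFactorSystem A T) (h3 : ∀ j, factorPeriod T z j ≤ 3)
    (ho : 4 ≤ orderOf z) : ∃ j l, factorPeriod T z j = 3 ∧ factorPeriod T z l = 2 := by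
  obtain ⟨j, hj⟩ := hT.exists_three_le_factorPeriod (by omega : 3 ≤ orderOf z)
  obtain ⟨l, hl⟩ := hT.exists_not_dvd (x := z) (n := 3)
    (fun h => absurd (Nat.le_of_dvd (by norm_num) h) (by omega))
  refine ⟨j, l, le_antisymm (h3 j) hj, ?_⟩
  have h0 := factorPeriod_pos (T := T) z l
  have h1 := h3 l
  interval_cases factorPeriod T z l <;> omega

theorem avgFix_le_of_two_factors_of_four_le (hT : IsFactorSystem A T) (hz : ∀ i : ι, z • i = i)
    (hik : i ≠ k) (hi : 2 ≤ factorPeriod T z i) (hk : 2 ≤ factorPeriod T z k)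
    (ho : 4 ≤ orderOf z) : avgFix A z ≤ 0.2891 := by
  by_cases h4 : ∃ j, 4 ≤ factorPeriod T z j
  · obtain ⟨j, hj⟩ := h4
    obtain ⟨l, hjl, hl⟩ := exists_partner hik hi hk j
    have := hT.avgFix_le_pair hjl (hz l) (by norm_num) (by norm_num) (by norm_num) hj hl
      (hj.trans (lcm_ge j l).1)
    norm_num at *
    linarith
  · push Not at h4
    obtain ⟨j, l, hj, hl⟩ := hT.exists_two_three (fun j => Nat.le_of_lt_succ (h4 j)) ho
    have hjl : j ≠ l := by rintro rfl; omega
    have := hT.avgFix_le_pair hjl (hz l) (a := 3) (b := 2) (l := 6) (by norm_num) (by norm_num)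
      (by norm_num) hj.ge hl.ge (by rw [hj, hl]; decide)
    norm_num at *
    linarith

/-- The exceptional elements have orders `3` and `2` on two factors; these occur for order `6`. -/
theorem avgFix_le_of_two_factors_of_five_le (hT : IsFactorSystem A T) (hz : ∀ i : ι, z • i = i)
    (hik : i ≠ k) (hi : 2 ≤ factorPeriod T z i) (hk : 2 ≤ factorPeriod T z k)
    (ho : 5 ≤ orderOf z) : avgFix A z ≤ 0.2198 ∨
      ∃ j l, factorPeriod T z j = 3 ∧ factorPeriod T z l = 2 := by
  by_cases h4 : ∀ j, factorPeriod T z j ≤ 3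
  · exact Or.inr (hT.exists_two_three h4 (by omega))
  left
  push Not at h4
  by_cases h5 : ∃ j, 5 ≤ factorPeriod T z j
  · obtain ⟨j, hj⟩ := h5
    obtain ⟨l, hjl, hl⟩ := exists_partner hik hi hk j
    obtain ⟨g1, g2⟩ := lcm_ge (T := T) (z := z) j l
    by_cases hl4 : 4 ≤ factorPeriod T z l
    · have := hT.avgFix_le_pair hjl (hz l) (by norm_num) (by norm_num) (by norm_num) hj hl4
        (hj.trans g1)
      norm_num at *
      linarith
    · have h6 : 6 ≤ Nat.lcm (factorPeriod T z j) (factorPeriod T z l) := by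
        have h1 := Nat.dvd_lcm_right (factorPeriod T z j) (factorPeriod T z l)
        rcases (by omega : factorPeriod T z l = 2 ∨ factorPeriod T z l = 3) with h2 | h2 <;>
        · rw [h2] at h1 g1 ⊢
          omega
      have := hT.avgFix_le_pair hjl (hz l) (by norm_num) (by norm_num) (by norm_num) hj hl h6
      norm_num at *
      linarith
  · push Not at h5
    obtain ⟨j, hj⟩ := h4
    have hj4 : factorPeriod T z j = 4 := by have := h5 j; omega
    obtain ⟨l, hl⟩ := hT.exists_not_dvd (x := z) (n := 4)
      (fun h => absurd (Nat.le_of_dvd (by norm_num) h) (by omega))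
    have hl3 : factorPeriod T z l = 3 := by
      have h0 := factorPeriod_pos (T := T) z l
      have h1 := h5 l
      interval_cases factorPeriod T z l <;> omega
    have hjl : j ≠ l := by rintro rfl; omega
    have := hT.avgFix_le_pair hjl (hz l) (a := 4) (b := 3) (l := 12) (by norm_num) (by norm_num)
      (by norm_num) hj4.ge hl3.ge (by rw [hj4, hl3]; decide)
    norm_num at *
    linarith

end TwoFactors

end IsFactorSystem
end Fixes

section Fixes

variable {H ι : Type*} [Group H] [Finite H] [MulAction H ι] [MulAction.IsPretransitive H ι]
  {A : Subgroup H} {T : ι → Subgroup H} {x y z : H}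

namespace IsFactorSystem

omit [MulAction.IsPretransitive H ι] in
/-- If `x` has the same order on the set of factors as in the group, then `z`, which fixes all
factors, acts nontrivially on at least two of them. -/
theorem exists_two_factors (hT : IsFactorSystem A T) (h : IsTriple x y z)
    (hz : ∀ i : ι, z • i = i) (hz1 : z ≠ 1) (hx : ∀ i : ι, MulAction.period x i = orderOf x) :
    ∃ i k, i ≠ k ∧ 2 ≤ factorPeriod T z i ∧ 2 ≤ factorPeriod T z k := by
  obtain ⟨i, hi⟩ := hT.exists_factorPeriod_ne_one hz1
  by_contra! hne
  refine hz1 (hT.eq_one_of_single h hz i (by rw [hx, pow_orderOf_eq_one]) fun k hk => ?_)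
  have h1 := hne i k hk.symm (two_le_factorPeriod hi)
  have h2 : factorPeriod T z k = 1 := by
    have := factorPeriod_pos (T := T) z k
    omega
  rw [← pow_one z, pow_mem_centralizer_iff, h2]

omit [Finite H] in
/-- If `x` exchanges two factors and `z` fixes them, there are no others. -/
theorem eq_or_eq_of_period_eq_two (h : IsTriple x y z) (hz : ∀ i : ι, z • i = i)
    (hx : ∀ i : ι, MulAction.period x i = 2) {i k : ι} (hik : i ≠ k) :
    x • i = k ∧ x • k = i ∧ ∀ j, j = i ∨ j = k := by
  have hall : ∀ i j : ι, j = i ∨ j = x • i := by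
    intro i j
    obtain ⟨n, rfl⟩ := h.exists_zpow_smul_eq hz i j
    rcases Int.even_or_odd n with hn | hn
    · left
      rw [MulAction.zpow_smul_eq_iff_period_dvd, hx]
      exact hn.two_dvd
    · right
      obtain ⟨m, rfl⟩ := hn
      rw [add_comm, zpow_add, zpow_one, mul_smul, smul_left_cancel_iff,
        MulAction.zpow_smul_eq_iff_period_dvd, hx]
      exact Dvd.intro _ rfl
  have h1 : x • i = k := ((hall i k).resolve_left hik.symm).symm
  have h2 : x • k = i := ((hall k i).resolve_left hik).symm
  exact ⟨h1, h2, fun j => h1 ▸ hall i j⟩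

/-- The case where `z` fixes all factors, and the order of `x` does not exceed the order of `y`. -/
theorem sum_avgFix_lt_of_fixes_of_le (hT : IsFactorSystem A T) [Nontrivial H] [Nontrivial ι]
    (hc : 60 < Nat.card H) (h : IsTriple x y z) (hab : orderOf x ≤ orderOf y)
    (hz : ∀ i : ι, z • i = i) : avgFix A x + avgFix A y + avgFix A z < 229 / 230 := by
  obtain ⟨i₀⟩ : Nonempty ι := inferInstance
  obtain ⟨t, ht⟩ : ∃ t, t = MulAction.period x i₀ := ⟨_, rfl⟩
  have hpx : ∀ i : ι, MulAction.period x i = t := fun i => (h.period_eq hz i i₀).trans ht.symm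
  have hpy : ∀ i : ι, MulAction.period y i = t := fun i => (h.period_eq_period hz i).trans (hpx i)
  have ht2 : 2 ≤ t := ht ▸ h.two_le_period hz i₀
  have hfx : ∀ i, factorPeriod T x i = orderOf x := hT.factorPeriod_eq_orderOf h hz
  have hfy : ∀ i, factorPeriod T y i = orderOf y := hT.factorPeriod_eq_orderOf h.swap hz
  have hz1 : z ≠ 1 := by
    intro hz1
    have h1 : y * x = 1 := by
      have := h.rotate.prod
      rwa [hz1, mul_one] at this
    apply hT.noAbelianNormal.not_commute h.closure_pair
    rw [h1, mul_eq_one_iff_eq_inv, eq_inv_of_mul_eq_one_right h1]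
  have hxa : t ∣ orderOf x := hpx i₀ ▸ period_dvd_orderOf' x i₀
  have hyb : t ∣ orderOf y := hpy i₀ ▸ period_dvd_orderOf' y i₀
  have htwo : orderOf x = t →
      ∃ i k, i ≠ k ∧ 2 ≤ factorPeriod T z i ∧ 2 ≤ factorPeriod T z k := fun hx =>
    hT.exists_two_factors h hz hz1 (fun i => by rw [hpx, hx])
  have hyp := h.hyperbolic hT.noAbelianNormal hc
  have hx0 := orderOf_pos x
  have hy0 := orderOf_pos y
  have hc2 : 2 ≤ orderOf z := by
    have := orderOf_pos z
    have : orderOf z ≠ 1 := fun h => hz1 (orderOf_eq_one_iff.mp h)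
    omega
  have hZ1 := hT.avgFix_le_of_ne_one hz1
  have hZ3 : 3 ≤ orderOf z → avgFix A z ≤ 0.4167 := hT.avgFix_le_of_three_le_orderOf
  have cx : ∀ {s a : ℕ}, 3 ≤ s → s ≤ t → 0 < a → a ≤ orderOf x →
      avgFix A x ≤ 1 / 3600 + (1 / 64 - 1 / 3600) / s + 63 / 64 / a := fun hs hst ha hax =>
    hT.avgFix_le_of_cycle hs (hpx i₀ ▸ hst) ha (hfx i₀ ▸ hax)
  have cy : ∀ {s a : ℕ}, 3 ≤ s → s ≤ t → 0 < a → a ≤ orderOf y →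
      avgFix A y ≤ 1 / 3600 + (1 / 64 - 1 / 3600) / s + 63 / 64 / a := fun hs hst ha hax =>
    hT.avgFix_le_of_cycle hs (hpy i₀ ▸ hst) ha (hfy i₀ ▸ hax)
  have sx : ∀ {a : ℕ}, t = 2 → 0 < a → a ≤ orderOf x →
      avgFix A x ≤ 1 / 60 + (1 / 64 - 1 / 60) / 2 + 63 / 64 / a := fun hs ha hax =>
    hT.avgFix_le_of_swap ((hpx i₀).trans hs) ha (hfx i₀ ▸ hax)
  have sy : ∀ {a : ℕ}, t = 2 → 0 < a → a ≤ orderOf y →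
      avgFix A y ≤ 1 / 60 + (1 / 64 - 1 / 60) / 2 + 63 / 64 / a := fun hs ha hax =>
    hT.avgFix_le_of_swap ((hpy i₀).trans hs) ha (hfy i₀ ▸ hax)
  have hyinv : y⁻¹ = z * x := inv_eq_of_mul_eq_one_right (by rw [← mul_assoc]; exact h.rotate.prod)
  have hxz : ∀ n : ℕ, y ^ n = 1 → (x * z) ^ n = 1 := by
    intro n hn
    have : x * z = x * y⁻¹ * x⁻¹ := by rw [hyinv]; group
    rw [this, conj_pow, inv_pow, hn]
    group
  have px : x ^ orderOf x = 1 := pow_orderOf_eq_one x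
  have py : y ^ orderOf y = 1 := pow_orderOf_eq_one y
  have pz : z ^ orderOf z = 1 := pow_orderOf_eq_one z
  -- `t` is the number of factors, which divides the orders of `x` and `y`
  rcases (by clear * - ht2; omega : t = 2 ∨ t = 3 ∨ t = 4 ∨ 5 ≤ t) with rfl | rfl | rfl | ht5
  · by_cases hx2 : orderOf x = 2
    · obtain ⟨i, k, hik, hi, hk⟩ := htwo hx2
      have hX := sx (a := 2) rfl (by norm_num) hx2.ge
      have hcases : orderOf y = 4 ∧ 5 ≤ orderOf z ∨ orderOf y = 6 ∧ 4 ≤ orderOf z ∨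
          8 ≤ orderOf y ∧ 3 ≤ orderOf z := by
        clear * - hx2 hyp hyb hy0 hc2
        rw [hx2] at hyp
        rcases (by omega : orderOf y = 2 ∨ orderOf y = 4 ∨ orderOf y = 6 ∨ 8 ≤ orderOf y)
          with hb | hb | hb | hb
        · rw [hb] at hyp; omega
        · rw [hb] at hyp; omega
        · rw [hb] at hyp; omega
        · have : orderOf z ≠ 2 := by
            intro hz2
            rw [hz2] at hyp
            omega
          omega
      rcases hcases with ⟨hb, hz5⟩ | ⟨hb, hz4⟩ | ⟨hb, hz3⟩
      · have hY := sy (a := 4) rfl (by norm_num) hb.ge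
        rcases hT.avgFix_le_of_two_factors_of_five_le hz hik hi hk hz5 with hZ | ⟨j, l, hj, hl⟩
        · norm_num at hX hY hZ ⊢
          linarith only [hX, hY, hZ]
        · have hjl : j ≠ l := by
            rintro rfl
            rw [hj] at hl
            norm_num at hl
          obtain ⟨h1, h2, h3⟩ := eq_or_eq_of_period_eq_two h hz hpx hjl
          exact (hT.false_of_two_four_six h h3 hz h1 h2 (hx2 ▸ px) (hxz 4 (hb ▸ py)) hj hl).elim
      · have hY := sy (a := 6) rfl (by norm_num) hb.ge
        have hZ := hT.avgFix_le_of_two_factors_of_four_le hz hik hi hk hz4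
        norm_num at hX hY hZ ⊢
        linarith only [hX, hY, hZ]
      · have hY := sy (a := 8) rfl (by norm_num) hb
        have hZ := hT.avgFix_le_of_two_factors_of_three_le hz hik hi hk hz3
        norm_num at hX hY hZ ⊢
        linarith only [hX, hY, hZ]
    · have hx4 : 4 ≤ orderOf x := by clear * - hx2 hxa hx0; omega
      have hX := sx (a := 4) rfl (by norm_num) hx4
      by_cases hz3 : 3 ≤ orderOf z
      · have hY := sy (a := 4) rfl (by norm_num) (hx4.trans hab)
        have hZ := hZ3 hz3
        norm_num at hX hY hZ ⊢
        linarith only [hX, hY, hZ]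
      · have hz2 : orderOf z = 2 := by clear * - hz3 hc2; omega
        by_cases hy8 : 8 ≤ orderOf y
        · have hY := sy (a := 8) rfl (by norm_num) hy8
          norm_num at hX hY hZ1 ⊢
          linarith only [hX, hY, hZ1]
        · by_cases hx6 : 6 ≤ orderOf x
          · have hX := sx (a := 6) rfl (by norm_num) hx6
            have hY := sy (a := 6) rfl (by norm_num) (hx6.trans hab)
            norm_num at hX hY hZ1 ⊢
            linarith only [hX, hY, hZ1]
          · have ha : orderOf x = 4 := by clear * - hx6 hx4 hxa; omega
            have hb : orderOf y = 6 := by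
              clear * - ha hy8 hyp hyb hz2 hab
              rw [ha, hz2] at hyp
              omega
            have hY := sy (a := 6) rfl (by norm_num) hb.ge
            by_cases h2 : ∃ i k, i ≠ k ∧ 2 ≤ factorPeriod T z i ∧ 2 ≤ factorPeriod T z k
            · obtain ⟨i, k, hik, hi, hk⟩ := h2
              have hZ := hT.avgFix_le_of_two_factors hz hik hi hk
              norm_num at hX hY hZ ⊢
              linarith only [hX, hY, hZ]
            -- orders `(4, 6, 2)` with `z` acting on a single factor: `y ^ 2 = 1` is forced
            · exfalso
              push Not at h2
              obtain ⟨k, hk⟩ := hT.exists_factorPeriod_ne_one hz1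
              obtain ⟨i, hik⟩ := exists_ne k
              have h3 := h2 k i hik.symm (two_le_factorPeriod hk)
              have h4 : factorPeriod T z i = 1 := by
                have := factorPeriod_pos (T := T) z i
                clear * - this h3
                omega
              have hzi : z ∈ Subgroup.centralizer (T i : Set H) := by
                rw [← pow_one z, pow_mem_centralizer_iff, h4]
              obtain ⟨h5, h6, h7⟩ := eq_or_eq_of_period_eq_two h hz hpx hik
              have h8 := hT.sq_eq_one_of_four_six_two h h7 hz h5 h6 (ha ▸ px) (hz2 ▸ pz)
                (hxz 6 (hb ▸ py)) hzi
              have h9 : (y⁻¹) ^ 2 = 1 := by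
                have : y⁻¹ = x⁻¹ * (x * z) * x⁻¹⁻¹ := by rw [hyinv]; group
                rw [this, conj_pow, h8]; group
              rw [inv_pow, inv_eq_one] at h9
              have h10 := orderOf_dvd_of_pow_eq_one h9
              rw [hb] at h10
              norm_num at h10
  -- three factors
  · rcases (by clear * - hxa hyb hx0 hab; omega : orderOf x = 3 ∧ orderOf y = 3 ∨
      orderOf x = 3 ∧ orderOf y = 6 ∨ orderOf x = 3 ∧ 9 ≤ orderOf y ∨ 6 ≤ orderOf x) with
      ⟨ha, hb⟩ | ⟨ha, hb⟩ | ⟨ha, hb⟩ | ha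
    · obtain ⟨i, k, hik, hi, hk⟩ := htwo ha
      have hz4 : 4 ≤ orderOf z := by
        clear * - ha hb hyp
        rw [ha, hb] at hyp
        omega
      have hX := cx (s := 3) (a := 3) le_rfl le_rfl (by norm_num) ha.ge
      have hY := cy (s := 3) (a := 3) le_rfl le_rfl (by norm_num) hb.ge
      have hZ := hT.avgFix_le_of_two_factors_of_four_le hz hik hi hk hz4
      norm_num at hX hY hZ ⊢
      linarith only [hX, hY, hZ]
    · have hz3 : 3 ≤ orderOf z := by
        clear * - ha hb hyp
        rw [ha, hb] at hyp
        omega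
      have hX := cx (s := 3) (a := 3) le_rfl le_rfl (by norm_num) ha.ge
      have hY := cy (s := 3) (a := 6) le_rfl le_rfl (by norm_num) hb.ge
      have hZ := hZ3 hz3
      norm_num at hX hY hZ ⊢
      linarith only [hX, hY, hZ]
    · obtain ⟨i, k, hik, hi, hk⟩ := htwo ha
      have hX := cx (s := 3) (a := 3) le_rfl le_rfl (by norm_num) ha.ge
      have hY := cy (s := 3) (a := 9) le_rfl le_rfl (by norm_num) hb
      have hZ := hT.avgFix_le_of_two_factors hz hik hi hk
      norm_num at hX hY hZ ⊢
      linarith only [hX, hY, hZ]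
    · have hX := cx (s := 3) (a := 6) le_rfl le_rfl (by norm_num) ha
      have hY := cy (s := 3) (a := 6) le_rfl le_rfl (by norm_num) (ha.trans hab)
      norm_num at hX hY hZ1 ⊢
      linarith only [hX, hY, hZ1]
  · have ha : 4 ≤ orderOf x := Nat.le_of_dvd hx0 hxa
    have hX := cx (s := 4) (a := 4) (by norm_num) le_rfl (by norm_num) ha
    by_cases hb : orderOf y = 4
    · have hz3 : 3 ≤ orderOf z := by
        have ha : orderOf x = 4 := le_antisymm (hb ▸ hab) ha
        clear * - ha hb hyp
        rw [ha, hb] at hyp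
        omega
      have hY := cy (s := 4) (a := 4) (by norm_num) le_rfl (by norm_num) hb.ge
      have hZ := hZ3 hz3
      norm_num at hX hY hZ ⊢
      linarith only [hX, hY, hZ]
    · have hb8 : 8 ≤ orderOf y := by clear * - hb hyb hy0; omega
      have hY := cy (s := 4) (a := 8) (by norm_num) le_rfl (by norm_num) hb8
      norm_num at hX hY hZ1 ⊢
      linarith only [hX, hY, hZ1]
  · have hX := cx (s := 5) (a := 5) (by norm_num) ht5 (by norm_num)
      (ht5.trans (Nat.le_of_dvd hx0 hxa))
    have hY := cy (s := 5) (a := 5) (by norm_num) ht5 (by norm_num)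
      (ht5.trans (Nat.le_of_dvd hy0 hyb))
    norm_num at hX hY hZ1 ⊢
    linarith only [hX, hY, hZ1]

theorem sum_avgFix_lt_of_fixes (hT : IsFactorSystem A T) [A.Normal] [Nontrivial H] [Nontrivial ι]
    (hc : 60 < Nat.card H) (h : IsTriple x y z) (hz : ∀ i : ι, z • i = i) :
    avgFix A x + avgFix A y + avgFix A z < 229 / 230 := by
  rcases le_total (orderOf x) (orderOf y) with hab | hab
  · exact hT.sum_avgFix_lt_of_fixes_of_le hc h hab hz
  · have := hT.sum_avgFix_lt_of_fixes_of_le hc h.swap (by rwa [orderOf_inv_mul_mul]) hz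
    rw [avgFix_inv_mul_mul] at this
    linarith

/-- The orbit ratios of a generating triple on a minimal normal subgroup which is not simple have
sum less than `229 / 230`. -/
theorem sum_avgFix_lt (hT : IsFactorSystem A T) [A.Normal] [Nontrivial ι] (h : IsTriple x y z) :
    avgFix A x + avgFix A y + avgFix A z < 229 / 230 := by
  obtain ⟨i, k, hik⟩ := exists_pair_ne ι
  have hc : 60 < Nat.card H := by
    refine lt_of_le_of_lt (hT.sixty i) (lt_of_le_of_ne (Subgroup.card_le_card_group _) fun he => ?_)
    have hi : T i = ⊤ := Subgroup.eq_top_of_card_eq _ he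
    have h1 : T k = ⊥ := by
      rw [eq_bot_iff]
      exact fun g hg => hT.eq_one_of_mem_of_ne hik (hi ▸ trivial) hg
    have := hT.sixty k
    rw [h1, Subgroup.card_bot] at this
    omega
  have : Nontrivial H := Finite.one_lt_card_iff_nontrivial.mp (by omega)
  by_cases hx : ∀ i : ι, x • i = i
  · linarith [hT.sum_avgFix_lt_of_fixes hc h.rotate hx]
  by_cases hy : ∀ i : ι, y • i = i
  · linarith [hT.sum_avgFix_lt_of_fixes hc h.rotate.rotate hy]
  by_cases hz : ∀ i : ι, z • i = i
  · exact hT.sum_avgFix_lt_of_fixes hc h hz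
  push Not at hx hy hz
  exact hT.sum_avgFix_lt_of_moved hc h hx hy hz

end IsFactorSystem
end Fixes

/-! ### Primitive groups with two minimal normal subgroups -/

section MinimalNormal

variable {G : Type*} [Group G] {M N P : Subgroup G}

theorem IsMinimalNormal.normal (hM : IsMinimalNormal M) : M.Normal := hM.prop.1

theorem IsMinimalNormal.ne_bot (hM : IsMinimalNormal M) : M ≠ ⊥ := hM.prop.2

theorem IsMinimalNormal.le_of_ne_bot (hM : IsMinimalNormal M) (hP : P.Normal) (hb : P ≠ ⊥)
    (hle : P ≤ M) : M ≤ P :=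
  hM.le_of_le ⟨hP, hb⟩ hle

theorem IsMinimalNormal.disjoint (hM : IsMinimalNormal M) (hN : IsMinimalNormal N) (h : M ≠ N) :
    Disjoint M N := by
  rw [disjoint_iff]
  by_contra hb
  have := hM.normal
  have := hN.normal
  have h1 := hM.le_of_ne_bot (P := M ⊓ N) inferInstance hb inf_le_left
  have h2 := hN.le_of_ne_bot (P := M ⊓ N) inferInstance hb inf_le_right
  exact h (le_antisymm (h1.trans inf_le_right) (h2.trans inf_le_left))

theorem IsMinimalNormal.commute (hM : IsMinimalNormal M) (hN : IsMinimalNormal N) (h : M ≠ N)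
    {m n : G} (hm : m ∈ M) (hn : n ∈ N) : m * n = n * m :=
  Subgroup.commute_of_normal_of_disjoint M N hM.normal hN.normal (hM.disjoint hN h) m n hm hn

end MinimalNormal

section Primitive

variable {G Ω : Type*} [Group G] [MulAction G Ω] {M N : Subgroup G}

/-- A minimal normal subgroup of a faithful primitive group is transitive. -/
theorem IsTypeB.exists_smul_eq (hB : IsTypeB G Ω) (hM : IsMinimalNormal M) (a b : Ω) :
    ∃ m ∈ M, m • a = b := by
  have := hB.primitive
  have := hB.faithful
  have hq : MulAction.IsQuasiPreprimitive G Ω := inferInstance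
  have := hM.normal
  have hne : MulAction.fixedPoints M Ω ≠ Set.univ := by
    intro h
    apply hM.ne_bot
    rw [eq_bot_iff]
    intro m hm
    rw [Subgroup.mem_bot]
    apply FaithfulSMul.eq_of_smul_eq_smul (α := Ω)
    intro a
    have ha : a ∈ MulAction.fixedPoints M Ω := h ▸ Set.mem_univ a
    rw [one_smul]
    exact ha ⟨m, hm⟩
  have ht := hq.isPretransitive_of_normal hne
  obtain ⟨m, hm⟩ := ht.exists_smul_eq a b
  exact ⟨m, m.2, hm⟩

/-- A nontrivial element which commutes with a minimal normal subgroup acts without fixed points. -/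
theorem IsTypeB.eq_one_of_smul_eq (hB : IsTypeB G Ω) (hM : IsMinimalNormal M) {c : G}
    (hc : ∀ m ∈ M, m * c = c * m) {a : Ω} (ha : c • a = a) : c = 1 := by
  have := hB.faithful
  apply FaithfulSMul.eq_of_smul_eq_smul (α := Ω)
  intro b
  obtain ⟨m, hm, rfl⟩ := hB.exists_smul_eq hM a b
  rw [one_smul, smul_smul, ← hc m hm, mul_smul, ha]

theorem IsTypeB.nonempty (hB : IsTypeB G Ω) : Nonempty Ω := by
  by_contra hne
  have := not_nonempty_iff.mp hne
  have := hB.faithful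
  obtain ⟨M, N, hM, -, -⟩ := hB.exists_two_minimal_normal
  apply hM.ne_bot
  rw [eq_bot_iff]
  intro m _
  exact FaithfulSMul.eq_of_smul_eq_smul (α := Ω) (fun a => isEmptyElim a)

theorem IsTypeB.finite [Finite Ω] (hB : IsTypeB G Ω) : Finite G := by
  have := hB.faithful
  exact Finite.of_injective _ (MulAction.toPerm_injective (α := G) (β := Ω))

variable (hB : IsTypeB G Ω) (hM : IsMinimalNormal M) (hN : IsMinimalNormal N) (hMN : M ≠ N)

include hB hM hN hMN

theorem IsTypeB.eq_one_of_mem_of_smul_eq {m : G} (hm : m ∈ M) {a : Ω} (ha : m • a = a) : m = 1 :=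
  hB.eq_one_of_smul_eq hN (fun _ hn => (hM.commute hN hMN hm hn).symm) ha

/-- The centralizer of `M` acts without fixed points and contains the transitive group `N`, so it is `N`. -/
theorem IsTypeB.mem_of_commute {c : G} (hc : ∀ m ∈ M, m * c = c * m) : c ∈ N := by
  obtain ⟨a⟩ := hB.nonempty
  obtain ⟨n, hn, hna⟩ := hB.exists_smul_eq hN a (c • a)
  have h1 : n⁻¹ * c = 1 := by
    apply hB.eq_one_of_smul_eq hM (a := a)
    · intro m hm
      rw [← mul_assoc, hM.commute hN hMN hm (N.inv_mem hn), mul_assoc, hc m hm, mul_assoc]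
    · rw [mul_smul, ← hna, inv_smul_smul]
  rw [← inv_mul_eq_one.mp h1]
  exact hn

theorem IsTypeB.exists_not_commute : ∃ a ∈ M, ∃ b ∈ M, a * b ≠ b * a := by
  by_contra! h
  apply hM.ne_bot
  rw [eq_bot_iff, ← (disjoint_iff.mp (hM.disjoint hN hMN))]
  exact fun m hm => ⟨hm, hB.mem_of_commute hM hN hMN fun a ha => h a ha m hm⟩

/-- `M` acts regularly. -/
theorem IsTypeB.card_eq : Nat.card Ω = Nat.card M := by
  obtain ⟨a⟩ := hB.nonempty
  refine (Nat.card_eq_of_bijective (fun m : M => (m : G) • a) ⟨fun m m' h => ?_, fun b => ?_⟩).symm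
  · have h1 : ((m' : G)⁻¹ * m) • a = a := by rw [mul_smul, inv_smul_eq_iff]; exact h
    exact Subtype.ext (inv_mul_eq_one.mp (hB.eq_one_of_mem_of_smul_eq hM hN hMN
      (M.mul_mem (M.inv_mem m'.2) m.2) h1)).symm
  · obtain ⟨m, hm, hb⟩ := hB.exists_smul_eq hM a b
    exact ⟨⟨m, hm⟩, hb⟩

/-- The regular normal subgroups `M` and `N` centralizing each other are isomorphic: `m` corresponds
to the element of `N` which acts on a base point as the inverse of `m` does. -/
theorem IsTypeB.nonempty_mulEquiv : Nonempty (M ≃* N) := by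
  obtain ⟨a⟩ := hB.nonempty
  choose f hf hfa using fun m : M => hB.exists_smul_eq hN a ((m : G)⁻¹ • a)
  have huniq : ∀ n n' : G, n ∈ N → n' ∈ N → n • a = n' • a → n = n' := by
    intro n n' hn hn' h
    have h1 : (n'⁻¹ * n : G) • a = a := by rw [mul_smul, inv_smul_eq_iff]; exact h
    exact (inv_mul_eq_one.mp (hB.eq_one_of_mem_of_smul_eq hN hM hMN.symm
      (N.mul_mem (N.inv_mem hn') hn) h1)).symm
  let F : M →* N := MonoidHom.mk' (fun m => ⟨f m, hf m⟩) (by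
    intro m m'
    apply Subtype.ext
    apply huniq _ _ (hf _) (N.mul_mem (hf m) (hf m'))
    change f (m * m') • a = (f m * f m') • a
    rw [hfa, Subgroup.coe_mul, mul_inv_rev, mul_smul, ← hfa m, smul_smul,
      hM.commute hN hMN (M.inv_mem m'.2) (hf m), mul_smul, ← hfa m', mul_smul])
  refine ⟨MulEquiv.ofBijective F ⟨?_, ?_⟩⟩
  · rw [injective_iff_map_eq_one]
    intro m hm
    have h1 : f m = 1 := congrArg Subtype.val hm
    have h2 := hfa m
    rw [h1, one_smul] at h2
    have h3 := hB.eq_one_of_mem_of_smul_eq hM hN hMN (M.inv_mem m.2) h2.symm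
    exact Subtype.ext (inv_eq_one.mp h3)
  · rintro ⟨n, hn⟩
    obtain ⟨m, hm, hma⟩ := hB.exists_smul_eq hM a (n • a)
    refine ⟨⟨m⁻¹, M.inv_mem hm⟩, Subtype.ext (huniq _ _ (hf _) hn ?_)⟩
    change f ⟨m⁻¹, _⟩ • a = n • a
    rw [hfa, inv_inv, hma]

theorem IsTypeB.socle_eq : socle G = M ⊔ N := by
  apply le_antisymm
  · refine sSup_le fun P hP => ?_
    by_cases hPM : P = M
    · rw [hPM]; exact le_sup_left
    · have hle : P ≤ N := fun p hp =>
        hB.mem_of_commute hM hN hMN fun m hm => (hP.commute hM hPM hp hm).symm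
      exact hle.trans le_sup_right
  · exact sup_le (le_sSup hM) (le_sSup hN)

theorem IsTypeB.nonempty_socle_mulEquiv : Nonempty (socle G ≃* M × M) := by
  obtain ⟨e⟩ := hB.nonempty_mulEquiv hM hN hMN
  let F : M × N →* G := M.subtype.noncommCoprod N.subtype
    (fun m n => hM.commute hN hMN m.2 n.2)
  have hF : Function.Injective F := by
    refine (MonoidHom.noncommCoprod_injective _ _ _).mpr ⟨M.subtype_injective, N.subtype_injective, ?_⟩
    rw [Subgroup.range_subtype, Subgroup.range_subtype]
    exact hM.disjoint hN hMN
  have hr : F.range = socle G := by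
    refine (MonoidHom.noncommCoprod_range _ _ _).trans ?_
    rw [Subgroup.range_subtype, Subgroup.range_subtype, hB.socle_eq hM hN hMN]
  exact ⟨((MulEquiv.prodCongr (MulEquiv.refl M) e).trans
    ((MonoidHom.ofInjective hF).trans (MulEquiv.subgroupCongr hr))).symm⟩

omit hB in
theorem IsMinimalNormal.mk_injOn [N.Normal] {m m' : G} (hm : m ∈ M) (hm' : m' ∈ M)
    (h : QuotientGroup.mk' N m = QuotientGroup.mk' N m') : m = m' := by
  have h1 : m⁻¹ * m' ∈ N := QuotientGroup.eq.mp h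
  have h2 : m⁻¹ * m' ∈ M ⊓ N := ⟨M.mul_mem (M.inv_mem hm) hm', h1⟩
  rw [disjoint_iff.mp (hM.disjoint hN hMN), Subgroup.mem_bot] at h2
  exact inv_mul_eq_one.mp h2

omit hB in
theorem IsMinimalNormal.map_mk [N.Normal] : IsMinimalNormal (M.map (QuotientGroup.mk' N)) := by
  have := hM.normal
  refine ⟨⟨this.map _ (QuotientGroup.mk'_surjective N), ?_⟩, ?_⟩
  · intro hb
    apply hM.ne_bot
    rw [eq_bot_iff]
    intro m hm
    have h1 : QuotientGroup.mk' N m ∈ (⊥ : Subgroup (G ⧸ N)) := hb ▸ Subgroup.mem_map_of_mem _ hm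
    rw [Subgroup.mem_bot, ← map_one (QuotientGroup.mk' N)] at h1
    exact hM.mk_injOn hN hMN hm M.one_mem h1
  · rintro B ⟨hB, hb⟩ hle
    have hMB : M ≤ B.comap (QuotientGroup.mk' N) := by
      refine (hM.le_of_ne_bot (P := B.comap (QuotientGroup.mk' N) ⊓ M) inferInstance ?_
        inf_le_right).trans inf_le_left
      intro h1
      apply hb
      rw [eq_bot_iff]
      intro b hbB
      obtain ⟨m, hm, rfl⟩ := hle hbB
      have h2 : m ∈ B.comap (QuotientGroup.mk' N) ⊓ M := ⟨hbB, hm⟩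
      rw [h1, Subgroup.mem_bot] at h2
      rw [h2, map_one]
      exact Subgroup.one_mem _
    exact Subgroup.map_le_iff_le_comap.mpr hMB

theorem IsTypeB.centralizer_map_mk [N.Normal] :
    Subgroup.centralizer (M.map (QuotientGroup.mk' N) : Set (G ⧸ N)) = ⊥ := by
  rw [eq_bot_iff]
  intro c hc
  obtain ⟨c, rfl⟩ := QuotientGroup.mk'_surjective N c
  rw [Subgroup.mem_bot]
  refine (QuotientGroup.eq_one_iff c).mpr (hB.mem_of_commute hM hN hMN fun m hm => ?_)
  have h1 := Subgroup.mem_centralizer_iff.mp hc _ (Subgroup.mem_map_of_mem _ hm)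
  have hcm : c * m * c⁻¹ ∈ M := hM.normal.conj_mem m hm c
  have h2 : m = c * m * c⁻¹ := by
    apply hM.mk_injOn hN hMN hm hcm
    rw [map_mul, map_mul, ← h1, ← map_mul, ← map_mul, mul_inv_cancel_right]
  rw [eq_mul_inv_iff_mul_eq] at h2
  exact h2

/-- The fixed points of `x` on `Ω` correspond to elements of `M` commuting with `x`, by regularity
of `M`; these embed into the quotient by `N`. -/
theorem IsTypeB.card_fixedBy_le [Finite Ω] [N.Normal] (x : G) :
    (Nat.card (MulAction.fixedBy Ω x) : ℚ) / Nat.card Ω ≤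
      fixRatio (M.map (QuotientGroup.mk' N)) (QuotientGroup.mk' N x) := by
  have := hB.finite
  have hcard : Nat.card Ω = Nat.card (M.map (QuotientGroup.mk' N)) := by
    rw [hB.card_eq hM hN hMN]
    refine Nat.card_eq_of_bijective (fun m : M => (⟨_, Subgroup.mem_map_of_mem _ m.2⟩ :
      M.map (QuotientGroup.mk' N))) ⟨fun m m' h => ?_, ?_⟩
    · exact Subtype.ext (hM.mk_injOn hN hMN m.2 m'.2 (congrArg Subtype.val h))
    · rintro ⟨_, m, hm, rfl⟩
      exact ⟨⟨m, hm⟩, rfl⟩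
  unfold fixRatio
  rw [← hcard]
  gcongr
  rcases isEmpty_or_nonempty (MulAction.fixedBy Ω x) with he | ⟨⟨a, ha⟩⟩
  · rw [Nat.card_eq_zero.mpr (Or.inl he)]
    exact Nat.zero_le _
  have ha' : x • a = a := ha
  choose f hf hfa using fun b : MulAction.fixedBy Ω x => hB.exists_smul_eq hM a b.1
  have hcomm : ∀ b, f b * x = x * f b := by
    intro b
    have hb : x • (b : Ω) = b := b.2
    have hxm : x * f b * x⁻¹ ∈ M := hM.normal.conj_mem _ (hf b) x
    have h1 : ((f b)⁻¹ * (x * f b * x⁻¹)) • a = a := by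
      have h2 : x⁻¹ • a = a := by rw [inv_smul_eq_iff, ha']
      rw [mul_smul, mul_smul, mul_smul, h2, hfa, hb, inv_smul_eq_iff, hfa]
    have h2 := hB.eq_one_of_mem_of_smul_eq hM hN hMN (M.mul_mem (M.inv_mem (hf b)) hxm) h1
    exact eq_mul_inv_iff_mul_eq.mp (inv_mul_eq_one.mp h2)
  refine Nat.card_le_card_of_injective (fun b => (⟨QuotientGroup.mk' N (f b),
    Subgroup.mem_map_of_mem _ (hf b), ?_⟩ : (M.map (QuotientGroup.mk' N) ⊓
      Subgroup.centralizer {QuotientGroup.mk' N x} : Subgroup (G ⧸ N)))) ?_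
  · refine Subgroup.mem_centralizer_singleton_iff.mpr ?_
    rw [← map_mul, ← map_mul, hcomm]
  · intro b b' h
    have h1 := hM.mk_injOn hN hMN (hf b) (hf b') (congrArg Subtype.val h)
    apply Subtype.ext
    rw [← hfa b, ← hfa b', h1]

end Primitive

/-! ### Orbit ratios and fixed point ratios -/

section OrbitRatio

variable {G : Type*} [Group G] [Finite G]

/-- Burnside's lemma for the cyclic group generated by `x`. -/
theorem orbitCount_mul_orderOf (Ω : Type*) [Finite Ω] [MulAction G Ω] (x : G) :
    orbitCount Ω x * orderOf x =
      ∑ j ∈ Finset.range (orderOf x), Nat.card (MulAction.fixedBy Ω (x ^ j)) := by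
  classical
  have := Fintype.ofFinite G
  have := Fintype.ofFinite Ω
  have h := MulAction.sum_card_fixedBy_eq_card_orbits_mul_card_group (Subgroup.zpowers x) Ω
  unfold orbitCount
  rw [← Nat.card_zpowers, Nat.card_eq_fintype_card (α := Subgroup.zpowers x)]
  have h2 : Nat.card (MulAction.orbitRel.Quotient (Subgroup.zpowers x) Ω) =
      Fintype.card (Quotient (MulAction.orbitRel (Subgroup.zpowers x) Ω)) :=
    Nat.card_eq_fintype_card
  rw [h2, ← h, ← Nat.card_eq_fintype_card (α := Subgroup.zpowers x), Nat.card_zpowers,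
    Finset.sum_range, ← (finEquivZPowers (isOfFinOrder_of_finite x)).sum_comp]
  refine Finset.sum_congr rfl fun j _ => ?_
  rw [finEquivZPowers_apply, ← Nat.card_eq_fintype_card]
  rfl

/-- An average over the powers of `x` of a function of the image of `x` under a homomorphism. -/
theorem sum_range_orderOf_div {H : Type*} [Group H] [Finite H] (q : G →* H) (x : G) (f : H → ℚ) :
    (∑ j ∈ Finset.range (orderOf x), f (q x ^ j)) / orderOf x =
      (∑ j ∈ Finset.range (orderOf (q x)), f (q x ^ j)) / orderOf (q x) := by
  obtain ⟨m, hm⟩ := orderOf_map_dvd q x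
  have key : ∀ m : ℕ, ∑ j ∈ Finset.range (orderOf (q x) * m), f (q x ^ j) =
      m * ∑ j ∈ Finset.range (orderOf (q x)), f (q x ^ j) := by
    intro m
    induction m with
    | zero => simp
    | succ m ih =>
      rw [mul_add, mul_one, Finset.sum_range_add, ih]
      simp only [pow_add, pow_mul, pow_orderOf_eq_one, one_pow, one_mul]
      push_cast
      ring
  have h0 : (orderOf (q x) : ℚ) ≠ 0 := by exact_mod_cast (orderOf_pos (q x)).ne'
  have h1 : (m : ℚ) ≠ 0 := by
    rintro h
    have : m = 0 := by exact_mod_cast h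
    rw [this, mul_zero] at hm
    exact (orderOf_pos x).ne' hm
  rw [hm, key]
  push_cast
  field_simp

variable {Ω : Type*} [MulAction G Ω] {M N : Subgroup G}

/-- The orbit ratio of `x` on `Ω` is at most the orbit ratio of its image in the quotient by `N` on
the image of `M`. -/
theorem IsTypeB.orbitRatio_le_avgFix [Finite Ω] (hB : IsTypeB G Ω) (hM : IsMinimalNormal M)
    (hN : IsMinimalNormal N) (hMN : M ≠ N) [N.Normal] (x : G) :
    orbitRatio Ω x ≤ avgFix (M.map (QuotientGroup.mk' N)) (QuotientGroup.mk' N x) := by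
  unfold avgFix
  rw [← sum_range_orderOf_div]
  have h0 : (0 : ℚ) < orderOf x := by exact_mod_cast orderOf_pos x
  rw [le_div_iff₀ h0]
  unfold orbitRatio
  rw [div_mul_eq_mul_div, ← Nat.cast_mul, orbitCount_mul_orderOf, Nat.cast_sum, Finset.sum_div]
  refine Finset.sum_le_sum fun j _ => ?_
  rw [← map_pow]
  exact hB.card_fixedBy_le hM hN hMN (x ^ j)

/-- If `M` is not simple, the orbit ratios of a generating triple with product `1` have sum less
than `229 / 230`. -/
theorem IsTypeB.sum_orbitRatio_lt [Finite Ω] (hB : IsTypeB G Ω) (hM : IsMinimalNormal M)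
    (hN : IsMinimalNormal N) (hMN : M ≠ N) (hns : ¬ IsSimpleGroup M) {S : Fin 3 → G}
    (hS : IsProductOneSystem S) : ∑ i, orbitRatio Ω (S i) < 229 / 230 := by
  have hNn := hN.normal
  have hA := hM.map_mk hN hMN
  have hAn := hA.normal
  have hprod : S 0 * S 1 * S 2 = 1 := by
    have := hS.prod_eq_one
    simpa [List.ofFn_succ, mul_assoc] using this
  have hgen : Subgroup.closure {S 0, S 1, S 2} = ⊤ := by
    rw [← hS.generates]
    congr 1
    ext s
    simp [Fin.exists_fin_succ, eq_comm]
  have hT : IsTriple (QuotientGroup.mk' N (S 0)) (QuotientGroup.mk' N (S 1))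
      (QuotientGroup.mk' N (S 2)) := by
    refine ⟨by rw [← map_mul, ← map_mul, hprod, map_one], ?_⟩
    have := congrArg (Subgroup.map (QuotientGroup.mk' N)) hgen
    rw [MonoidHom.map_closure, Subgroup.map_top_of_surjective _ (QuotientGroup.mk'_surjective N)] at this
    rw [← this]
    congr 1
    simp [Set.image_insert_eq]
  have hab : ∃ a ∈ M.map (QuotientGroup.mk' N), ∃ b ∈ M.map (QuotientGroup.mk' N), a * b ≠ b * a := by
    obtain ⟨a, ha, b, hb, hne⟩ := hB.exists_not_commute hM hN hMN
    refine ⟨_, Subgroup.mem_map_of_mem _ ha, _, Subgroup.mem_map_of_mem _ hb, fun h => hne ?_⟩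
    rw [← map_mul, ← map_mul] at h
    exact hM.mk_injOn hN hMN (M.mul_mem ha hb) (M.mul_mem hb ha) h
  have hAs : ¬ IsSimpleGroup (M.map (QuotientGroup.mk' N)) := by
    intro hs
    apply hns
    let F : M →* M.map (QuotientGroup.mk' N) := (QuotientGroup.mk' N).subgroupMap M
    have hF : Function.Bijective F := by
      refine ⟨fun m m' h => Subtype.ext (hM.mk_injOn hN hMN m.2 m'.2 (congrArg Subtype.val h)), ?_⟩
      exact MonoidHom.subgroupMap_surjective _ _
    exact (MulEquiv.ofBijective F hF).isSimpleGroup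
  obtain ⟨T₀, T, hι, hfac⟩ := exists_isFactorSystem hA hab (hB.centralizer_map_mk hM hN hMN) hAs
  have := hfac.sum_avgFix_lt hT
  rw [Fin.sum_univ_three]
  linarith [hB.orbitRatio_le_avgFix hM hN hMN (S 0), hB.orbitRatio_le_avgFix hM hN hMN (S 1),
    hB.orbitRatio_le_avgFix hM hN hMN (S 2)]

end OrbitRatio

end LowGenus

theorem proposition3p3 {G : Type u} {Ω : Type v} [Group G] [Finite Ω] [MulAction G Ω]
    (hB : LowGenus.IsTypeB G Ω) (S : Fin 3 → G) (g : ℕ)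
    (hS : LowGenus.IsGenusSystem Ω S g)
    (hg : (g : ℚ) ≤ 1 + (Nat.card Ω : ℚ) / 460) :
    ∃ (L : Type u) (_ : Group L), Finite L ∧ IsSimpleGroup L ∧
      (∃ a b : L, a * b ≠ b * a) ∧ Nonempty (LowGenus.socle G ≃* L × L) := by
  have hG := hB.finite
  obtain ⟨M, N, hM, hN, hMN⟩ := hB.exists_two_minimal_normal
  by_cases hs : IsSimpleGroup M
  · obtain ⟨a, ha, b, hb, hab⟩ := hB.exists_not_commute hM hN hMN
    exact ⟨M, inferInstance, inferInstance, hs,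
      ⟨⟨a, ha⟩, ⟨b, hb⟩, fun h => hab (congrArg Subtype.val h)⟩,
      hB.nonempty_socle_mulEquiv hM hN hMN⟩
  · exfalso
    have h1 := hB.sum_orbitRatio_lt hM hN hMN hs hS.toIsProductOneSystem
    rw [hS.riemann_hurwitz] at h1
    have hΩ := hB.nonempty
    have hn : (0 : ℚ) < Nat.card Ω := by exact_mod_cast Nat.card_pos
    have h2 : -(1 / 230) ≤ 2 * (1 - (g : ℚ)) / (Nat.card Ω : ℚ) := by
      rw [le_div_iff₀ hn]
      linarith
    push_cast at h1
    linarith
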